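/- **Theorem 3.2 (Mode stability on the real axis).** Let $M>0$ and $a,Q\in\mathbb R$ with $a^2+Q^2<M^2$. Put $r_\pm=M\pm\sqrt{M^2-a^2-Q^2}$, $\Delta=r^2-2Mr+a^2+Q^2$, $\rho^2=r^2+a^2\cos^2\theta$, and let $r^*$ be a primitive of $(r^2+a^2)/\Delta$ on $(r_+,\infty)$. Let $\mathcal M=\{(t,r,\theta,\phi)\in\mathbb R\times(r_+,\infty)\times\mathbb S^2\}$ be the exterior of the subextremal Kerr–Newman black hole, with the metric $$g=-\frac{\Delta}{\rho^2}\big(dt-a\sin^2\theta\,d\phi\big)^2+\frac{\sin^2\theta}{\rho^2}\big((r^2+a^2)\,d\phi-a\,dt\big)^2+\frac{\rho^2}{\Delta}\,dr^2+\rho^2\,d\theta^2 .$$ A smooth solution $\psi:\mathcal M\to\mathbb C$ of the wave equation $\square_g\psi=0$ is called a *mode solution* with frequency $\omega\in\mathbb C\setminus\{0\}$ if there are $m\in\mathbb Z$, $\lambda\in\mathbb C$ and functions $R$ on $(r_+,\infty)$ and $S$ on $(0,\pi)$ such that $$\psi(t,r,\theta,\phi)=R(r)\,S(\theta)\,e^{im\phi}e^{-i\omega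 t}$$ and 1. $S$ is an eigenfunction (in particular $S\not\equiv0$) with eigenvalue $\lambda$ of $$\frac1{\sin\theta}\frac{d}{d\theta}\Big(\sin\theta\,\frac{dS}{d\theta}\Big)-\Big(\frac{m^2}{\sin^2\theta}-a^2\omega^2\cos^2\theta\Big)S+\lambda S=0\quad\text{on }(0,\pi),$$ with the boundary condition that $e^{im\phi}S(\theta)$ extends smoothly to $\mathbb S^2$; 2. $R$ solves, on $(r_+,\infty)$, $$\frac{d}{dr}\Big(\Delta\frac{dR}{dr}\Big)+\Big[-\omega^2\Big(a^2-\frac{(a^2+r^2)^2}{\Delta}\Big)+\frac{a^2m^2}{\Delta}-\frac{2am\omega(2Mr-Q^2)}{\Delta}-\lambda\Big]R=0;$$ 3. $R(r)\,(r-r_+)^{-\xi}$ is smooth at $r=r_+$, where $\xi=\dfrac{i\,(am-(2Mr_+-Q^2)\omega)}{r_+-r_-}$; 4. there are constants $(C_k)_{k\ge0}$ such that for every $N\ge1$, as $r\to\infty$, $$R(r)=\frac{e^{i\omega r^*(r)}}{r}\sum_{k=0}^N C_k\,r^{-k}+O(r^{-N-2}).$$ Then there are no non-trivial mode solutions with $\omega\in\mathbb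 R\setminus\{0\}$: every mode solution with real frequency $\omega\neq0$ vanishes identically on $\mathcal M$. -/

import Mathlib

namespace KerrNewman

open scoped Manifold Topology
open Filter Set

noncomputable section

/-- The outer root `r₊ = M + √(M² - a² - Q²)` of `Δ` (the radius of the event horizon). -/
def rPlus (M a Q : ℝ) : ℝ := M + Real.sqrt (M ^ 2 - a ^ 2 - Q ^ 2)

/-- The inner root `r₋ = M - √(M² - a² - Q²)` of `Δ`. -/
def rMinus (M a Q : ℝ) : ℝ := M - Real.sqrt (M ^ 2 - a ^ 2 - Q ^ 2)

/-- `Δ = r² - 2Mr + a² + Q²`. -/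
def Delta (M a Q r : ℝ) : ℝ := r ^ 2 - 2 * M * r + a ^ 2 + Q ^ 2

/-- `ρ² = r² + a² cos² θ`. -/
def rhoSq (a r θ : ℝ) : ℝ := r ^ 2 + a ^ 2 * Real.cos θ ^ 2

/-- The unit sphere in `ℝ³`. -/
abbrev S2 : Type := Metric.sphere (0 : EuclideanSpace ℝ (Fin 3)) 1

/-- The point of the unit sphere with polar angle `θ` and azimuth `φ`. -/
def spherePoint (θ φ : ℝ) : S2 :=
  ⟨!₂[Real.sin θ * Real.cos φ, Real.sin θ * Real.sin φ, Real.cos θ], by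
    rw [mem_sphere_zero_iff_norm, EuclideanSpace.norm_eq, Real.sqrt_eq_one]
    simp only [Fin.sum_univ_three, Real.norm_eq_abs, sq_abs]
    simp
    nlinarith [Real.sin_sq_add_cos_sq θ, Real.sin_sq_add_cos_sq φ]⟩

/-- The exterior `{(t, r, y) : r > r₊}`, `y` in the unit sphere. -/
def exterior (M a Q : ℝ) : Set (ℝ × ℝ × S2) := {p | rPlus M a Q < p.2.1}

/-- The Kerr–Newman metric in Boyer–Lindquist coordinates `x = (t, r, θ, φ)`:
`-(Δ/ρ²)(dt - a sin²θ dφ)² + (sin²θ/ρ²)((r²+a²)dφ - a dt)² + (ρ²/Δ)dr² + ρ² dθ²`. -/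
def metric (M a Q : ℝ) (x : Fin 4 → ℝ) : Matrix (Fin 4) (Fin 4) ℝ :=
  let r := x 1
  let θ := x 2
  let α : Fin 4 → ℝ := ![1, 0, 0, -(a * Real.sin θ ^ 2)]
  let β : Fin 4 → ℝ := ![-a, 0, 0, r ^ 2 + a ^ 2]
  (-(Delta M a Q r / rhoSq a r θ)) • Matrix.vecMulVec α α
    + (Real.sin θ ^ 2 / rhoSq a r θ) • Matrix.vecMulVec β β
    + Matrix.diagonal ![0, rhoSq a r θ / Delta M a Q r, rhoSq a r θ, 0]

/-- The coordinate partial derivative `∂_μ f`. -/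
def partialDeriv (μ : Fin 4) (f : (Fin 4 → ℝ) → ℂ) (x : Fin 4 → ℝ) : ℂ :=
  fderiv ℝ f x (Pi.single μ 1)

/-- The wave operator of a metric `g` in coordinates:
`□_g f = |det g|^{-1/2} ∂_μ (|det g|^{1/2} g^{μν} ∂_ν f)`. -/
def box (g : (Fin 4 → ℝ) → Matrix (Fin 4) (Fin 4) ℝ) (f : (Fin 4 → ℝ) → ℂ)
    (x : Fin 4 → ℝ) : ℂ :=
  (((Real.sqrt |(g x).det|)⁻¹ : ℝ) : ℂ) *
    ∑ μ, partialDeriv μ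
      (fun y => ((Real.sqrt |(g y).det| : ℝ) : ℂ) *
        ∑ ν, (((g y)⁻¹ μ ν : ℝ) : ℂ) * partialDeriv ν f y) x

/-- A function on the spacetime, written in Boyer–Lindquist coordinates `(t, r, θ, φ)`. -/
def inCoords (ψ : ℝ × ℝ × S2 → ℂ) (x : Fin 4 → ℝ) : ℂ :=
  ψ (x 0, x 1, spherePoint (x 2) (x 3))

/-- `ψ` is a smooth solution of the wave equation `□_g ψ = 0` on the exterior. (The equation is
imposed off the axis, where the coordinates are regular; by continuity this is no restriction.) -/
def IsSmoothWave (M a Q : ℝ) (ψ : ℝ × ℝ × S2 → ℂ) : Prop :=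
  ContMDiffOn (𝓘(ℝ, ℝ).prod (𝓘(ℝ, ℝ).prod (𝓡 2))) 𝓘(ℝ, ℂ)
    ((⊤ : ℕ∞) : WithTop ℕ∞) ψ (exterior M a Q) ∧
  ∀ x : Fin 4 → ℝ, rPlus M a Q < x 1 → x 2 ∈ Ioo 0 Real.pi →
    box (metric M a Q) (inCoords ψ) x = 0

/-- The tortoise coordinate `r*`, a primitive of `(r² + a²)/Δ` on `(r₊, ∞)`. -/
def rStar (M a Q r : ℝ) : ℝ :=
  r + (rPlus M a Q ^ 2 + a ^ 2) / (rPlus M a Q - rMinus M a Q) * Real.log (r - rPlus M a Q)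
    - (rMinus M a Q ^ 2 + a ^ 2) / (rPlus M a Q - rMinus M a Q) * Real.log (r - rMinus M a Q)

theorem hasDerivAt_rStar {M a Q r : ℝ} (h : a ^ 2 + Q ^ 2 < M ^ 2) (hr : rPlus M a Q < r) :
    HasDerivAt (rStar M a Q) ((r ^ 2 + a ^ 2) / Delta M a Q r) r := by
  have hs : 0 < Real.sqrt (M ^ 2 - a ^ 2 - Q ^ 2) := Real.sqrt_pos.2 (by linarith)
  have hs2 : Real.sqrt (M ^ 2 - a ^ 2 - Q ^ 2) ^ 2 = M ^ 2 - a ^ 2 - Q ^ 2 :=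
    Real.sq_sqrt (by linarith)
  have hD : Delta M a Q r = (r - rPlus M a Q) * (r - rMinus M a Q) := by
    unfold Delta rPlus rMinus
    linear_combination hs2
  have hpm : rPlus M a Q - rMinus M a Q ≠ 0 := by
    unfold rPlus rMinus
    linarith
  have hp : r - rPlus M a Q ≠ 0 := by linarith
  have hm : r - rMinus M a Q ≠ 0 := by
    unfold rPlus at hr
    unfold rMinus
    linarith
  have key := ((hasDerivAt_id r).add ((((hasDerivAt_id r).sub_const (rPlus M a Q)).log hp).const_mul
    ((rPlus M a Q ^ 2 + a ^ 2) / (rPlus M a Q - rMinus M a Q)))).sub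
    ((((hasDerivAt_id r).sub_const (rMinus M a Q)).log hm).const_mul
    ((rMinus M a Q ^ 2 + a ^ 2) / (rPlus M a Q - rMinus M a Q)))
  refine key.congr_deriv ?_
  rw [hD]
  simp only [id]
  field_simp
  ring

/-- `S` is an eigenfunction with eigenvalue `lam` of the angular Sturm–Liouville problem
`(1/sin θ) d/dθ (sin θ dS/dθ) - (m²/sin²θ - a²ω²cos²θ) S + lam S = 0` on `(0, π)`, with the boundary
condition that `e^{imφ} S(θ)` extends smoothly to the sphere. -/
structure IsAngularEigenfunction (a : ℝ) (ω : ℂ) (m : ℤ) (lam : ℂ) (S : ℝ → ℂ) : Prop where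
  contDiffOn : ContDiffOn ℝ 2 S (Ioo 0 Real.pi)
  ode : ∀ θ ∈ Ioo 0 Real.pi,
    1 / (Real.sin θ : ℂ) * deriv (fun s : ℝ => (Real.sin s : ℂ) * deriv S s) θ
      - ((m : ℂ) ^ 2 / (Real.sin θ : ℂ) ^ 2 - (a : ℂ) ^ 2 * ω ^ 2 * (Real.cos θ : ℂ) ^ 2) * S θ
      + lam * S θ = 0
  smooth_extension : ∃ Y : S2 → ℂ, ContMDiff (𝓡 2) 𝓘(ℝ, ℂ) ((⊤ : ℕ∞) : WithTop ℕ∞) Y ∧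
    ∀ θ ∈ Ioo 0 Real.pi, ∀ φ : ℝ,
      Y (spherePoint θ φ) = Complex.exp (Complex.I * m * φ) * S θ
  nonzero : ∃ θ ∈ Ioo 0 Real.pi, S θ ≠ 0

/-- `R` is a (classical) solution on `(r₊, ∞)` of the radial equation. -/
structure IsRadialSolution (M a Q : ℝ) (ω : ℂ) (m : ℤ) (lam : ℂ) (R : ℝ → ℂ) : Prop where
  contDiffOn : ContDiffOn ℝ 2 R (Ioi (rPlus M a Q))
  ode : ∀ r > rPlus M a Q,
    deriv (fun s : ℝ => (Delta M a Q s : ℂ) * deriv R s) r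
      + (-(ω ^ 2 * ((a : ℂ) ^ 2 - ((a : ℂ) ^ 2 + (r : ℂ) ^ 2) ^ 2 / (Delta M a Q r : ℂ)))
        + (a : ℂ) ^ 2 * (m : ℂ) ^ 2 / (Delta M a Q r : ℂ)
        - 2 * a * m * ω * (2 * M * r - (Q : ℂ) ^ 2) / (Delta M a Q r : ℂ)
        - lam) * R r = 0

/-- The exponent `i(am - (2Mr₊ - Q²)ω)/(r₊ - r₋)`. -/
def horizonExponent (M a Q : ℝ) (ω : ℂ) (m : ℤ) : ℂ :=
  Complex.I * (a * m - (2 * M * rPlus M a Q - (Q : ℂ) ^ 2) * ω) /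
    ((rPlus M a Q - rMinus M a Q : ℝ) : ℂ)

/-- The boundary condition at the horizon: `R(r) (r - r₊)^{-ξ}`, with `ξ` the horizon exponent,
is smooth at `r = r₊`, i.e. it agrees for `r > r₊` near `r₊` with a function smooth at `r₊`. -/
def RegularAtHorizon (M a Q : ℝ) (ω : ℂ) (m : ℤ) (R : ℝ → ℂ) : Prop :=
  ∃ f : ℝ → ℂ, ContDiffAt ℝ ((⊤ : ℕ∞) : WithTop ℕ∞) f (rPlus M a Q) ∧
    ∀ᶠ r in 𝓝[>] (rPlus M a Q),
      R r * ((r - rPlus M a Q : ℝ) : ℂ) ^ (-horizonExponent M a Q ω m) = f r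

/-- The boundary condition at infinity: there are constants `C k` such that for every `N ≥ 1`,
`R = (e^{iωr*}/r) ∑_{k=0}^N C k r^{-k} + O(r^{-N-2})` for large `r`. -/
def OutgoingAtInfinity (M a Q : ℝ) (ω : ℂ) (R : ℝ → ℂ) : Prop :=
  ∃ C : ℕ → ℂ, ∀ N : ℕ, 1 ≤ N →
    (fun r : ℝ => R r - Complex.exp (Complex.I * ω * rStar M a Q r) / r *
        ∑ k ∈ Finset.range (N + 1), C k * ((r : ℂ) ^ k)⁻¹)
      =O[atTop] fun r : ℝ => (r ^ (N + 2))⁻¹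

/-- `ψ` is a mode solution of the wave equation with frequency `ω ≠ 0`: a smooth solution of the
form `ψ = R(r) S(θ) e^{imφ} e^{-iωt}`, where `S` is an eigenfunction of the angular problem, `R`
solves the radial equation with the same eigenvalue, and `R` satisfies the boundary conditions at
the horizon and at infinity. The label `ℓ ≥ |m|` only enumerates the eigenvalues for given `m`,
so here the eigenvalue `lam` itself is quantified over. -/
def IsModeSolution (M a Q : ℝ) (ψ : ℝ × ℝ × S2 → ℂ) (ω : ℂ) : Prop :=
  IsSmoothWave M a Q ψ ∧ ω ≠ 0 ∧
  ∃ (m : ℤ) (lam : ℂ) (R S : ℝ → ℂ),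
    (∀ t : ℝ, ∀ r > rPlus M a Q, ∀ θ ∈ Ioo 0 Real.pi, ∀ φ : ℝ,
      ψ (t, r, spherePoint θ φ) =
        R r * S θ * Complex.exp (Complex.I * m * φ) * Complex.exp (-(Complex.I * ω * t))) ∧
    IsAngularEigenfunction a ω m lam S ∧
    IsRadialSolution M a Q ω m lam R ∧
    RegularAtHorizon M a Q ω m R ∧
    OutgoingAtInfinity M a Q ω R

end

end KerrNewman

/-! A flux identity for the radial function itself is not enough: the horizon term has the sign of
`ω (am - (r₊² + a²) ω)`, which is indefinite in the superradiant regime. The remedy, in the spirit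
of Whiting, is an integral transform after which the boundary term has a definite sign.

With `s = r₊ - r₋`, `r = r₊ + s z` and a suitable real phase `θ`, the function `f = e^{iθ} R` solves
a confluent Heun equation on `(0, ∞)` with real parameters `Ω = 2ωs`, `α`, `γ`, `Λ`. Reality of `Λ`
uses that the angular eigenvalue is real (`IsAngularEigenfunction.im_eq_zero`). The phase cancels
the outgoing oscillation, so `(1 + z) f` converges at infinity, and it doubles the horizon exponent,
so `f = z^{2iα} h` with `h` smooth at `0`.

The Laplace transform `F(p) = ∫ e^{pz} f dz`, `Re p < 0`, satisfies a second order equation with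
singular points `0` and `iΩ` (`IsHeunSolution.laplace_ode`). On the line `p = iΩv` that equation has
again the Heun shape with a real potential, so the flux `Im ((v(v-1) F_v + i(Ω v(v-1)/2 + μv) F)
conj F)`, `μ = α + γ`, is constant in `v`. At `v = 1` the derivative term drops out and `Ω` times
the flux is `Ωμ|F|²`. Here `Ωμ = -4Mω²s ≤ 0`: the azimuthal number has cancelled, and superradiance
with it. As `v → ∞`, `F` behaves like `h(0) Γ(a) (1 - p)^{-a}` with `a = 1 + 2iα`, while `F_p =
O(|p|⁻²)`, so `Ω` times the flux tends to `(Ω²/2) lim |vF|²`, a nonnegative multiple of `|h(0)|²`.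
Hence `h(0) = 0` (`IsHeunSolution.leading_eq_zero`).

No boundary values on the imaginary axis are taken. The argument runs on `p = iΩv - ε`, where the
flux is conserved up to `O(ε)`, with bounds uniform in `ε`; the interval `[1, V]` is fixed first and
`ε` is then chosen small in terms of `V`.

Finally, a solution whose leading coefficient at the regular singular point `0` vanishes is zero
(`IsHeunSolution.eq_zero_of_leading`). So `R = 0`, and `ψ = 0` off the axis, hence everywhere by
continuity. -/

section ConfluentHeun

/-! ### Functions of polynomial growth against a decaying exponential -/

open Filter Set Topology MeasureTheory

/-- Continuous functions on `(0, ∞)` that are bounded by a polynomial. -/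
structure IsModerate (φ : ℝ → ℂ) : Prop where
  continuousOn : ContinuousOn φ (Ioi 0)
  bound : ∃ (C : ℝ) (n : ℕ), ∀ z > 0, ‖φ z‖ ≤ C * (1 + z) ^ n

/-- The Laplace transform `p ↦ ∫₀^∞ e^{pz} φ(z) dz`, convergent for `Re p < 0`. -/
noncomputable def laplace (φ : ℝ → ℂ) (p : ℂ) : ℂ :=
  ∫ z in Ioi (0 : ℝ), Complex.exp (p * z) * φ z

namespace IsModerate

variable {φ χ : ℝ → ℂ}

theorem congr (hφ : IsModerate φ) (h : ∀ z > 0, χ z = φ z) : IsModerate χ := by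
  refine ⟨hφ.continuousOn.congr fun z hz => h z hz, ?_⟩
  obtain ⟨C, n, hC⟩ := hφ.bound
  exact ⟨C, n, fun z hz => by rw [h z hz]; exact hC z hz⟩

theorem of_bounded (hc : ContinuousOn φ (Ioi 0)) (C : ℝ) (hC : ∀ z > 0, ‖φ z‖ ≤ C) :
    IsModerate φ := ⟨hc, C, 0, fun z hz => by simpa using hC z hz⟩

theorem const (c : ℂ) : IsModerate fun _ => c :=
  of_bounded continuousOn_const ‖c‖ fun _ _ => le_rfl

theorem ofReal : IsModerate fun z => (z : ℂ) := by
  refine ⟨Complex.continuous_ofReal.continuousOn, 1, 1, fun z hz => ?_⟩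
  rw [Complex.norm_real, Real.norm_of_nonneg hz.le]
  linarith

theorem mul (hφ : IsModerate φ) (hχ : IsModerate χ) : IsModerate fun z => φ z * χ z := by
  obtain ⟨C, n, hC⟩ := hφ.bound
  obtain ⟨D, k, hD⟩ := hχ.bound
  refine ⟨hφ.continuousOn.mul hχ.continuousOn, C * D, n + k, fun z hz => ?_⟩
  rw [norm_mul, pow_add]
  calc ‖φ z‖ * ‖χ z‖ ≤ (C * (1 + z) ^ n) * (D * (1 + z) ^ k) :=
        mul_le_mul (hC z hz) (hD z hz) (norm_nonneg _) ((norm_nonneg _).trans (hC z hz))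
    _ = _ := by ring

theorem add (hφ : IsModerate φ) (hχ : IsModerate χ) : IsModerate fun z => φ z + χ z := by
  obtain ⟨C, n, hC⟩ := hφ.bound
  obtain ⟨D, k, hD⟩ := hχ.bound
  refine ⟨hφ.continuousOn.add hχ.continuousOn, |C| + |D|, n + k, fun z hz => ?_⟩
  have h1 : (1 + z) ^ n ≤ (1 + z) ^ (n + k) := pow_le_pow_right₀ (by linarith) (by omega)
  have h2 : (1 + z) ^ k ≤ (1 + z) ^ (n + k) := pow_le_pow_right₀ (by linarith) (by omega)
  have h3 : 0 ≤ (1 + z) ^ n := by positivity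
  have h4 : 0 ≤ (1 + z) ^ k := by positivity
  calc ‖φ z + χ z‖ ≤ C * (1 + z) ^ n + D * (1 + z) ^ k :=
        (norm_add_le _ _).trans (add_le_add (hC z hz) (hD z hz))
    _ ≤ |C| * (1 + z) ^ (n + k) + |D| * (1 + z) ^ (n + k) := by
        refine add_le_add ((mul_le_mul_of_nonneg_right (le_abs_self C) h3).trans ?_)
          ((mul_le_mul_of_nonneg_right (le_abs_self D) h4).trans ?_)
        · gcongr
        · gcongr
    _ = _ := by ring

theorem const_mul (hφ : IsModerate φ) (c : ℂ) : IsModerate fun z => c * φ z := (const c).mul hφ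

theorem mul_ofReal (hφ : IsModerate φ) : IsModerate fun z => (z : ℂ) * φ z := ofReal.mul hφ

theorem of_bounds (hc : ContinuousOn φ (Ioi 0)) {δ C D : ℝ} (hδ : 0 < δ) (n : ℕ)
    (h0 : ∀ z ∈ Ioo 0 δ, ‖φ z‖ ≤ C) (h1 : ∀ z ≥ 1, ‖φ z‖ ≤ D * (1 + z) ^ n) :
    IsModerate φ := by
  obtain ⟨B, hB⟩ := (isCompact_Icc (a := δ) (b := 1)).exists_bound_of_continuousOn
    (hc.mono fun z hz => hδ.trans_le hz.1)
  refine ⟨hc, max C (max B D), n, fun z hz => ?_⟩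
  have hp : 1 ≤ (1 + z) ^ n := one_le_pow₀ (by linarith)
  have key : ∀ E, ‖φ z‖ ≤ E → ‖φ z‖ ≤ E * (1 + z) ^ n := fun E hE =>
    hE.trans (le_mul_of_one_le_right ((norm_nonneg _).trans hE) hp)
  have hp' : 0 ≤ (1 + z) ^ n := by linarith
  rcases lt_or_ge z δ with h | h
  · exact (key _ (h0 z ⟨hz, h⟩)).trans (mul_le_mul_of_nonneg_right (le_max_left _ _) hp')
  rcases le_or_gt z 1 with h' | h'
  · exact (key _ (hB z ⟨h, h'⟩)).trans (mul_le_mul_of_nonneg_right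
      ((le_max_left _ _).trans (le_max_right _ _)) hp')
  · exact (h1 z h'.le).trans (mul_le_mul_of_nonneg_right
      ((le_max_right _ _).trans (le_max_right _ _)) hp')

theorem integrableOn_of_decay (hφ : IsModerate φ) {D : ℝ} (h1 : ∀ z ≥ 1, ‖φ z‖ ≤ D / z ^ 2) :
    IntegrableOn φ (Ioi 0) := by
  obtain ⟨C, n, hC⟩ := hφ.bound
  rw [← Ioc_union_Ioi_eq_Ioi (zero_le_one' ℝ)]
  refine IntegrableOn.union ?_ ?_
  · refine IntegrableOn.of_bound (by simp)
      ((hφ.continuousOn.mono Ioc_subset_Ioi_self).aestronglyMeasurable measurableSet_Ioc)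
      (|C| * 2 ^ n) ?_
    refine (ae_restrict_mem measurableSet_Ioc).mono fun z hz => (hC z hz.1).trans ?_
    have : (1 + z) ^ n ≤ 2 ^ n := pow_le_pow_left₀ (by linarith [hz.1]) (by linarith [hz.2]) n
    have h0 : 0 ≤ (1 + z) ^ n := pow_nonneg (by linarith [hz.1]) n
    exact mul_le_mul (le_abs_self C) this h0 (abs_nonneg _)
  · have hi := (integrableOn_Ioi_rpow_of_lt (a := -2) (by norm_num) one_pos).const_mul D
    refine hi.mono' ((hφ.continuousOn.mono (Ioi_subset_Ioi zero_le_one)).aestronglyMeasurable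
      measurableSet_Ioi) ((ae_restrict_mem measurableSet_Ioi).mono fun z hz => ?_)
    refine (h1 z (le_of_lt hz)).trans (le_of_eq ?_)
    have hz0 : (0 : ℝ) < z := zero_lt_one.trans hz
    rw [Real.rpow_neg hz0.le, div_eq_mul_inv]
    norm_num

theorem tendsto_pow_mul_exp {ε : ℝ} (hε : 0 < ε) (C : ℝ) (n : ℕ) :
    Tendsto (fun z : ℝ => Real.exp (-ε * z) * (C * (1 + z) ^ n)) atTop (𝓝 0) := by
  have h := (Real.tendsto_pow_mul_exp_neg_atTop_nhds_zero n).comp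
    ((tendsto_atTop_add_const_left atTop (1 : ℝ) tendsto_id).const_mul_atTop hε)
  have h2 := h.const_mul (C * Real.exp ε / ε ^ n)
  rw [mul_zero] at h2
  refine h2.congr fun z => ?_
  simp only [Function.comp, id, mul_pow]
  have : Real.exp (-(ε * (1 + z))) = Real.exp (-ε * z) / Real.exp ε := by
    rw [← Real.exp_sub]; ring_nf
  rw [this]
  field_simp

theorem norm_exp_mul (p : ℂ) (z : ℝ) : ‖Complex.exp (p * z)‖ = Real.exp (p.re * z) := by
  rw [Complex.norm_exp]; simp

theorem integrableOn_exp (hφ : IsModerate φ) {p : ℂ} (hp : p.re < 0) :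
    IntegrableOn (fun z : ℝ => Complex.exp (p * z) * φ z) (Ioi 0) := by
  obtain ⟨C, n, hC⟩ := hφ.bound
  have hε : 0 < -p.re / 2 := by linarith
  have hb : IsModerate fun z : ℝ => Complex.exp (p * z) * φ z :=
    (of_bounded (by fun_prop) 1 fun z hz => by
      rw [norm_exp_mul, Real.exp_le_one_iff]; nlinarith).mul hφ
  have ht := (tendsto_pow_mul_exp (ε := -p.re) (by linarith) C (n + 2)).eventually
    (eventually_le_nhds one_pos)
  obtain ⟨A, hA⟩ := eventually_atTop.1 ht
  obtain ⟨B, hB⟩ := (isCompact_Icc (a := (1 : ℝ)) (b := max A 1)).exists_bound_of_continuousOn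
    (hb.continuousOn.mono fun z hz => (zero_lt_one' ℝ).trans_le hz.1)
  refine hb.integrableOn_of_decay (D := max 1 (B * (max A 1) ^ 2)) fun z hz => ?_
  have hz0 : 0 < z := by linarith
  rw [le_div_iff₀ (by positivity)]
  rcases le_or_gt z (max A 1) with h | h
  · refine le_trans ?_ (le_max_right _ _)
    have := hB z ⟨hz, h⟩
    have hB0 : 0 ≤ B := (norm_nonneg _).trans this
    gcongr
  · refine le_trans ?_ (le_max_left _ _)
    refine le_trans ?_ (hA z ((le_max_left _ _).trans h.le))
    rw [norm_mul, norm_exp_mul, neg_neg, mul_assoc]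
    refine mul_le_mul_of_nonneg_left ?_ (Real.exp_pos _).le
    rw [pow_add, ← mul_assoc]
    refine mul_le_mul (hC z hz0) (pow_le_pow_left₀ hz0.le (by linarith) 2) (by positivity) ?_
    exact (norm_nonneg _).trans (hC z hz0)

theorem tendsto_exp_mul (hφ : IsModerate φ) {p : ℂ} (hp : p.re < 0) :
    Tendsto (fun z : ℝ => Complex.exp (p * z) * φ z) atTop (𝓝 0) := by
  obtain ⟨C, n, hC⟩ := hφ.bound
  refine squeeze_zero_norm' ?_ (tendsto_pow_mul_exp (ε := -p.re) (by linarith) C n)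
  filter_upwards [eventually_gt_atTop 0] with z hz
  rw [norm_mul, norm_exp_mul, neg_neg]
  exact mul_le_mul_of_nonneg_left (hC z hz) (Real.exp_pos _).le

end IsModerate

/-! ### Laplace transform calculus and the model functions `z^{a-1} e^{-z}` -/

section Laplace

variable {φ χ : ℝ → ℂ} {p : ℂ}

theorem laplace_congr (h : ∀ z > 0, φ z = χ z) (p : ℂ) : laplace φ p = laplace χ p :=
  setIntegral_congr_fun measurableSet_Ioi fun z hz => by simp only [h z hz]

theorem laplace_add (hφ : IsModerate φ) (hχ : IsModerate χ) (hp : p.re < 0) :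
    laplace (fun z => φ z + χ z) p = laplace φ p + laplace χ p := by
  unfold laplace
  rw [← integral_add (hφ.integrableOn_exp hp) (hχ.integrableOn_exp hp)]
  simp only [mul_add]

theorem laplace_const_mul (c : ℂ) : laplace (fun z => c * φ z) p = c * laplace φ p := by
  unfold laplace
  rw [← integral_const_mul]
  simp only [mul_left_comm]

theorem hasDerivAt_laplace (hφ : IsModerate φ) (hp : p.re < 0) :
    HasDerivAt (laplace φ) (laplace (fun z => z * φ z) p) p := by
  have hp2 : ((p.re / 2 : ℝ) : ℂ).re < 0 := by simp; linarith
  have hb := (hφ.mul_ofReal.integrableOn_exp hp2).norm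
  have hm : ∀ q : ℂ, AEStronglyMeasurable (fun z : ℝ => Complex.exp (q * z) * φ z)
      (volume.restrict (Ioi 0)) := fun q =>
    (ContinuousOn.mul (by fun_prop) hφ.continuousOn).aestronglyMeasurable measurableSet_Ioi
  have hs : {q : ℂ | q.re < p.re / 2} ∈ 𝓝 p :=
    (isOpen_lt Complex.continuous_re continuous_const).mem_nhds (by simp; linarith)
  refine (hasDerivAt_integral_of_dominated_loc_of_deriv_le
    (F := fun (q : ℂ) (z : ℝ) => Complex.exp (q * z) * φ z)
    (F' := fun (q : ℂ) (z : ℝ) => Complex.exp (q * z) * (z * φ z)) hs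
    (Eventually.of_forall hm) (hφ.integrableOn_exp hp)
    (hφ.mul_ofReal.integrableOn_exp hp).aestronglyMeasurable
    ((ae_restrict_mem measurableSet_Ioi).mono fun z hz q hq => ?_) hb ?_).2
  · rw [norm_mul, norm_mul (Complex.exp _), IsModerate.norm_exp_mul, IsModerate.norm_exp_mul]
    refine mul_le_mul_of_nonneg_right (Real.exp_le_exp.2 ?_) (norm_nonneg _)
    exact mul_le_mul_of_nonneg_right (by simpa using le_of_lt hq) (le_of_lt hz)
  · refine Eventually.of_forall fun z q _ => ?_
    have := ((hasDerivAt_id q).mul_const (z : ℂ)).cexp.mul_const (φ z)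
    refine this.congr_deriv ?_
    simp only [id]; ring

/-- Integration by parts for the Laplace transform of a function vanishing at `0`. -/
theorem laplace_deriv (hφ : IsModerate φ) (hχ : IsModerate χ)
    (hd : ∀ z > 0, HasDerivAt φ (χ z) z) (h0 : Tendsto φ (𝓝[>] 0) (𝓝 0)) (hp : p.re < 0) :
    laplace χ p = -p * laplace φ p := by
  have hu : ∀ x ∈ Ioi (0 : ℝ), HasDerivAt (fun z : ℝ => Complex.exp (p * z))
      (p * Complex.exp (p * x)) x := fun x _ => by
    have := ((hasDerivAt_id (x : ℂ)).const_mul p).cexp.comp_ofReal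
    refine this.congr_deriv ?_
    simp [mul_comm]
  have h0' : Tendsto ((fun z : ℝ => Complex.exp (p * z)) * φ) (𝓝[>] 0) (𝓝 0) := by
    have : Tendsto (fun z : ℝ => Complex.exp (p * z)) (𝓝[>] 0) (𝓝 (Complex.exp (p * (0 : ℝ)))) :=
      (Continuous.tendsto (by fun_prop) 0).mono_left nhdsWithin_le_nhds
    have h := this.mul h0
    rw [mul_zero] at h
    exact h
  have h1 : IntegrableOn ((fun z : ℝ => p * Complex.exp (p * z)) * φ) (Ioi 0) :=
    ((hφ.integrableOn_exp hp).const_mul p).congr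
      (Eventually.of_forall fun z => by simp [mul_assoc])
  have h2 := integral_Ioi_mul_deriv_eq_deriv_mul hu hd (hχ.integrableOn_exp hp) h1 h0'
    (hφ.tendsto_exp_mul hp)
  unfold laplace
  rw [h2]
  simp only [mul_assoc, integral_const_mul]
  ring

theorem norm_laplace_le (hφ : IntegrableOn φ (Ioi 0)) (hp : p.re < 0) :
    ‖laplace φ p‖ ≤ ∫ z in Ioi (0 : ℝ), ‖φ z‖ := by
  refine norm_integral_le_of_norm_le hφ.norm
    ((ae_restrict_mem measurableSet_Ioi).mono fun z hz => ?_)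
  rw [norm_mul, IsModerate.norm_exp_mul]
  refine mul_le_of_le_one_left (norm_nonneg _) (Real.exp_le_one_iff.2 ?_)
  exact mul_nonpos_of_nonpos_of_nonneg hp.le (le_of_lt hz)

/-- The Laplace transform of a function that vanishes to second order at `0` and has integrable
second derivative is `O(|p|⁻²)`. -/
theorem exists_norm_laplace_le {φ₁ φ₂ : ℝ → ℂ} (hφ : IsModerate φ) (hφ₁ : IsModerate φ₁)
    (hφ₂ : IsModerate φ₂) (hd : ∀ z > 0, HasDerivAt φ (φ₁ z) z)
    (hd₁ : ∀ z > 0, HasDerivAt φ₁ (φ₂ z) z) (h0 : Tendsto φ (𝓝[>] 0) (𝓝 0))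
    (h1 : Tendsto φ₁ (𝓝[>] 0) (𝓝 0)) (hi : IntegrableOn φ₂ (Ioi 0)) :
    ∃ C, ∀ p : ℂ, p.re < 0 → ‖laplace φ p‖ ≤ C / ‖p‖ ^ 2 := by
  refine ⟨∫ z in Ioi (0 : ℝ), ‖φ₂ z‖, fun p hp => ?_⟩
  have hp0 : p ≠ 0 := by rintro rfl; simp at hp
  have h := norm_laplace_le hi hp
  rw [laplace_deriv hφ₁ hφ₂ hd₁ h1 hp, laplace_deriv hφ hφ₁ hd h0 hp] at h
  rw [le_div_iff₀ (by positivity)]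
  refine le_trans (le_of_eq ?_) h
  simp only [norm_mul, norm_neg]
  ring

/-- The function `z^{a-1} e^{-z}` on `(0, ∞)`. -/
noncomputable def gammaKernel (a : ℂ) (z : ℝ) : ℂ := Complex.exp ((a - 1) * Real.log z - z)

theorem norm_gammaKernel (a : ℂ) {z : ℝ} (hz : 0 < z) :
    ‖gammaKernel a z‖ = z ^ (a.re - 1) * Real.exp (-z) := by
  unfold gammaKernel
  rw [Complex.norm_exp, Real.rpow_def_of_pos hz, ← Real.exp_add]
  congr 1
  rw [Complex.sub_re, Complex.re_mul_ofReal]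
  simp
  ring

theorem hasDerivAt_gammaKernel (a : ℂ) {z : ℝ} (hz : 0 < z) :
    HasDerivAt (gammaKernel a) (((a - 1) / z - 1) * gammaKernel a z) z := by
  have h1 := ((Real.hasDerivAt_log hz.ne').ofReal_comp).const_mul (a - 1)
  have h2 := (h1.sub (hasDerivAt_id z).ofReal_comp).cexp
  refine h2.congr_deriv ?_
  simp [gammaKernel, div_eq_mul_inv, mul_comm]

theorem mul_gammaKernel (a : ℂ) {z : ℝ} (hz : 0 < z) :
    (z : ℂ) * gammaKernel a z = gammaKernel (a + 1) z := by
  unfold gammaKernel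
  have : (z : ℂ) = Complex.exp (Real.log z) := by
    rw [← Complex.ofReal_exp, Real.exp_log hz]
  nth_rw 1 [this]
  rw [← Complex.exp_add]
  congr 1
  ring

theorem isModerate_gammaKernel {a : ℂ} (ha : 1 ≤ a.re) : IsModerate (gammaKernel a) := by
  obtain ⟨n, hn⟩ := exists_nat_ge (a.re - 1)
  refine ⟨fun z hz => (hasDerivAt_gammaKernel a hz).continuousAt.continuousWithinAt, 1, n,
    fun z hz => ?_⟩
  rw [norm_gammaKernel a hz, one_mul]
  calc z ^ (a.re - 1) * Real.exp (-z) ≤ z ^ (a.re - 1) * 1 := by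
        have : Real.exp (-z) ≤ 1 := Real.exp_le_one_iff.2 (by linarith)
        gcongr
    _ ≤ (1 + z) ^ (a.re - 1) := by
        rw [mul_one]; exact Real.rpow_le_rpow hz.le (by linarith) (by linarith)
    _ ≤ (1 + z) ^ (n : ℝ) := Real.rpow_le_rpow_of_exponent_le (by linarith) hn
    _ = _ := Real.rpow_natCast _ _

theorem tendsto_gammaKernel {a : ℂ} (ha : 1 < a.re) :
    Tendsto (gammaKernel a) (𝓝[>] 0) (𝓝 0) := by
  have h : Tendsto (fun z : ℝ => z ^ (a.re - 1)) (𝓝[>] 0) (𝓝 0) := by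
    have := (Real.continuousAt_rpow_const 0 (a.re - 1) (Or.inr (by linarith))).tendsto
    rw [Real.zero_rpow (by linarith)] at this
    exact this.mono_left nhdsWithin_le_nhds
  refine squeeze_zero_norm' ?_ h
  filter_upwards [self_mem_nhdsWithin] with z hz
  have hz : 0 < z := hz
  rw [norm_gammaKernel a hz]
  exact mul_le_of_le_one_right (by positivity) (Real.exp_le_one_iff.2 (by linarith))

/-- Integration by parts, since the derivative of `z^a e^{-z}` is `a z^{a-1} e^{-z} - z^a e^{-z}`.
The condition `1 ≤ a.re` keeps both kernels bounded near `0` and makes the boundary term vanish. -/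
theorem laplace_gammaKernel_succ {a : ℂ} (ha : 1 ≤ a.re) (hp : p.re < 0) :
    (1 - p) * laplace (gammaKernel (a + 1)) p = a * laplace (gammaKernel a) p := by
  have ha' : 1 ≤ (a + 1).re := by simp; linarith
  have hm := isModerate_gammaKernel ha
  have hm' := isModerate_gammaKernel ha'
  have h := laplace_deriv (χ := fun z => a * gammaKernel a z + (-1) * gammaKernel (a + 1) z) hm'
    ((hm.const_mul a).add (hm'.const_mul (-1)))
    (fun z hz => (hasDerivAt_gammaKernel (a + 1) hz).congr_deriv (by
      have : (z : ℂ) ≠ 0 := by exact_mod_cast hz.ne'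
      rw [← mul_gammaKernel a hz]; field_simp; ring))
    (tendsto_gammaKernel (by simp; linarith)) hp
  rw [laplace_add (hm.const_mul a) (hm'.const_mul (-1)) hp, laplace_const_mul,
    laplace_const_mul] at h
  linear_combination -h

/-- The recursion in `a` says exactly that the left side has zero derivative in `p`, so it is
constant on the half-plane. Its value is read off at `p = -1`, where the transform is the Gamma
integral with rate `1 - p = 2`. The principal power is harmless because `1 - p` has positive real
part. -/
theorem laplace_gammaKernel {a : ℂ} (ha : 1 ≤ a.re) (hp : p.re < 0) :
    (1 - p) ^ a * laplace (gammaKernel a) p = Complex.Gamma a := by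
  have hm := isModerate_gammaKernel ha
  have hslit : ∀ q : ℂ, q.re < 0 → 1 - q ∈ Complex.slitPlane := fun q hq =>
    Or.inl (by simp; linarith)
  have hder : ∀ q : ℂ, q.re < 0 →
      HasDerivAt (fun q => (1 - q) ^ a * laplace (gammaKernel a) q) 0 q := by
    intro q hq
    have h1 := (((hasDerivAt_id q).const_sub 1).cpow_const (c := a) (hslit q hq)).mul
      (hasDerivAt_laplace hm hq)
    refine h1.congr_deriv ?_
    simp only [id]
    rw [laplace_congr (fun z hz => mul_gammaKernel a hz)]
    have hq0 : 1 - q ≠ 0 := Complex.slitPlane_ne_zero (hslit q hq)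
    have h2 := laplace_gammaKernel_succ ha hq
    have h3 : (1 - q) ^ a = (1 - q) ^ (a - 1) * (1 - q) := by
      rw [Complex.cpow_sub _ _ hq0, Complex.cpow_one]; field_simp
    rw [h3]
    linear_combination (1 - q) ^ (a - 1) * h2
  have hopen : IsOpen {q : ℂ | q.re < 0} := isOpen_lt Complex.continuous_re continuous_const
  have hconn : IsPreconnected {q : ℂ | q.re < 0} := (convex_halfSpace_re_lt 0).isPreconnected
  have hconst := hopen.is_const_of_deriv_eq_zero hconn
    (fun q hq => (hder q hq).differentiableAt.differentiableWithinAt)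
    (fun q hq => (hder q hq).deriv) (show p ∈ {q : ℂ | q.re < 0} from hp)
    (show (-1 : ℂ) ∈ {q : ℂ | q.re < 0} by simp)
  refine hconst.trans ?_
  have hG := Complex.integral_cpow_mul_exp_neg_mul_Ioi (a := a) (r := 2) (by linarith) two_pos
  have hL : laplace (gammaKernel a) (-1) = (1 / ((2 : ℝ) : ℂ)) ^ a * Complex.Gamma a := by
    rw [← hG]
    refine setIntegral_congr_fun measurableSet_Ioi fun z hz => ?_
    have hz0 : (z : ℂ) ≠ 0 := by exact_mod_cast (ne_of_gt hz)
    simp only [gammaKernel]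
    rw [Complex.cpow_def_of_ne_zero hz0, ← Complex.exp_add, ← Complex.exp_add,
      ← Complex.ofReal_log (le_of_lt hz)]
    congr 1
    push_cast
    ring
  rw [hL, ← mul_assoc]
  have h2 : (1 - -1 : ℂ) = ((2 : ℝ) : ℂ) := by norm_num
  have h3 : (1 / ((2 : ℝ) : ℂ)) = ((1 / 2 : ℝ) : ℂ) := by norm_num
  rw [h2, h3, ← Complex.mul_cpow_ofReal_nonneg (by norm_num) (by norm_num)]
  norm_num

end Laplace

/-! ### Decay at infinity and its integration -/

/-- `φ(z) = O(z⁻ⁿ)` on `[1, ∞)`. -/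
def HasDecay (n : ℕ) (φ : ℝ → ℂ) : Prop := ∃ C, ∀ z ≥ 1, ‖φ z‖ ≤ C / z ^ n

namespace HasDecay

variable {n m : ℕ} {φ χ : ℝ → ℂ}

theorem congr (h : HasDecay n φ) (he : ∀ z ≥ 1, χ z = φ z) : HasDecay n χ := by
  obtain ⟨C, hC⟩ := h
  exact ⟨C, fun z hz => by rw [he z hz]; exact hC z hz⟩

theorem add (h : HasDecay n φ) (h' : HasDecay n χ) : HasDecay n fun z => φ z + χ z := by
  obtain ⟨C, hC⟩ := h
  obtain ⟨D, hD⟩ := h'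
  refine ⟨C + D, fun z hz => ?_⟩
  rw [add_div]
  exact (norm_add_le _ _).trans (add_le_add (hC z hz) (hD z hz))

theorem mul (h : HasDecay n φ) (h' : HasDecay m χ) : HasDecay (n + m) fun z => φ z * χ z := by
  obtain ⟨C, hC⟩ := h
  obtain ⟨D, hD⟩ := h'
  refine ⟨C * D, fun z hz => ?_⟩
  rw [norm_mul, pow_add, ← div_mul_div_comm]
  exact mul_le_mul (hC z hz) (hD z hz) (norm_nonneg _) ((norm_nonneg _).trans (hC z hz))

theorem const (c : ℂ) : HasDecay 0 fun _ => c := ⟨‖c‖, fun z _ => by simp⟩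

theorem const_mul (h : HasDecay n φ) (c : ℂ) : HasDecay n fun z => c * φ z := by
  simpa using (const c).mul h

theorem mono (h : HasDecay n φ) (hmn : m ≤ n) : HasDecay m φ := by
  obtain ⟨C, hC⟩ := h
  refine ⟨C, fun z hz => (hC z hz).trans ?_⟩
  have hC0 : 0 ≤ C := by
    have := (norm_nonneg _).trans (hC 1 le_rfl)
    simpa using this
  exact div_le_div_of_nonneg_left hC0 (by positivity) (pow_le_pow_right₀ hz hmn)

theorem inv : HasDecay 1 fun z => (z : ℂ)⁻¹ := by
  refine ⟨1, fun z hz => ?_⟩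
  rw [norm_inv, Complex.norm_real, Real.norm_of_nonneg (by linarith)]
  simp

theorem inv_one_add : HasDecay 1 fun z => (1 + (z : ℂ))⁻¹ := by
  refine ⟨1, fun z hz => ?_⟩
  have : (1 + (z : ℂ)) = ((1 + z : ℝ) : ℂ) := by push_cast; ring
  simp only [this]
  rw [norm_inv, Complex.norm_real, Real.norm_of_nonneg (by linarith), pow_one, one_div]
  exact inv_anti₀ (by linarith) (by linarith)

theorem tendsto (h : HasDecay n φ) (hn : n ≠ 0) : Tendsto φ atTop (𝓝 0) := by
  obtain ⟨C, hC⟩ := h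
  refine squeeze_zero_norm' (eventually_atTop.2 ⟨1, hC⟩) ?_
  exact (tendsto_const_nhds (x := C)).div_atTop (tendsto_pow_atTop hn)

/-- A convergent function is bounded on `[1, ∞)`. -/
theorem of_tendsto {c : ℂ} (hc : ContinuousOn φ (Ioi 0)) (h : Tendsto φ atTop (𝓝 c)) :
    HasDecay 0 φ := by
  obtain ⟨A, hA⟩ := eventually_atTop.1 (h.norm.eventually (eventually_le_nhds (lt_add_one ‖c‖)))
  obtain ⟨B, hB⟩ := (isCompact_Icc (a := (1 : ℝ)) (b := A)).exists_bound_of_continuousOn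
    (hc.mono fun z hz => (zero_lt_one' ℝ).trans_le hz.1)
  refine ⟨max B (‖c‖ + 1), fun z hz => ?_⟩
  rw [pow_zero, div_one]
  rcases le_total z A with h | h
  · exact (hB z ⟨hz, h⟩).trans (le_max_left _ _)
  · exact (hA z h).trans (le_max_right _ _)

end HasDecay

theorem norm_sub_le_of_deriv_decay {h h' : ℝ → ℂ} {C : ℝ} {n : ℕ} (hn : n ≠ 0)
    (hd : ∀ z ≥ 1, HasDerivAt h (h' z) z) (hC : ∀ z ≥ 1, ‖h' z‖ ≤ C / z ^ (n + 1))
    {x y : ℝ} (hx : 1 ≤ x) (hxy : x ≤ y) : ‖h y - h x‖ ≤ C / x ^ n := by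
  have hC0 : 0 ≤ C := by simpa using (norm_nonneg _).trans (hC 1 le_rfl)
  -- The comparison function `C (x⁻ⁿ - z⁻ⁿ)` vanishes at `x` and has derivative `n C z⁻ⁿ⁻¹`, which
  -- dominates the bound on `h'` because `n ≥ 1`.
  have hB : ∀ z ∈ Icc x y, HasDerivAt (fun z : ℝ => C * ((x ^ n)⁻¹ - (z ^ n)⁻¹))
      (C * (n * z ^ (n - 1) / (z ^ n) ^ 2)) z := fun z hz => by
    have hz0 : z ^ n ≠ 0 := pow_ne_zero _ (by linarith [hz.1])
    refine ((((hasDerivAt_pow n z).inv hz0).const_sub _).const_mul C).congr_deriv ?_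
    ring
  have key := image_norm_le_of_norm_deriv_right_le_deriv_boundary' (f := fun z => h z - h x)
    (f' := h') (a := x) (b := y) (B := fun z => C * ((x ^ n)⁻¹ - (z ^ n)⁻¹))
    (B' := fun z => C * (n * z ^ (n - 1) / (z ^ n) ^ 2))
    (fun z hz => ((hd z (hx.trans hz.1)).sub_const _).continuousAt.continuousWithinAt)
    (fun z hz => ((hd z (hx.trans hz.1)).sub_const _).hasDerivWithinAt) (by simp)
    (fun z hz => (hB z hz).continuousAt.continuousWithinAt)
    (fun z hz => (hB z (Ico_subset_Icc_self hz)).hasDerivWithinAt)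
    (fun z hz => by
      have hz1 : 1 ≤ z := hx.trans hz.1
      have hz0 : 0 < z := by linarith
      refine (hC z hz1).trans ?_
      rw [div_eq_mul_one_div]
      refine mul_le_mul_of_nonneg_left ?_ hC0
      have h1 : (1 : ℝ) ≤ n := by exact_mod_cast Nat.one_le_iff_ne_zero.2 hn
      rw [div_le_div_iff₀ (by positivity) (by positivity)]
      have e : z ^ (n - 1) * z ^ (n + 1) = (z ^ n) ^ 2 := by
        rw [← pow_add, ← pow_mul]; congr 1; omega
      nlinarith [pow_pos hz0 n, mul_le_mul_of_nonneg_right h1 (sq_nonneg (z ^ n))])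
    (right_mem_Icc.2 hxy)
  refine key.trans ?_
  rw [div_eq_mul_inv]
  refine mul_le_mul_of_nonneg_left ?_ hC0
  have : 0 ≤ (y ^ n)⁻¹ := by have : 0 ≤ y := by linarith
                             positivity
  linarith

theorem HasDecay.zero_of_deriv {h h' : ℝ → ℂ} {n : ℕ} (hn : n ≠ 0)
    (hd : ∀ z ≥ 1, HasDerivAt h (h' z) z) (hC : HasDecay (n + 1) h') : HasDecay 0 h := by
  obtain ⟨C, hC⟩ := hC
  refine ⟨‖h 1‖ + C, fun z hz => ?_⟩
  have := norm_sub_le_of_deriv_decay hn hd hC le_rfl hz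
  simp only [one_pow, div_one, pow_zero] at this ⊢
  linarith [norm_sub_norm_le (h z) (h 1)]

/-- Integration inwards from infinity: the increment bound from `z` to `y` is uniform in `y`, and `h
y → 0`. -/
theorem HasDecay.of_deriv {h h' : ℝ → ℂ} {n : ℕ} (hn : n ≠ 0)
    (hd : ∀ z ≥ 1, HasDerivAt h (h' z) z) (hC : HasDecay (n + 1) h')
    (h0 : Tendsto h atTop (𝓝 0)) : HasDecay n h := by
  obtain ⟨C, hC⟩ := hC
  refine ⟨C, fun z hz => ?_⟩
  have hlim : Tendsto (fun y => ‖h y - h z‖) atTop (𝓝 ‖0 - h z‖) := (h0.sub_const _).norm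
  rw [zero_sub, norm_neg] at hlim
  exact le_of_tendsto hlim (eventually_atTop.2 ⟨z, fun y hy =>
    norm_sub_le_of_deriv_decay hn hd hC hz hy⟩)

/-- A convergent function with bounded second derivative has derivative tending to zero. -/
theorem tendsto_deriv_zero {g g₁ g₂ : ℝ → ℂ} {c : ℂ} (hg : ∀ z ≥ 1, HasDerivAt g (g₁ z) z)
    (hg₁ : ∀ z ≥ 1, HasDerivAt g₁ (g₂ z) z) (h2 : HasDecay 0 g₂) (h : Tendsto g atTop (𝓝 c)) :
    Tendsto g₁ atTop (𝓝 0) := by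
  obtain ⟨C, hC⟩ := h2
  simp only [pow_zero, div_one] at hC
  have hC0 : 0 ≤ C := (norm_nonneg _).trans (hC 1 le_rfl)
  -- The second derivative bound controls the first order Taylor remainder over a step `η`, so `g₁
  -- z` is a difference quotient of `g` up to `C η`.
  have taylor : ∀ z ≥ 1, ∀ η > 0, ‖g (z + η) - g z - η * g₁ z‖ ≤ C * η * η := by
    intro z hz η hη
    have hd : ∀ t ∈ Icc z (z + η), HasDerivWithinAt (fun t : ℝ => g t - (t : ℂ) * g₁ z)
        (g₁ t - g₁ z) (Icc z (z + η)) t := fun t ht => by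
      have := (hg t (hz.trans ht.1)).sub ((hasDerivAt_id t).ofReal_comp.mul_const (g₁ z))
      exact (this.congr_deriv (by simp)).hasDerivWithinAt
    have hb : ∀ t ∈ Icc z (z + η), ‖g₁ t - g₁ z‖ ≤ C * η := fun t ht => by
      have := (convex_Icc z (z + η)).norm_image_sub_le_of_norm_hasDerivWithin_le
        (fun s hs => (hg₁ s (hz.trans hs.1)).hasDerivWithinAt) (fun s hs => hC s (hz.trans hs.1))
        (left_mem_Icc.2 (by linarith)) ht
      refine this.trans (mul_le_mul_of_nonneg_left ?_ hC0)
      rw [Real.norm_of_nonneg (by linarith [ht.1])]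
      linarith [ht.2]
    have := (convex_Icc z (z + η)).norm_image_sub_le_of_norm_hasDerivWithin_le hd hb
      (left_mem_Icc.2 (by linarith)) (right_mem_Icc.2 (by linarith))
    rw [add_sub_cancel_left, Real.norm_of_nonneg hη.le] at this
    refine le_trans (le_of_eq ?_) this
    congr 1
    push_cast
    ring
  rw [Metric.tendsto_atTop]
  intro ε hε
  -- This step length gives `C η ≤ ε / 2`; the other half of `ε` comes from the convergence of `g`.
  have hη : 0 < ε / (2 * (C + 1)) := by positivity
  set η := ε / (2 * (C + 1)) with hηdef
  have hlim : Tendsto (fun z => ‖g (z + η) - g z‖) atTop (𝓝 0) := by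
    have := (h.comp (tendsto_atTop_add_const_right atTop η tendsto_id)).sub h
    simpa using this.norm
  obtain ⟨A, hA⟩ := eventually_atTop.1 (hlim.eventually (gt_mem_nhds (show 0 < η * (ε / 2) by
    positivity)))
  refine ⟨max A 1, fun z hz => ?_⟩
  have h1 := taylor z ((le_max_right _ _).trans hz) η hη
  have h2 := hA z ((le_max_left _ _).trans hz)
  rw [dist_zero_right]
  have h3 : η * ‖g₁ z‖ ≤ ‖g (z + η) - g z‖ + C * η * η := by
    have e : (η : ℂ) * g₁ z = (g (z + η) - g z) - (g (z + η) - g z - η * g₁ z) := by ring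
    calc η * ‖g₁ z‖ = ‖(η : ℂ) * g₁ z‖ := by
          rw [norm_mul, Complex.norm_real, Real.norm_of_nonneg hη.le]
      _ ≤ _ := by rw [e]; exact (norm_sub_le _ _).trans (add_le_add le_rfl h1)
  have h4 : C * η ≤ ε / 2 := by
    rw [hηdef, mul_div_assoc', div_le_div_iff₀ (by positivity) (by positivity)]
    nlinarith
  have h5 : η * ‖g₁ z‖ < η * ε := by nlinarith
  exact lt_of_mul_lt_mul_left h5 hη.le

/-- `f`, with derivatives `f₁` and `f₂`, solves on `(0, ∞)` the confluent Heun equation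
`z(1+z)f'' + (1 + 2z + 2ik)f' + (ik' - Λ)f = 0`, `k = Ωz(1+z)/2 - α(1+z) - γz`. -/
structure IsHeunSolution (Ω α γ Λ : ℝ) (f f₁ f₂ : ℝ → ℂ) : Prop where
  hasDerivAt : ∀ z > 0, HasDerivAt f (f₁ z) z
  hasDerivAt₁ : ∀ z > 0, HasDerivAt f₁ (f₂ z) z
  ode : ∀ z : ℝ, 0 < z → (z : ℂ) * (1 + z) * f₂ z
    + (1 + 2 * z + 2 * Complex.I * (Ω / 2 * z * (1 + z) - α * (1 + z) - γ * z)) * f₁ z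
    + (Complex.I * (Ω * (z + 1 / 2) - (α + γ)) - Λ) * f z = 0

/-! ### Heun solutions at infinity -/

section Infinity

variable {Ω α γ Λ : ℝ}

/-- The first-order coefficient of the equation satisfied by `(1 + z) f`. -/
noncomputable def heunCoeff (Ω α γ : ℝ) (z : ℝ) : ℂ :=
  Complex.I * Ω + (1 - 2 * Complex.I * α) * (z : ℂ)⁻¹ - (1 + 2 * Complex.I * γ) * (1 + (z : ℂ))⁻¹

/-- The zeroth-order coefficient of the equation satisfied by `(1 + z) f`. -/
noncomputable def heunCoeffZero (Ω α γ Λ : ℝ) (z : ℝ) : ℂ :=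
  (Complex.I * (Ω / 2 + α + γ) - Λ - (1 + 2 * Complex.I * γ) * (1 + (z : ℂ))⁻¹) *
    ((z : ℂ)⁻¹ * (1 + (z : ℂ))⁻¹)

theorem one_add_ofReal_ne_zero {z : ℝ} (hz : 0 < z) : (1 + (z : ℂ)) ≠ 0 := by
  have : (1 + (z : ℂ)) = ((1 + z : ℝ) : ℂ) := by push_cast; ring
  rw [this]
  exact_mod_cast (by linarith : (1 + z : ℝ) ≠ 0)

/-- For `g = (1 + z) f` the `iΩ/z` part of the zeroth order coefficient disappears. What remains is
a perturbation of `g'' + iΩ g' = 0` with zeroth order coefficient `O(z⁻²)`, so that a bounded `g`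
can be bootstrapped. -/
theorem heunCoeff_ode {f f₁ f₂ : ℝ → ℂ} (hf : IsHeunSolution Ω α γ Λ f f₁ f₂) {z : ℝ}
    (hz : 0 < z) :
    ((1 + z) * f₂ z + 2 * f₁ z) + heunCoeff Ω α γ z * ((1 + z) * f₁ z + f z)
      + heunCoeffZero Ω α γ Λ z * ((1 + z) * f z) = 0 := by
  have h0 : (z : ℂ) ≠ 0 := by exact_mod_cast hz.ne'
  have h1 := one_add_ofReal_ne_zero hz
  have h2 := hf.ode z hz
  have h3 : (z : ℂ) * (((1 + z) * f₂ z + 2 * f₁ z) +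
      heunCoeff Ω α γ z * ((1 + z) * f₁ z + f z)
      + heunCoeffZero Ω α γ Λ z * ((1 + z) * f z)) = 0 := by
    unfold heunCoeff heunCoeffZero
    field_simp
    field_simp at h2
    linear_combination (1 + (z : ℂ)) * h2
  exact (mul_eq_zero.1 h3).resolve_left h0

/-- The integrating factor of `heunCoeff`. -/
noncomputable def heunWeight (Ω α γ : ℝ) (z : ℝ) : ℂ :=
  Complex.exp (Complex.I * Ω * z + (1 - 2 * Complex.I * α) * Real.log z
    - (1 + 2 * Complex.I * γ) * Real.log (1 + z))

theorem hasDerivAt_heunWeight {z : ℝ} (hz : 0 < z) :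
    HasDerivAt (heunWeight Ω α γ) (heunWeight Ω α γ z * heunCoeff Ω α γ z) z := by
  have h1 := (Real.hasDerivAt_log hz.ne').ofReal_comp.const_mul (1 - 2 * Complex.I * α)
  have h2 := (((hasDerivAt_id z).const_add 1).log (by simp; linarith)).ofReal_comp.const_mul
    (1 + 2 * Complex.I * γ)
  have h3 := ((((hasDerivAt_id z).ofReal_comp.const_mul (Complex.I * Ω)).add h1).sub h2).cexp
  refine h3.congr_deriv ?_
  simp [heunWeight, heunCoeff]

/-- The imaginary parts of the exponents are pure phases. On `[1, ∞)` the modulus lies between `1/2`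
and `1`, so multiplying by the weight costs nothing in decay estimates. -/
theorem norm_heunWeight {z : ℝ} (hz : 0 < z) : ‖heunWeight Ω α γ z‖ = z / (1 + z) := by
  unfold heunWeight
  rw [Complex.norm_exp]
  have : (Complex.I * Ω * z + (1 - 2 * Complex.I * α) * Real.log z
    - (1 + 2 * Complex.I * γ) * Real.log (1 + z)).re = Real.log z - Real.log (1 + z) := by
    simp 
  rw [this, Real.exp_sub, Real.exp_log hz, Real.exp_log (by linarith)]

theorem norm_le_two_mul_weight {z : ℝ} (hz : 1 ≤ z) (c : ℂ) :
    ‖c‖ ≤ 2 * ‖heunWeight Ω α γ z * c‖ := by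
  rw [norm_mul, norm_heunWeight (by linarith)]
  have : (1 : ℝ) ≤ 2 * (z / (1 + z)) := by
    rw [mul_div_assoc', le_div_iff₀ (by linarith)]; linarith
  nlinarith [norm_nonneg c]

theorem HasDecay.of_weight {n : ℕ} {G : ℝ → ℂ}
    (h : HasDecay n fun z => heunWeight Ω α γ z * G z) : HasDecay n G := by
  obtain ⟨C, hC⟩ := h
  refine ⟨2 * C, fun z hz => (norm_le_two_mul_weight (Ω := Ω) (α := α) (γ := γ) hz (G z)).trans ?_⟩
  rw [mul_div_assoc]
  exact mul_le_mul_of_nonneg_left (hC z hz) two_pos.le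

theorem HasDecay.weight_mul {n : ℕ} {G : ℝ → ℂ} (h : HasDecay n G) :
    HasDecay n fun z => heunWeight Ω α γ z * G z := by
  have : HasDecay 0 (heunWeight Ω α γ) := by
    refine ⟨1, fun z hz => ?_⟩
    rw [norm_heunWeight (by linarith), pow_zero, div_one, div_le_one (by linarith)]
    linarith
  simpa using this.mul h

theorem hasDerivAt_weight_mul {G G₁ : ℝ → ℂ} (hG : ∀ z ≥ 1, HasDerivAt G (G₁ z) z) :
    ∀ z ≥ 1, HasDerivAt (fun z => heunWeight Ω α γ z * G z)
      (heunWeight Ω α γ z * (G₁ z + heunCoeff Ω α γ z * G z)) z := fun z hz =>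
  ((hasDerivAt_heunWeight (lt_of_lt_of_le one_pos hz)).mul (hG z hz)).congr_deriv (by ring)

/-- Since `(wG)' = w (G' + aG)` for the integrating factor `w` of the coefficient `a`, decay of `G'
+ aG` may be integrated as if it were decay of `G'`. -/
theorem HasDecay.zero_of_transport {n : ℕ} (hn : n ≠ 0) {G G₁ : ℝ → ℂ}
    (hG : ∀ z ≥ 1, HasDerivAt G (G₁ z) z)
    (h : HasDecay (n + 1) fun z => G₁ z + heunCoeff Ω α γ z * G z) : HasDecay 0 G :=
  (HasDecay.zero_of_deriv hn (hasDerivAt_weight_mul hG) h.weight_mul).of_weight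

theorem HasDecay.of_transport {n : ℕ} (hn : n ≠ 0) {G G₁ : ℝ → ℂ}
    (hG : ∀ z ≥ 1, HasDerivAt G (G₁ z) z)
    (h : HasDecay (n + 1) fun z => G₁ z + heunCoeff Ω α γ z * G z)
    (h0 : Tendsto G atTop (𝓝 0)) : HasDecay n G := by
  refine (HasDecay.of_deriv hn (hasDerivAt_weight_mul hG) h.weight_mul ?_).of_weight
  refine squeeze_zero_norm' ?_ (by simpa using h0.norm)
  filter_upwards [eventually_ge_atTop 1] with z hz
  rw [norm_mul, norm_heunWeight (by linarith)]
  refine mul_le_of_le_one_left (norm_nonneg _) ?_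
  rw [div_le_one (by linarith)]
  linarith

theorem hasDecay_heunCoeff_sub :
    HasDecay 1 fun z => heunCoeff Ω α γ z - Complex.I * Ω :=
  ((HasDecay.inv.const_mul (1 - 2 * Complex.I * α)).add
    (HasDecay.inv_one_add.const_mul (-(1 + 2 * Complex.I * γ)))).congr fun z _ => by
      unfold heunCoeff; ring

theorem hasDecay_heunCoeff : HasDecay 0 (heunCoeff Ω α γ) :=
  ((hasDecay_heunCoeff_sub.mono (Nat.zero_le 1)).add (HasDecay.const (Complex.I * Ω))).congr
    fun z _ => (sub_add_cancel (heunCoeff Ω α γ z) _).symm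

theorem hasDecay_heunCoeffZero : HasDecay 2 (heunCoeffZero Ω α γ Λ) :=
  (((HasDecay.const _).add ((HasDecay.inv_one_add.const_mul
    (-(1 + 2 * Complex.I * γ))).mono (Nat.zero_le 1))).mul
    (HasDecay.inv.mul HasDecay.inv_one_add)).congr fun z _ => by
      unfold heunCoeffZero; rw [sub_eq_add_neg _ (_ * _), neg_mul]

/-- The derivative of `heunCoeffZero`. -/
noncomputable def heunCoeffZeroDeriv (Ω α γ Λ : ℝ) (z : ℝ) : ℂ :=
  (1 + 2 * Complex.I * γ) * ((1 + (z : ℂ))⁻¹ * (1 + (z : ℂ))⁻¹ * ((z : ℂ)⁻¹ * (1 + (z : ℂ))⁻¹)) +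
  (Complex.I * (Ω / 2 + α + γ) - Λ + (-(1 + 2 * Complex.I * γ)) * (1 + (z : ℂ))⁻¹) *
    ((-1) * ((z : ℂ)⁻¹ * (z : ℂ)⁻¹ * (1 + (z : ℂ))⁻¹) +
      (-1) * ((z : ℂ)⁻¹ * (1 + (z : ℂ))⁻¹ * (1 + (z : ℂ))⁻¹))

theorem hasDecay_heunCoeffZeroDeriv : HasDecay 3 (heunCoeffZeroDeriv Ω α γ Λ) := by
  have i := HasDecay.inv
  have j := HasDecay.inv_one_add
  refine HasDecay.add ((((j.mul j).mul (i.mul j)).const_mul _).mono (by norm_num)) ?_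
  have h0 := (HasDecay.const (Complex.I * (Ω / 2 + α + γ) - Λ)).add
    ((j.const_mul (-(1 + 2 * Complex.I * γ))).mono (Nat.zero_le 1))
  exact (h0.mul ((((i.mul i).mul j).const_mul (-1)).add (((i.mul j).mul j).const_mul (-1)))).mono
    (by norm_num)

theorem hasDerivAt_heunCoeffZero {z : ℝ} (hz : 0 < z) :
    HasDerivAt (heunCoeffZero Ω α γ Λ) (heunCoeffZeroDeriv Ω α γ Λ z) z := by
  have h0 : (z : ℂ) ≠ 0 := by exact_mod_cast hz.ne'
  have h1 := one_add_ofReal_ne_zero hz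
  have d0 : HasDerivAt (fun z : ℝ => (z : ℂ)) 1 z := by simpa using (hasDerivAt_id z).ofReal_comp
  have i := d0.inv h0
  have j := (d0.const_add (1 : ℂ)).inv h1
  refine ((((j.const_mul (1 + 2 * Complex.I * γ)).const_sub
    (Complex.I * (Ω / 2 + α + γ) - Λ))).mul (i.mul j)).congr_deriv ?_
  unfold heunCoeffZeroDeriv
  simp only [Pi.mul_apply, Pi.inv_apply]
  field_simp
  ring

/-- A solution with `(1 + z) f` convergent at infinity decays with its derivatives. -/
theorem IsHeunSolution.hasDecay {f f₁ f₂ : ℝ → ℂ} (hf : IsHeunSolution Ω α γ Λ f f₁ f₂)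
    (hΩ : Ω ≠ 0) {c : ℂ} (hinf : Tendsto (fun z : ℝ => (1 + (z : ℂ)) * f z) atTop (𝓝 c)) :
    HasDecay 1 f ∧ HasDecay 2 f₁ ∧ HasDecay 2 f₂ ∧
      HasDecay 2 (fun z => (1 + (z : ℂ)) * f₂ z + 2 * f₁ z) := by
  have hpos : ∀ z : ℝ, 1 ≤ z → 0 < z := fun z hz => by linarith
  have d0 : ∀ z : ℝ, HasDerivAt (fun z : ℝ => 1 + (z : ℂ)) 1 z := fun z => by
    simpa using (hasDerivAt_id z).ofReal_comp.const_add (1 : ℂ)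
  set g : ℝ → ℂ := fun z => (1 + (z : ℂ)) * f z with hgdef
  set g₁ : ℝ → ℂ := fun z => (1 + (z : ℂ)) * f₁ z + f z with hg₁def
  set g₂ : ℝ → ℂ := fun z => (1 + (z : ℂ)) * f₂ z + 2 * f₁ z with hg₂def
  have hg : ∀ z > 0, HasDerivAt g (g₁ z) z := fun z hz =>
    ((d0 z).mul (hf.hasDerivAt z hz)).congr_deriv (by simp only [hg₁def]; ring)
  have hg₁ : ∀ z > 0, HasDerivAt g₁ (g₂ z) z := fun z hz =>
    (((d0 z).mul (hf.hasDerivAt₁ z hz)).add (hf.hasDerivAt z hz)).congr_deriv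
      (by simp only [hg₂def]; ring)
  have hode : ∀ z > 0, g₂ z + heunCoeff Ω α γ z * g₁ z + heunCoeffZero Ω α γ Λ z * g z = 0 :=
    fun z hz => heunCoeff_ode hf hz
  have hgb : HasDecay 0 g :=
    HasDecay.of_tendsto (fun z hz => (hg z hz).continuousAt.continuousWithinAt) hinf
  have hbg : HasDecay 2 fun z => heunCoeffZero Ω α γ Λ z * g z := hasDecay_heunCoeffZero.mul hgb
  -- First round of the bootstrap: only boundedness of `g` is used.
  have htr : HasDecay (1 + 1) fun z => g₂ z + heunCoeff Ω α γ z * g₁ z :=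
    (hbg.const_mul (-1)).congr fun z hz => by linear_combination hode z (hpos z hz)
  have hd₁ : ∀ z ≥ 1, HasDerivAt g₁ (g₂ z) z := fun z hz => hg₁ z (hpos z hz)
  have hg₁b : HasDecay 0 g₁ := HasDecay.zero_of_transport one_ne_zero hd₁ htr
  have hg₂b : HasDecay 0 g₂ :=
    (((hasDecay_heunCoeff.mul hg₁b).const_mul (-1)).add
      ((hbg.mono (Nat.zero_le 2)).const_mul (-1))).congr fun z hz => by
        linear_combination hode z (hpos z hz)
  -- A nonzero limit of `w g'` would correspond to the oscillating solution `e^{-iΩz}` in `g'`;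
  -- convergence of `g` together with boundedness of `g''` excludes it.
  have hg₁0 : Tendsto g₁ atTop (𝓝 0) :=
    tendsto_deriv_zero (fun z hz => hg z (hpos z hz)) hd₁ hg₂b hinf
  have hg₁d : HasDecay 1 g₁ := HasDecay.of_transport one_ne_zero hd₁ htr hg₁0
  have hIΩ : Complex.I * (Ω : ℂ) ≠ 0 := mul_ne_zero Complex.I_ne_zero (by exact_mod_cast hΩ)
  -- Integrating the `O(z⁻²)` source gives only `g' = O(z⁻¹)`. Since `Ω ≠ 0` the weight oscillates
  -- and one more power is available: for `G = g' + (iΩ)⁻¹ b g`, with `b` the zeroth order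
  -- coefficient, the leading part of the source cancels and `G' + aG = (iΩ)⁻¹ ((a - iΩ) b g + b' g
  -- + b g')` is `O(z⁻³)`.
  have hG : HasDecay 2 fun z => g₁ z + (Complex.I * Ω)⁻¹ * (heunCoeffZero Ω α γ Λ z * g z) := by
    refine HasDecay.of_transport (Ω := Ω) (α := α) (γ := γ) two_ne_zero
      (G₁ := fun z => g₂ z + (Complex.I * Ω)⁻¹ *
        (heunCoeffZeroDeriv Ω α γ Λ z * g z + heunCoeffZero Ω α γ Λ z * g₁ z)) (fun z hz => ?_) ?_ ?_
    · exact (hd₁ z hz).add (((hasDerivAt_heunCoeffZero (hpos z hz)).mul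
        (hg z (hpos z hz))).const_mul _)
    · refine ((((hasDecay_heunCoeff_sub (Ω := Ω) (α := α) (γ := γ)).mul hbg).add
        (((hasDecay_heunCoeffZeroDeriv (Ω := Ω) (α := α) (γ := γ) (Λ := Λ)).mul hgb).add
          ((hasDecay_heunCoeffZero (Ω := Ω) (α := α) (γ := γ) (Λ := Λ)).mul hg₁d))).const_mul (Complex.I * Ω)⁻¹).congr fun z hz => ?_
      have := hode z (hpos z hz)
      linear_combination this + heunCoeffZero Ω α γ Λ z * g z * inv_mul_cancel₀ hIΩ
    · simpa using hg₁0.add ((hbg.tendsto two_ne_zero).const_mul (Complex.I * Ω)⁻¹)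
  have hg₁2 : HasDecay 2 g₁ :=
    (hG.add (hbg.const_mul (-(Complex.I * Ω)⁻¹))).congr fun z _ => by ring
  have hg₂2 : HasDecay 2 g₂ :=
    (((hasDecay_heunCoeff.mul hg₁2).const_mul (-1)).add (hbg.const_mul (-1))).congr fun z hz => by
        linear_combination hode z (hpos z hz)
  have j := HasDecay.inv_one_add
  have hf0 : HasDecay 1 f := (j.mul hgb).congr fun z hz => by
    have := one_add_ofReal_ne_zero (hpos z hz)
    simp only [hgdef]; field_simp
  have hf1 : HasDecay 2 f₁ :=
    (((j.mul hg₁2).mono (by norm_num)).add ((j.mul hf0).const_mul (-1))).congr fun z hz => by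
      have := one_add_ofReal_ne_zero (hpos z hz)
      simp only [hg₁def]; field_simp; ring
  have hf2 : HasDecay 2 f₂ :=
    ((j.mul (hg₂2.add (hf1.const_mul (-2)))).mono (by norm_num)).congr fun z hz => by
      have := one_add_ofReal_ne_zero (hpos z hz)
      simp only [hg₂def]; field_simp; ring
  exact ⟨hf0, hf1, hf2, hg₂2⟩

end Infinity

/-! ### Behaviour at the regular singular point `z = 0` -/

/-- `h` has derivatives `h₁`, `h₂` on `(-δ, δ)`, all three bounded by `C` there. -/
structure HasTaylorData (h h₁ h₂ : ℝ → ℂ) (δ C : ℝ) : Prop where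
  pos : 0 < δ
  hasDerivAt : ∀ z ∈ Ioo (-δ) δ, HasDerivAt h (h₁ z) z
  hasDerivAt₁ : ∀ z ∈ Ioo (-δ) δ, HasDerivAt h₁ (h₂ z) z
  bound : ∀ z ∈ Ioo (-δ) δ, ‖h z‖ ≤ C
  bound₁ : ∀ z ∈ Ioo (-δ) δ, ‖h₁ z‖ ≤ C
  bound₂ : ∀ z ∈ Ioo (-δ) δ, ‖h₂ z‖ ≤ C

theorem exists_hasTaylorData {h : ℝ → ℂ} (hh : ContDiffAt ℝ 2 h 0) {P : ℝ → Prop}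
    (hP : ∀ᶠ z in 𝓝[>] (0 : ℝ), P z) :
    ∃ δ C, HasTaylorData h (deriv h) (deriv (deriv h)) δ C ∧ ∀ z ∈ Ioo 0 δ, P z := by
  obtain ⟨u, hu, hcd⟩ := hh.contDiffOn (m := 2) le_rfl (by simp)
  obtain ⟨v, hvu, hvo, hv0⟩ := mem_nhds_iff.1 hu
  have hcd := hcd.mono hvu
  have h1 : ContDiffOn ℝ 1 (deriv h) v :=
    ((contDiffOn_succ_iff_deriv_of_isOpen (n := 1) hvo).1 hcd).2.2
  have h2 : ContinuousOn (deriv (deriv h)) v :=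
    (((contDiffOn_succ_iff_deriv_of_isOpen (n := 0) hvo).1 h1).2.2).continuousOn
  have hc : ∀ g : ℝ → ℂ, ContinuousOn g v → ∀ᶠ z in 𝓝 (0 : ℝ), ‖g z‖ ≤ ‖g 0‖ + 1 :=
    fun g hg => ((hg.continuousAt (hvo.mem_nhds hv0)).norm.eventually
      (eventually_le_nhds (lt_add_one _)))
  have hev := (hvo.eventually_mem hv0).and ((hc _ hcd.continuousOn).and
    ((hc _ h1.continuousOn).and ((hc _ h2).and (eventually_nhdsWithin_iff.1 hP))))
  obtain ⟨δ, hδ, hball⟩ := Metric.eventually_nhds_iff_ball.1 hev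
  rw [Real.ball_eq_Ioo, zero_sub, zero_add] at hball
  refine ⟨δ, max (‖h 0‖ + 1) (max (‖deriv h 0‖ + 1) (‖deriv (deriv h) 0‖ + 1)),
    ⟨hδ, fun z hz => ?_, fun z hz => ?_, fun z hz => ?_, fun z hz => ?_, fun z hz => ?_⟩,
    fun z hz => (hball z ⟨by linarith [hz.1], hz.2⟩).2.2.2.2 hz.1⟩
  · have hz' := (hball z hz).1
    exact ((hcd.differentiableOn (by norm_num)).differentiableAt
      (hvo.mem_nhds hz')).hasDerivAt
  · have hz' := (hball z hz).1
    exact ((h1.differentiableOn (by norm_num)).differentiableAt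
      (hvo.mem_nhds hz')).hasDerivAt
  · exact (hball z hz).2.1.trans (le_max_left _ _)
  · exact (hball z hz).2.2.1.trans ((le_max_left _ _).trans (le_max_right _ _))
  · exact (hball z hz).2.2.2.1.trans ((le_max_right _ _).trans (le_max_right _ _))

/-- The oscillating factor `z^{2iα}` on `(0, ∞)`. -/
noncomputable def osc (α : ℝ) (z : ℝ) : ℂ := Complex.exp (2 * Complex.I * α * Real.log z)

theorem norm_osc (α z : ℝ) : ‖osc α z‖ = 1 := by
  have : 2 * Complex.I * α * Real.log z = ((2 * α * Real.log z : ℝ) : ℂ) * Complex.I := by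
    push_cast; ring
  rw [osc, this, Complex.norm_exp_ofReal_mul_I]

theorem hasDerivAt_osc (α : ℝ) {z : ℝ} (hz : 0 < z) :
    HasDerivAt (osc α) (osc α z * (2 * Complex.I * α / z)) z := by
  refine (((Real.hasDerivAt_log hz.ne').ofReal_comp).const_mul
    (2 * Complex.I * α)).cexp.congr_deriv ?_
  simp [osc, div_eq_mul_inv]

theorem gammaKernel_eq_osc (α z : ℝ) :
    gammaKernel (1 + 2 * Complex.I * α) z = osc α z * Complex.exp (-z) := by
  rw [gammaKernel, osc, ← Complex.exp_add]; congr 1; ring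

section OscMul

variable {α : ℝ} {f f₁ f₂ h h₁ h₂ : ℝ → ℂ} {δ C : ℝ}

theorem deriv_of_eq_osc_mul (hf : ∀ z > 0, HasDerivAt f (f₁ z) z)
    (hh : HasTaylorData h h₁ h₂ δ C) (hfh : ∀ z ∈ Ioo 0 δ, f z = osc α z * h z) :
    ∀ z ∈ Ioo 0 δ, f₁ z = osc α z * (h₁ z + 2 * Complex.I * α * h z / z) := fun z hz => by
  have hz' : z ∈ Ioo (-δ) δ := ⟨by linarith [hz.1, hh.pos], hz.2⟩
  have h0 : (z : ℂ) ≠ 0 := by exact_mod_cast hz.1.ne'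
  have h1 := (hasDerivAt_osc α hz.1).mul (hh.hasDerivAt z hz')
  refine (hf z hz.1).unique ((h1.congr_of_eventuallyEq ?_).congr_deriv ?_)
  · exact eventually_of_mem (Ioo_mem_nhds hz.1 hz.2) hfh
  · ring

theorem deriv₂_of_eq_osc_mul (hf : ∀ z > 0, HasDerivAt f (f₁ z) z)
    (hf₁ : ∀ z > 0, HasDerivAt f₁ (f₂ z) z)
    (hh : HasTaylorData h h₁ h₂ δ C) (hfh : ∀ z ∈ Ioo 0 δ, f z = osc α z * h z) :
    ∀ z ∈ Ioo 0 δ, f₂ z = osc α z * (h₂ z + 4 * Complex.I * α * h₁ z / z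
      + 2 * Complex.I * α * (2 * Complex.I * α - 1) * h z / z ^ 2) := fun z hz => by
  have hz' : z ∈ Ioo (-δ) δ := ⟨by linarith [hz.1, hh.pos], hz.2⟩
  have h0 : (z : ℂ) ≠ 0 := by exact_mod_cast hz.1.ne'
  have d0 : HasDerivAt (fun z : ℝ => (z : ℂ)) 1 z := by simpa using (hasDerivAt_id z).ofReal_comp
  have h1 := (hasDerivAt_osc α hz.1).mul ((hh.hasDerivAt₁ z hz').add
    (((hh.hasDerivAt z hz').const_mul (2 * Complex.I * α)).div d0 h0))
  refine (hf₁ z hz.1).unique ((h1.congr_of_eventuallyEq ?_).congr_deriv ?_)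
  · exact eventually_of_mem (Ioo_mem_nhds hz.1 hz.2) (deriv_of_eq_osc_mul hf hh hfh)
  · simp only [Pi.add_apply, Pi.div_apply]
    field_simp
    ring

theorem HasTaylorData.norm_deriv_le (hh : HasTaylorData h h₁ h₂ δ C) (h10 : h₁ 0 = 0) :
    ∀ z ∈ Ioo 0 δ, ‖h₁ z‖ ≤ C * z := fun z hz => by
  have hs : Icc 0 z ⊆ Ioo (-δ) δ := fun t ht => ⟨by linarith [ht.1, hh.pos], ht.2.trans_lt hz.2⟩
  have := (convex_Icc 0 z).norm_image_sub_le_of_norm_hasDerivWithin_le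
    (fun t ht => (hh.hasDerivAt₁ t (hs ht)).hasDerivWithinAt) (fun t ht => hh.bound₂ t (hs ht))
    (left_mem_Icc.2 hz.1.le) (right_mem_Icc.2 hz.1.le)
  rwa [h10, sub_zero, sub_zero, Real.norm_of_nonneg hz.1.le] at this

theorem HasTaylorData.norm_le (hh : HasTaylorData h h₁ h₂ δ C) (h00 : h 0 = 0) {B z : ℝ}
    (hz : z ∈ Ioo 0 δ) (hB : ∀ t ∈ Icc 0 z, ‖h₁ t‖ ≤ B) : ‖h z‖ ≤ B * z := by
  have hs : Icc 0 z ⊆ Ioo (-δ) δ := fun t ht => ⟨by linarith [ht.1, hh.pos], ht.2.trans_lt hz.2⟩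
  have := (convex_Icc 0 z).norm_image_sub_le_of_norm_hasDerivWithin_le
    (fun t ht => (hh.hasDerivAt t (hs ht)).hasDerivWithinAt) hB
    (left_mem_Icc.2 hz.1.le) (right_mem_Icc.2 hz.1.le)
  rwa [h00, sub_zero, sub_zero, Real.norm_of_nonneg hz.1.le] at this

theorem HasTaylorData.nonneg (hh : HasTaylorData h h₁ h₂ δ C) : 0 ≤ C :=
  (norm_nonneg _).trans (hh.bound 0 ⟨by linarith [hh.pos], hh.pos⟩)

theorem HasTaylorData.norm_le_sq (hh : HasTaylorData h h₁ h₂ δ C) (h00 : h 0 = 0)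
    (h10 : h₁ 0 = 0) : ∀ z ∈ Ioo 0 δ, ‖h z‖ ≤ C * z ^ 2 := fun z hz => by
  have h := hh.norm_le h00 hz (B := C * z) fun t ht => by
    rcases ht.1.eq_or_lt with rfl | h0
    · rw [h10, norm_zero]; exact mul_nonneg hh.nonneg hz.1.le
    · exact (hh.norm_deriv_le h10 t ⟨h0, ht.2.trans_lt hz.2⟩).trans
        (mul_le_mul_of_nonneg_left ht.2 hh.nonneg)
  rw [sq, ← mul_assoc]; exact h

/-- If the smooth factor vanishes to second order at `0`, then so does `f = z^{2iα} h`. -/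
theorem norm_le_of_eq_osc_mul (hf : ∀ z > 0, HasDerivAt f (f₁ z) z)
    (hf₁ : ∀ z > 0, HasDerivAt f₁ (f₂ z) z) (hh : HasTaylorData h h₁ h₂ δ C)
    (hfh : ∀ z ∈ Ioo 0 δ, f z = osc α z * h z) (h00 : h 0 = 0) (h10 : h₁ 0 = 0) :
    ∃ D, 0 ≤ D ∧ ∀ z ∈ Ioo 0 δ, ‖f z‖ ≤ D * z ^ 2 ∧ ‖f₁ z‖ ≤ D * z ∧ ‖f₂ z‖ ≤ D := by
  set A := ‖2 * Complex.I * (α : ℂ)‖ with hA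
  set A' := ‖4 * Complex.I * (α : ℂ)‖ with hA'
  set A₂ := ‖2 * Complex.I * (α : ℂ) * (2 * Complex.I * α - 1)‖ with hA₂
  have hC := hh.nonneg
  have p1 : 0 ≤ A := norm_nonneg _
  have p2 : 0 ≤ A' := norm_nonneg _
  have p3 : 0 ≤ A₂ := norm_nonneg _
  refine ⟨C * (1 + A + A' + A₂), by positivity, fun z hz => ?_⟩
  have hz0 := hz.1
  have b0 := hh.norm_le_sq h00 h10 z hz
  have b1 := hh.norm_deriv_le h10 z hz
  have b2 := hh.bound₂ z ⟨by linarith [hz.1, hh.pos], hz.2⟩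
  have nz : ‖(z : ℂ)‖ = z := by rw [Complex.norm_real, Real.norm_of_nonneg hz0.le]
  refine ⟨?_, ?_, ?_⟩
  · rw [hfh z hz, norm_mul, norm_osc, one_mul]
    refine b0.trans (mul_le_mul_of_nonneg_right ?_ (by positivity))
    nlinarith [mul_nonneg hC p1, mul_nonneg hC p2, mul_nonneg hC p3]
  · rw [deriv_of_eq_osc_mul hf hh hfh z hz, norm_mul, norm_osc, one_mul]
    have e : ‖2 * Complex.I * α * h z / z‖ ≤ A * (C * z) := by
      rw [norm_div, norm_mul, nz, ← hA, div_le_iff₀ hz0]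
      calc A * ‖h z‖ ≤ A * (C * z ^ 2) := by gcongr
        _ = _ := by ring
    refine (norm_add_le _ _).trans ((add_le_add b1 e).trans ?_)
    have : 0 ≤ C * z := by positivity
    nlinarith [mul_nonneg this p2, mul_nonneg this p3]
  · rw [deriv₂_of_eq_osc_mul hf hf₁ hh hfh z hz, norm_mul, norm_osc, one_mul]
    have e1 : ‖4 * Complex.I * α * h₁ z / z‖ ≤ A' * C := by
      rw [norm_div, norm_mul, nz, ← hA', div_le_iff₀ hz0]
      calc A' * ‖h₁ z‖ ≤ A' * (C * z) := by gcongr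
        _ = _ := by ring
    have e2 : ‖2 * Complex.I * α * (2 * Complex.I * α - 1) * h z / z ^ 2‖ ≤ A₂ * C := by
      rw [norm_div, norm_mul, norm_pow, nz, ← hA₂, div_le_iff₀ (by positivity)]
      calc A₂ * ‖h z‖ ≤ A₂ * (C * z ^ 2) := by gcongr
        _ = _ := by ring
    refine (norm_add₃_le).trans ((add_le_add (add_le_add b2 e1) e2).trans ?_)
    nlinarith [mul_nonneg hC p1]

end OscMul

/-! ### Size of the model functions and of their transforms -/

theorem HasDecay.gammaKernel (n : ℕ) (a : ℂ) : HasDecay n (gammaKernel a) := by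
  have hc : ∀ b : ℂ, ContinuousOn (_root_.gammaKernel b) (Ioi 0) := fun b z hz =>
    (hasDerivAt_gammaKernel b hz).continuousAt.continuousWithinAt
  have ht : ∀ b : ℂ, Tendsto (_root_.gammaKernel b) atTop (𝓝 0) := fun b => by
    refine squeeze_zero_norm' ?_
      (tendsto_rpow_mul_exp_neg_mul_atTop_nhds_zero (b.re - 1) 1 one_pos)
    filter_upwards [eventually_gt_atTop 0] with z hz
    rw [norm_gammaKernel b hz, neg_one_mul]
  have hs : ∀ n : ℕ, ∀ a : ℂ, HasDecay n (_root_.gammaKernel a) := by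
    intro n
    induction n with
    | zero => exact fun a => HasDecay.of_tendsto (hc a) (ht a)
    | succ n ih =>
      -- The kernel of index `a` is `z⁻¹` times that of index `a + 1`; the induction hypothesis
      -- holds for every index, so each step gains one power.
      refine fun a => ((ih (a + 1)).mul HasDecay.inv).congr fun z hz => ?_
      have hz0 : 0 < z := by linarith
      have h0 : (z : ℂ) ≠ 0 := by exact_mod_cast hz0.ne'
      rw [← mul_gammaKernel a hz0]
      field_simp
  exact hs n a

/-- The first derivative of `gammaKernel`. -/
noncomputable def gammaKernelDeriv (a : ℂ) (z : ℝ) : ℂ :=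
  (a - 1) * gammaKernel (a - 1) z - gammaKernel a z

theorem hasDerivAt_gammaKernel' (a : ℂ) {z : ℝ} (hz : 0 < z) :
    HasDerivAt (gammaKernel a) (gammaKernelDeriv a z) z := by
  refine (hasDerivAt_gammaKernel a hz).congr_deriv ?_
  have h0 : (z : ℂ) ≠ 0 := by exact_mod_cast hz.ne'
  have h := mul_gammaKernel (a - 1) hz
  rw [sub_add_cancel] at h
  rw [gammaKernelDeriv, ← h]
  field_simp

/-- The second derivative of `gammaKernel`. -/
noncomputable def gammaKernelDeriv₂ (a : ℂ) (z : ℝ) : ℂ :=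
  (a - 1) * gammaKernelDeriv (a - 1) z - gammaKernelDeriv a z

theorem hasDerivAt_gammaKernelDeriv (a : ℂ) {z : ℝ} (hz : 0 < z) :
    HasDerivAt (gammaKernelDeriv a) (gammaKernelDeriv₂ a z) z :=
  ((hasDerivAt_gammaKernel' (a - 1) hz).const_mul (a - 1)).sub (hasDerivAt_gammaKernel' a hz)

theorem HasDecay.sub {n : ℕ} {φ χ : ℝ → ℂ} (h : HasDecay n φ) (h' : HasDecay n χ) :
    HasDecay n fun z => φ z - χ z :=
  (h.add (h'.const_mul (-1))).congr fun z _ => by ring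

theorem HasDecay.gammaKernelDeriv (n : ℕ) (a : ℂ) : HasDecay n (gammaKernelDeriv a) :=
  ((HasDecay.gammaKernel n (a - 1)).const_mul _).sub (HasDecay.gammaKernel n a)

theorem HasDecay.gammaKernelDeriv₂ (n : ℕ) (a : ℂ) : HasDecay n (gammaKernelDeriv₂ a) :=
  ((HasDecay.gammaKernelDeriv n (a - 1)).const_mul _).sub (HasDecay.gammaKernelDeriv n a)

theorem norm_one_sub_cpow {a p : ℂ} (hp : p.re < 0) :
    ‖(1 - p) ^ a‖ = ‖1 - p‖ ^ a.re / Real.exp ((1 - p).arg * a.im) :=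
  Complex.norm_cpow_of_ne_zero (fun h => by
    have := congrArg Complex.re h; simp at this; linarith) a

theorem one_le_norm_one_sub {p : ℂ} (hp : p.re < 0) : 1 ≤ ‖1 - p‖ := by
  have h := Complex.abs_re_le_norm (1 - p)
  rw [Complex.sub_re, Complex.one_re, abs_of_pos (by linarith)] at h
  linarith

theorem norm_le_norm_one_sub {p : ℂ} (hp : p.re < 0) : ‖p‖ ≤ ‖1 - p‖ := by
  rw [← sq_le_sq₀ (norm_nonneg _) (norm_nonneg _), ← Complex.normSq_eq_norm_sq,
    ← Complex.normSq_eq_norm_sq, Complex.normSq_apply, Complex.normSq_apply]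
  simp
  nlinarith

/-- The exponential of the argument is the only effect of the imaginary part of `a`. It lies between
`e^{-π|Im a|}` and `e^{π|Im a|}`, so the transform is comparable from both sides to `|1 - p|^{-Re
a}`, uniformly up to the imaginary axis. -/
theorem norm_laplace_gammaKernel {a p : ℂ} (ha : 1 ≤ a.re) (hp : p.re < 0) :
    ‖laplace (gammaKernel a) p‖ =
      ‖Complex.Gamma a‖ * Real.exp ((1 - p).arg * a.im) / ‖1 - p‖ ^ a.re := by
  have h := congrArg norm (laplace_gammaKernel ha hp)
  have h1 : 0 < ‖1 - p‖ := one_pos.trans_le (one_le_norm_one_sub hp)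
  rw [norm_mul, norm_one_sub_cpow hp] at h
  rw [← h]
  have := Real.rpow_pos_of_pos h1 a.re
  field_simp

theorem abs_arg_mul_le (w : ℂ) (x : ℝ) : |w.arg * x| ≤ Real.pi * |x| := by
  rw [abs_mul]
  exact mul_le_mul_of_nonneg_right (Complex.abs_arg_le_pi w) (abs_nonneg _)

theorem exists_norm_laplace_gammaKernel_le {a : ℂ} (ha : 2 ≤ a.re) :
    ∃ C, ∀ p : ℂ, p.re < 0 → ‖laplace (gammaKernel a) p‖ ≤ C / ‖p‖ ^ 2 := by
  refine ⟨‖Complex.Gamma a‖ * Real.exp (Real.pi * |a.im|), fun p hp => ?_⟩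
  have hp0 : p ≠ 0 := by rintro rfl; simp at hp
  rw [norm_laplace_gammaKernel (by linarith) hp]
  refine div_le_div₀ (by positivity) ?_ (by positivity) ?_
  · have := (le_abs_self _).trans (abs_arg_mul_le (1 - p) a.im)
    gcongr
  · calc ‖p‖ ^ 2 ≤ ‖1 - p‖ ^ 2 := by gcongr; exact norm_le_norm_one_sub hp
      _ = ‖1 - p‖ ^ (2 : ℝ) := (Real.rpow_two _).symm
      _ ≤ _ := Real.rpow_le_rpow_of_exponent_le (one_le_norm_one_sub hp) ha

/-- The lower bound, resting on `Γ(a) ≠ 0`, is what turns smallness of the transform into vanishing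
of the leading coefficient `h 0`. -/
theorem exists_le_norm_laplace_gammaKernel {a : ℂ} (ha : a.re = 1) :
    ∃ c > 0, ∀ p : ℂ, p.re < 0 → c / ‖1 - p‖ ≤ ‖laplace (gammaKernel a) p‖ := by
  have hΓ : Complex.Gamma a ≠ 0 := Complex.Gamma_ne_zero_of_re_pos (by linarith)
  refine ⟨‖Complex.Gamma a‖ * Real.exp (-(Real.pi * |a.im|)), by positivity, fun p hp => ?_⟩
  have h1 : 0 < ‖1 - p‖ := one_pos.trans_le (one_le_norm_one_sub hp)
  rw [norm_laplace_gammaKernel ha.ge hp, ha, Real.rpow_one]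
  have := (neg_le_of_abs_le (abs_arg_mul_le (1 - p) a.im))
  gcongr

theorem HasDecay.ofReal_mul {n : ℕ} {φ : ℝ → ℂ} (h : HasDecay (n + 1) φ) :
    HasDecay n fun z => (z : ℂ) * φ z := by
  obtain ⟨C, hC⟩ := h
  refine ⟨C, fun z hz => ?_⟩
  have hz0 : 0 < z := by linarith
  rw [norm_mul, Complex.norm_real, Real.norm_of_nonneg hz0.le]
  calc z * ‖φ z‖ ≤ z * (C / z ^ (n + 1)) := mul_le_mul_of_nonneg_left (hC z hz) hz0.le
    _ = _ := by field_simp; ring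

theorem HasDecay.isModerate {φ : ℝ → ℂ} (h : HasDecay 0 φ) (hc : ContinuousOn φ (Ioi 0))
    {δ C : ℝ} (hδ : 0 < δ) (h0 : ∀ z ∈ Ioo 0 δ, ‖φ z‖ ≤ C) : IsModerate φ := by
  obtain ⟨D, hD⟩ := h
  exact IsModerate.of_bounds hc hδ 0 h0 (D := D) (fun z hz => by simpa using hD z hz)

theorem tendsto_zero_of_norm_le_mul {φ : ℝ → ℂ} {δ C : ℝ} (hδ : 0 < δ)
    (h : ∀ z ∈ Ioo 0 δ, ‖φ z‖ ≤ C * z) : Tendsto φ (𝓝[>] 0) (𝓝 0) := by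
  refine squeeze_zero_norm' (eventually_of_mem (Ioo_mem_nhdsGT hδ) h) ?_
  have : Tendsto (fun z : ℝ => C * z) (𝓝 0) (𝓝 (C * 0)) :=
    (continuous_const.mul continuous_id).tendsto 0
  rw [mul_zero] at this
  exact this.mono_left nhdsWithin_le_nhds

/-! ### The transformed equation and the asymptotics of the transform -/

section Moments

variable {Ω α γ Λ : ℝ} {f f₁ f₂ h h₁ h₂ : ℝ → ℂ} {δ C : ℝ} {c : ℂ}

theorem IsHeunSolution.continuousOn (hf : IsHeunSolution Ω α γ Λ f f₁ f₂) :
    ContinuousOn f (Ioi 0) := fun z hz => (hf.hasDerivAt z hz).continuousAt.continuousWithinAt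

theorem IsHeunSolution.continuousOn₁ (hf : IsHeunSolution Ω α γ Λ f f₁ f₂) :
    ContinuousOn f₁ (Ioi 0) := fun z hz => (hf.hasDerivAt₁ z hz).continuousAt.continuousWithinAt

theorem IsHeunSolution.continuousOn₂ (hf : IsHeunSolution Ω α γ Λ f f₁ f₂) :
    ContinuousOn f₂ (Ioi 0) := by
  have hne : ∀ z ∈ Ioi (0 : ℝ), (z : ℂ) * (1 + z) ≠ 0 := fun z hz =>
    mul_ne_zero (by exact_mod_cast (ne_of_gt hz)) (one_add_ofReal_ne_zero hz)
  have : ContinuousOn (fun z : ℝ => -((1 + 2 * (z : ℂ) +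
      2 * Complex.I * (Ω / 2 * z * (1 + z) - α * (1 + z) - γ * z)) * f₁ z
    + (Complex.I * (Ω * (z + 1 / 2) - (α + γ)) - Λ) * f z) / ((z : ℂ) * (1 + z))) (Ioi 0) := by
    refine ContinuousOn.div (((ContinuousOn.mul (by fun_prop) hf.continuousOn₁).add
      (ContinuousOn.mul (by fun_prop) hf.continuousOn)).neg) (by fun_prop) hne
  refine this.congr fun z hz => ?_
  have h1 := hne z hz
  simp only
  rw [eq_div_iff h1]
  linear_combination hf.ode z hz

theorem IsHeunSolution.isModerate (hf : IsHeunSolution Ω α γ Λ f f₁ f₂) (hd : HasDecay 1 f)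
    (hh : HasTaylorData h h₁ h₂ δ C) (hfh : ∀ z ∈ Ioo 0 δ, f z = osc α z * h z) :
    IsModerate f :=
  (hd.mono (Nat.zero_le 1)).isModerate hf.continuousOn hh.pos (C := C) fun z hz => by
    rw [hfh z hz, norm_mul, norm_osc, one_mul]
    exact hh.bound z ⟨by linarith [hz.1, hh.pos], hz.2⟩

theorem IsHeunSolution.isModerate₁ (hf : IsHeunSolution Ω α γ Λ f f₁ f₂) (hd : HasDecay 2 f₁)
    (hh : HasTaylorData h h₁ h₂ δ C) (hfh : ∀ z ∈ Ioo 0 δ, f z = osc α z * h z) :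
    IsModerate fun z => (z : ℂ) * f₁ z := by
  refine (hd.ofReal_mul.mono (Nat.zero_le 1)).isModerate
    (Complex.continuous_ofReal.continuousOn.mul hf.continuousOn₁) hh.pos
    (C := δ * C + ‖2 * Complex.I * (α : ℂ)‖ * C) fun z hz => ?_
  have hz0 : (z : ℂ) ≠ 0 := by exact_mod_cast hz.1.ne'
  have hz' : z ∈ Ioo (-δ) δ := ⟨by linarith [hz.1, hh.pos], hz.2⟩
  rw [deriv_of_eq_osc_mul hf.hasDerivAt hh hfh z hz]
  have e : (z : ℂ) * (osc α z * (h₁ z + 2 * Complex.I * α * h z / z)) =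
      osc α z * (z * h₁ z + 2 * Complex.I * α * h z) := by field_simp
  rw [e, norm_mul, norm_osc, one_mul]
  refine (norm_add_le _ _).trans (add_le_add ?_ ?_)
  · rw [norm_mul, Complex.norm_real, Real.norm_of_nonneg hz.1.le]
    exact mul_le_mul hz.2.le (hh.bound₁ z hz') (norm_nonneg _) hh.pos.le
  · rw [norm_mul]
    exact mul_le_mul_of_nonneg_left (hh.bound z hz') (norm_nonneg _)

/-- The equation satisfied by the Laplace transform of a Heun solution. -/
theorem IsHeunSolution.laplace_ode (hf : IsHeunSolution Ω α γ Λ f f₁ f₂) (hd : HasDecay 1 f)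
    (hd₁ : HasDecay 2 f₁)
    (hh : HasTaylorData h h₁ h₂ δ C) (hfh : ∀ z ∈ Ioo 0 δ, f z = osc α z * h z)
    {p : ℂ} (hp : p.re < 0) :
    p * (p - Complex.I * Ω) * laplace (fun z => z * (z * f z)) p +
      (p * (p - Complex.I * Ω) + (2 * p - Complex.I * Ω) + 2 * Complex.I * (α + γ) * p) *
        laplace (fun z => z * f z) p +
      ((1 + 2 * Complex.I * α) * p + Complex.I * (α + γ) - Complex.I * Ω / 2 - Λ) *
        laplace f p = 0 := by
  have m0 := hf.isModerate hd hh hfh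
  have m1 := hf.isModerate₁ hd₁ hh hfh
  have mz := m0.mul_ofReal
  have mzz := mz.mul_ofReal
  have d0 : ∀ z : ℝ, HasDerivAt (fun z : ℝ => (z : ℂ)) 1 z := fun z => by
    simpa using (hasDerivAt_id z).ofReal_comp
  -- With `k` as in `IsHeunSolution`, the equation has the divergence form `(z(1+z) f' + 2ik f)' =
  -- (ik' + Λ) f`, ready for one integration by parts.
  have mB1 : IsModerate fun z : ℝ => (1 + (z : ℂ)) * (z * f₁ z) + 2 * Complex.I *
      (Ω / 2 * z * (1 + z) - α * (1 + z) - γ * z) * f z :=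
    ((m1.add m1.mul_ofReal).add (((m0.const_mul (-(2 * Complex.I * α))).add
      (mz.const_mul (Complex.I * Ω - 2 * Complex.I * (α + γ)))).add
      (mzz.const_mul (Complex.I * Ω)))).congr fun z _ => by ring
  have mB1' : IsModerate fun z : ℝ =>
      (Complex.I * (Ω / 2 - (α + γ)) + Λ) * f z + Complex.I * Ω * (z * f z) :=
    (m0.const_mul _).add (mz.const_mul _)
  have mB2 : IsModerate fun z : ℝ => (z : ℂ) * f z + z * (z * f z) := mz.add mzz
  have mB2' : IsModerate fun z : ℝ => (f z + 2 * (z * f z)) + (1 + (z : ℂ)) * (z * f₁ z) :=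
    ((m0.add (mz.const_mul 2)).add (m1.add m1.mul_ofReal)).congr fun z _ => by ring
  have t1 := laplace_deriv mB1 mB1' (fun z hz => ?_) ?_ hp
  rotate_left
  · have hk : HasDerivAt (fun z : ℝ => 2 * Complex.I *
        (Ω / 2 * (z : ℂ) * (1 + z) - α * (1 + z) - γ * z))
        (2 * Complex.I * (Ω * (z + 1 / 2) - (α + γ))) z :=
      (((((d0 z).const_mul ((Ω : ℂ) / 2)).mul ((d0 z).const_add 1)).sub
        (((d0 z).const_add 1).const_mul (α : ℂ))).sub ((d0 z).const_mul (γ : ℂ))).const_mul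
        (2 * Complex.I) |>.congr_deriv (by ring)
    refine ((((d0 z).const_add 1).mul ((d0 z).mul (hf.hasDerivAt₁ z hz))).add
      (hk.mul (hf.hasDerivAt z hz))).congr_deriv ?_
    simp only [Pi.mul_apply]
    linear_combination hf.ode z hz
  -- The boundary term at `0` vanishes because of the horizon condition: on `z^{2iα} h` the
  -- contribution `2iα f` of `z f'` cancels `-2iα f` from `2ik f`, leaving a factor `z`.
  · refine tendsto_zero_of_norm_le_mul hh.pos (C := (1 + δ) * C +
      (‖Complex.I * (Ω : ℂ)‖ * (1 + δ) + ‖2 * Complex.I * (γ : ℂ)‖) * C) fun z hz => ?_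
    have hz0 : (z : ℂ) ≠ 0 := by exact_mod_cast hz.1.ne'
    have hz' : z ∈ Ioo (-δ) δ := ⟨by linarith [hz.1, hh.pos], hz.2⟩
    have e : (1 + (z : ℂ)) * (z * f₁ z) + 2 * Complex.I *
        (Ω / 2 * z * (1 + z) - α * (1 + z) - γ * z) * f z = osc α z * (((1 + z) * h₁ z +
        (Complex.I * Ω * (1 + z) - 2 * Complex.I * γ) * h z) * z) := by
      rw [hfh z hz, deriv_of_eq_osc_mul hf.hasDerivAt hh hfh z hz]
      field_simp
      ring
    have nz : ‖1 + (z : ℂ)‖ ≤ 1 + δ := by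
      refine (norm_add_le _ _).trans ?_
      rw [norm_one, Complex.norm_real, Real.norm_of_nonneg hz.1.le]
      linarith [hz.2]
    have hδ := hh.pos
    have hC := hh.nonneg
    rw [e, norm_mul, norm_osc, one_mul, norm_mul, Complex.norm_real, Real.norm_of_nonneg hz.1.le]
    refine mul_le_mul_of_nonneg_right ((norm_add_le _ _).trans (add_le_add ?_ ?_)) hz.1.le
    · rw [norm_mul]
      exact mul_le_mul nz (hh.bound₁ z hz') (norm_nonneg _) (by linarith)
    · rw [norm_mul]
      refine mul_le_mul ((norm_sub_le _ _).trans (add_le_add ?_ le_rfl)) (hh.bound z hz')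
        (norm_nonneg _) (by positivity)
      rw [norm_mul]
      exact mul_le_mul_of_nonneg_left nz (norm_nonneg _)
  -- `f'` may behave like `1/z` at `0` and need not have a transform of its own, so only `z f'` is
  -- used; integrating by parts `(z + z²) f` eliminates it.
  have t2 := laplace_deriv mB2 mB2' (fun z hz => ?_) ?_ hp
  rotate_left
  · refine (((d0 z).mul (hf.hasDerivAt z hz)).add
      ((d0 z).mul ((d0 z).mul (hf.hasDerivAt z hz)))).congr_deriv ?_
    simp only [Pi.mul_apply]
    ring
  · refine tendsto_zero_of_norm_le_mul hh.pos (C := (1 + δ) * C) fun z hz => ?_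
    have hz' : z ∈ Ioo (-δ) δ := ⟨by linarith [hz.1, hh.pos], hz.2⟩
    have e : (z : ℂ) * f z + z * (z * f z) = osc α z * (((1 + z) * h z) * z) := by
      rw [hfh z hz]; ring
    have nz : ‖1 + (z : ℂ)‖ ≤ 1 + δ := by
      refine (norm_add_le _ _).trans ?_
      rw [norm_one, Complex.norm_real, Real.norm_of_nonneg hz.1.le]
      linarith [hz.2]
    have hδ := hh.pos
    rw [e, norm_mul, norm_osc, one_mul, norm_mul, Complex.norm_real, Real.norm_of_nonneg hz.1.le,
      norm_mul]
    exact mul_le_mul_of_nonneg_right (mul_le_mul nz (hh.bound z hz') (norm_nonneg _)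
      (by linarith)) hz.1.le
  have t3 : laplace (fun z : ℝ => (1 + (z : ℂ)) * (z * f₁ z) + 2 * Complex.I *
      (Ω / 2 * z * (1 + z) - α * (1 + z) - γ * z) * f z) p =
      laplace (fun z : ℝ => (f z + 2 * (z * f z)) + (1 + (z : ℂ)) * (z * f₁ z)) p +
      ((-1 - 2 * Complex.I * α) * laplace f p +
        (Complex.I * Ω - 2 * Complex.I * (α + γ) - 2) * laplace (fun z => z * f z) p +
        Complex.I * Ω * laplace (fun z => z * (z * f z)) p) := by
    rw [← laplace_const_mul, ← laplace_const_mul, ← laplace_const_mul,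
      ← laplace_add (m0.const_mul _) (mz.const_mul _) hp,
      ← laplace_add ((m0.const_mul _).add (mz.const_mul _)) (mzz.const_mul _) hp,
      ← laplace_add mB2' (((m0.const_mul _).add (mz.const_mul _)).add (mzz.const_mul _)) hp]
    exact laplace_congr (fun z _ => by ring) p
  rw [t3, t2, laplace_add mz mzz hp, laplace_add (m0.const_mul _) (mz.const_mul _) hp,
    laplace_const_mul, laplace_const_mul] at t1
  linear_combination -t1

/-- Multiplied by `z^{2iα}`, the function `(b + cz) e^{-z}` is a combination of the model kernels of
index `a` and `a + 1`, `a = 1 + 2iα`. Subtracting it adjusts the 1-jet of `h` at `0` without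
disturbing the decay at infinity. -/
theorem HasTaylorData.sub_linear_mul_exp (hh : HasTaylorData h h₁ h₂ δ C) (b c : ℂ) :
    HasTaylorData (fun z => h z - (b + c * z) * Complex.exp (-z))
      (fun z => h₁ z - (c - b - c * z) * Complex.exp (-z))
      (fun z => h₂ z - (-2 * c + b + c * z) * Complex.exp (-z)) δ
      (C + (‖b‖ + (2 + δ) * ‖c‖) * Real.exp δ) := by
  have d0 : ∀ z : ℝ, HasDerivAt (fun z : ℝ => (z : ℂ)) 1 z := fun z => by
    simpa using (hasDerivAt_id z).ofReal_comp
  have hδ := hh.pos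
  have key : ∀ z ∈ Ioo (-δ) δ, ∀ u w x : ℂ, ‖u‖ ≤ C → ‖w‖ ≤ ‖b‖ + 2 * ‖c‖ → x = c * z →
      ‖u - (w + x) * Complex.exp (-z)‖ ≤ C + (‖b‖ + (2 + δ) * ‖c‖) * Real.exp δ := by
    intro z hz u w x hu hw hx
    refine (norm_sub_le _ _).trans (add_le_add hu ?_)
    rw [norm_mul]
    have hz' : ‖(z : ℂ)‖ ≤ δ := by
      rw [Complex.norm_real, Real.norm_eq_abs]; exact (abs_lt.2 hz).le
    have hx' : ‖x‖ ≤ ‖c‖ * δ := by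
      rw [hx, norm_mul]; exact mul_le_mul_of_nonneg_left hz' (norm_nonneg _)
    refine mul_le_mul ((norm_add_le _ _).trans (by linarith)) ?_ (norm_nonneg _) (by positivity)
    rw [Complex.norm_exp]
    exact Real.exp_le_exp.2 (by simpa using (by linarith [hz.1] : -z ≤ δ))
  have hb := norm_nonneg b
  have hc := norm_nonneg c
  refine ⟨hδ, fun z hz => ?_, fun z hz => ?_, fun z hz => ?_, fun z hz => ?_, fun z hz => ?_⟩
  · refine ((hh.hasDerivAt z hz).sub ((((d0 z).const_mul c).const_add b).mul
      (d0 z).neg.cexp)).congr_deriv ?_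
    simp only [Pi.neg_apply]
    ring
  · refine ((hh.hasDerivAt₁ z hz).sub ((((d0 z).const_mul c).const_sub (c - b)).mul
      (d0 z).neg.cexp)).congr_deriv ?_
    simp only [Pi.neg_apply]
    ring
  · exact key z hz _ _ _ (hh.bound z hz) (by linarith) rfl
  · have h3 := key z hz (-h₁ z) (b - c) (c * z) (by rw [norm_neg]; exact hh.bound₁ z hz)
      ((norm_sub_le _ _).trans (by linarith)) rfl
    rw [← norm_neg] at h3
    refine le_trans (le_of_eq ?_) h3
    congr 1
    ring
  · refine key z hz _ _ _ (hh.bound₂ z hz) ?_ rfl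
    refine (norm_add_le _ _).trans ?_
    rw [norm_mul, norm_neg, Complex.norm_two]
    linarith

/-- Asymptotics of the Laplace transform of `f` and of its derivative: the leading term comes from
the leading behaviour of `f` at `0`. -/
theorem IsHeunSolution.exists_laplace_asymptotics (hf : IsHeunSolution Ω α γ Λ f f₁ f₂)
    (hd : HasDecay 1 f) (hd₁ : HasDecay 2 f₁) (hd₂ : HasDecay 2 f₂)
    (hg₂ : HasDecay 2 (fun z => (1 + (z : ℂ)) * f₂ z + 2 * f₁ z))
    (hh : HasTaylorData h h₁ h₂ δ C) (hfh : ∀ z ∈ Ioo 0 δ, f z = osc α z * h z) :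
    ∃ B, ∀ p : ℂ, p.re < 0 →
      ‖laplace f p - h 0 * laplace (gammaKernel (1 + 2 * Complex.I * α)) p‖ ≤ B / ‖p‖ ^ 2 ∧
      ‖laplace (fun z => z * f z) p‖ ≤ B / ‖p‖ ^ 2 := by
  have d0 : ∀ z : ℝ, HasDerivAt (fun z : ℝ => (z : ℂ)) 1 z := fun z => by
    simpa using (hasDerivAt_id z).ofReal_comp
  set a : ℂ := 1 + 2 * Complex.I * α with ha
  have hare : a.re = 1 := by simp [ha]
  set b := h 0 with hb
  -- The value for which `(b + cz) e^{-z} = b + (c - b) z + …` has the same 1-jet at `0` as `h`.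
  set c := h₁ 0 + h 0 with hc
  have hH := hh.sub_linear_mul_exp b c
  set v : ℝ → ℂ := fun z => f z - (b * gammaKernel a z + c * gammaKernel (a + 1) z) with hv
  set v₁ : ℝ → ℂ := fun z =>
    f₁ z - (b * gammaKernelDeriv a z + c * gammaKernelDeriv (a + 1) z) with hv₁
  set v₂ : ℝ → ℂ := fun z =>
    f₂ z - (b * gammaKernelDeriv₂ a z + c * gammaKernelDeriv₂ (a + 1) z) with hv₂
  have dv : ∀ z > 0, HasDerivAt v (v₁ z) z := fun z hz => (hf.hasDerivAt z hz).sub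
    (((hasDerivAt_gammaKernel' a hz).const_mul b).add
      ((hasDerivAt_gammaKernel' (a + 1) hz).const_mul c))
  have dv₁ : ∀ z > 0, HasDerivAt v₁ (v₂ z) z := fun z hz => (hf.hasDerivAt₁ z hz).sub
    (((hasDerivAt_gammaKernelDeriv a hz).const_mul b).add
      ((hasDerivAt_gammaKernelDeriv (a + 1) hz).const_mul c))
  have hvH : ∀ z ∈ Ioo 0 δ, v z = osc α z * (h z - (b + c * z) * Complex.exp (-z)) :=
    fun z hz => by
      simp only [hv]
      rw [← mul_gammaKernel a hz.1, gammaKernel_eq_osc, hfh z hz]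
      ring
  obtain ⟨D, hD0, hD⟩ := norm_le_of_eq_osc_mul dv dv₁ hH hvH (by simp [hb]) (by simp [hc, hb])
  have hK : ∀ n, HasDecay n fun z => b * gammaKernel a z + c * gammaKernel (a + 1) z := fun n =>
    ((HasDecay.gammaKernel n a).const_mul b).add ((HasDecay.gammaKernel n (a + 1)).const_mul c)
  have hK₁ : ∀ n, HasDecay n fun z => b * gammaKernelDeriv a z + c * gammaKernelDeriv (a + 1) z :=
    fun n => ((HasDecay.gammaKernelDeriv n a).const_mul b).add
      ((HasDecay.gammaKernelDeriv n (a + 1)).const_mul c)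
  have hK₂ : ∀ n, HasDecay n fun z =>
      b * gammaKernelDeriv₂ a z + c * gammaKernelDeriv₂ (a + 1) z :=
    fun n => ((HasDecay.gammaKernelDeriv₂ n a).const_mul b).add
      ((HasDecay.gammaKernelDeriv₂ n (a + 1)).const_mul c)
  have ev : HasDecay 1 v := hd.sub (hK 1)
  have ev₁ : HasDecay 2 v₁ := hd₁.sub (hK₁ 2)
  have ev₂ : HasDecay 2 v₂ := hd₂.sub (hK₂ 2)
  have eg₂ : HasDecay 2 fun z => (1 + (z : ℂ)) * v₂ z + 2 * v₁ z :=
    (hg₂.sub (((hK₂ 2).add (hK₂ 3).ofReal_mul).add ((hK₁ 2).const_mul 2))).congr fun z _ => by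
      simp only [hv₁, hv₂]; ring
  have cK₂ : ∀ a : ℂ, ContinuousOn (gammaKernel a) (Ioi 0) := fun a z hz =>
    (hasDerivAt_gammaKernel a hz).continuousAt.continuousWithinAt
  have cv₂ : ContinuousOn v₂ (Ioi 0) := by
    refine hf.continuousOn₂.sub (ContinuousOn.add (continuousOn_const.mul ?_)
      (continuousOn_const.mul ?_)) <;>
    · unfold gammaKernelDeriv₂ gammaKernelDeriv
      exact (continuousOn_const.mul ((continuousOn_const.mul (cK₂ _)).sub (cK₂ _))).sub
        ((continuousOn_const.mul (cK₂ _)).sub (cK₂ _))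
  have mv : IsModerate v := (ev.mono (Nat.zero_le 1)).isModerate
    (fun z hz => (dv z hz).continuousAt.continuousWithinAt) hh.pos (C := D * δ ^ 2) fun z hz =>
      (hD z hz).1.trans (mul_le_mul_of_nonneg_left
        (pow_le_pow_left₀ hz.1.le hz.2.le 2) hD0)
  have mv₁ : IsModerate v₁ := (ev₁.mono (Nat.zero_le 2)).isModerate
    (fun z hz => (dv₁ z hz).continuousAt.continuousWithinAt) hh.pos (C := D * δ) fun z hz =>
      (hD z hz).2.1.trans (mul_le_mul_of_nonneg_left hz.2.le hD0)
  have mv₂ : IsModerate v₂ := (ev₂.mono (Nat.zero_le 2)).isModerate cv₂ hh.pos (C := D)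
    fun z hz => (hD z hz).2.2
  have t0 : Tendsto v (𝓝[>] 0) (𝓝 0) :=
    tendsto_zero_of_norm_le_mul hh.pos (C := D * δ) fun z hz => (hD z hz).1.trans (by
      rw [sq, ← mul_assoc]
      exact mul_le_mul_of_nonneg_right (mul_le_mul_of_nonneg_left hz.2.le hD0) hz.1.le)
  have t1 : Tendsto v₁ (𝓝[>] 0) (𝓝 0) :=
    tendsto_zero_of_norm_le_mul hh.pos (C := D) fun z hz => (hD z hz).2.1
  have tid : Tendsto (fun z : ℝ => (z : ℂ)) (𝓝[>] 0) (𝓝 0) := by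
    have := Complex.continuous_ofReal.tendsto 0
    rw [Complex.ofReal_zero] at this
    exact this.mono_left nhdsWithin_le_nhds
  obtain ⟨D₂, hD₂⟩ := ev₂
  obtain ⟨D₃, hD₃⟩ := eg₂
  obtain ⟨B₁, hB₁⟩ := exists_norm_laplace_le mv mv₁ mv₂ dv dv₁ t0 t1
    (mv₂.integrableOn_of_decay hD₂)
  have mg₂ : IsModerate fun z => (1 + (z : ℂ)) * v₂ z + 2 * v₁ z :=
    ((mv₂.add mv₂.mul_ofReal).add (mv₁.const_mul 2)).congr fun z _ => by ring
  -- The transform of `z v` is obtained from those of `(1 + z) v` and `v`: the second derivative of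
  -- `(1 + z) v` is the combination whose integrability at infinity is supplied by `hg₂`.
  obtain ⟨B₂, hB₂⟩ := exists_norm_laplace_le (φ := fun z => (1 + (z : ℂ)) * v z)
    (φ₁ := fun z => (1 + (z : ℂ)) * v₁ z + v z) (φ₂ := fun z => (1 + (z : ℂ)) * v₂ z + 2 * v₁ z)
    ((mv.add mv.mul_ofReal).congr fun z _ => by ring)
    (((mv₁.add mv₁.mul_ofReal).add mv).congr fun z _ => by ring) mg₂
    (fun z hz => (((d0 z).const_add 1).mul (dv z hz)).congr_deriv (by ring))
    (fun z hz => ((((d0 z).const_add 1).mul (dv₁ z hz)).add (dv z hz)).congr_deriv (by ring))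
    (by simpa using (tid.const_add 1).mul t0) (by simpa using ((tid.const_add 1).mul t1).add t0)
    (mg₂.integrableOn_of_decay hD₃)
  obtain ⟨B₃, hB₃⟩ := exists_norm_laplace_gammaKernel_le (a := a + 1) (by simp [hare]; norm_num)
  obtain ⟨B₄, hB₄⟩ := exists_norm_laplace_gammaKernel_le (a := a + 1 + 1)
    (by simp [hare]; norm_num)
  have mK := isModerate_gammaKernel (a := a) hare.ge
  have mK' := isModerate_gammaKernel (a := a + 1) (by simp [hare])
  have mK'' := isModerate_gammaKernel (a := a + 1 + 1) (by simp [hare])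
  have m0 := hf.isModerate hd hh hfh
  refine ⟨max (‖c‖ * B₃ + B₁) (‖b‖ * B₃ + ‖c‖ * B₄ + (B₂ + B₁)), fun p hp => ⟨?_, ?_⟩⟩
  · have e : laplace f p = b * laplace (gammaKernel a) p +
        c * laplace (gammaKernel (a + 1)) p + laplace v p := by
      rw [← laplace_const_mul, ← laplace_const_mul,
        ← laplace_add (mK.const_mul _) (mK'.const_mul _) hp,
        ← laplace_add ((mK.const_mul _).add (mK'.const_mul _)) mv hp]
      exact laplace_congr (fun z _ => by simp only [hv]; ring) p
    have e' : laplace f p - b * laplace (gammaKernel a) p =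
        c * laplace (gammaKernel (a + 1)) p + laplace v p := by rw [e]; ring
    rw [e']
    refine (norm_add_le _ _).trans (le_trans ?_
      (div_le_div_of_nonneg_right (le_max_left _ _) (by positivity)))
    rw [norm_mul, add_div, mul_div_assoc]
    exact add_le_add (mul_le_mul_of_nonneg_left (hB₃ p hp) (norm_nonneg _)) (hB₁ p hp)
  · have mg : IsModerate fun z => (1 + (z : ℂ)) * v z :=
      (mv.add mv.mul_ofReal).congr fun z _ => by ring
    have e : laplace (fun z => z * f z) p = b * laplace (gammaKernel (a + 1)) p +
        c * laplace (gammaKernel (a + 1 + 1)) p +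
        (laplace (fun z => (1 + (z : ℂ)) * v z) p + (-1) * laplace v p) := by
      rw [← laplace_const_mul, ← laplace_const_mul, ← laplace_const_mul,
        ← laplace_add (mK'.const_mul _) (mK''.const_mul _) hp,
        ← laplace_add mg (mv.const_mul _) hp,
        ← laplace_add ((mK'.const_mul _).add (mK''.const_mul _)) (mg.add (mv.const_mul _)) hp]
      refine laplace_congr (fun z hz => ?_) p
      simp only [hv]
      rw [← mul_gammaKernel (a + 1) hz, ← mul_gammaKernel a hz]
      ring
    rw [e]
    refine (norm_add_le _ _).trans (le_trans (add_le_add (norm_add_le _ _) (norm_add_le _ _)) ?_)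
    refine le_trans ?_ (div_le_div_of_nonneg_right (le_max_right _ _) (by positivity))
    rw [norm_mul, norm_mul, norm_mul, norm_neg, norm_one, one_mul, add_div, add_div, add_div,
      mul_div_assoc, mul_div_assoc]
    exact add_le_add (add_le_add (mul_le_mul_of_nonneg_left (hB₃ p hp) (norm_nonneg _))
      (mul_le_mul_of_nonneg_left (hB₄ p hp) (norm_nonneg _))) (add_le_add (hB₂ p hp) (hB₁ p hp))

end Moments

end ConfluentHeun

/-! ### The flux identity along vertical lines -/

section FluxIdentity

open Filter Set Topology MeasureTheory ComplexConjugate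

section Flux

/-- The flux of a solution of the transformed equation along the line `p = iΩv - ε`. -/
noncomputable def flux (Ω μ ε : ℝ) (F F' : ℝ → ℂ) (v : ℝ) : ℝ :=
  ((-(Complex.I / Ω) * ((Complex.I * Ω * v - ε) * (Complex.I * Ω * v - ε - Complex.I * Ω)) * F' v +
    Complex.I * (Ω / 2 * v * (v - 1) + μ * v) * F v) * conj (F v)).im

variable {Ω α μ Λ ε : ℝ} {F F' F'' : ℝ → ℂ}

/-- For `ε = 0` the equation reads `(v(v-1) F_v)_v + 2iκ F_v + iκ_v F - (2αΩv + Λ) F = 0` with `κ =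
Ωv(v-1)/2 + μv` real. Pairing with `conj F` makes the `κ` terms a total derivative up to real
quantities, and the potential is real, so the imaginary part of the flux is constant. For `ε > 0`
the remainder carries a factor `ε`. Here `F'` is the derivative in `p`, whence the factors `iΩ`. -/
theorem hasDerivAt_flux (hΩ : Ω ≠ 0) {v : ℝ} (hF : HasDerivAt F (Complex.I * Ω * F' v) v)
    (hF' : HasDerivAt F' (Complex.I * Ω * F'' v) v) {p : ℂ} (hp : p = Complex.I * Ω * v - ε)
    (hode : p * (p - Complex.I * Ω) * F'' v +
      (p * (p - Complex.I * Ω) + (2 * p - Complex.I * Ω) + 2 * Complex.I * μ * p) * F' v +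
      ((1 + 2 * Complex.I * α) * p + Complex.I * μ - Complex.I * Ω / 2 - Λ) * F v = 0) :
    HasDerivAt (flux Ω μ ε F F')
      (ε * ((((Complex.I * Ω * (2 * v - 1) - ε + 2 * Complex.I * μ) * F' v +
        (1 + 2 * Complex.I * α) * F v) * conj (F v)).im +
        Ω * (2 * v - 1) * Complex.normSq (F' v))) v := by
  have hΩ' : (Ω : ℂ) ≠ 0 := by exact_mod_cast hΩ
  have d0 : HasDerivAt (fun z : ℝ => (z : ℂ)) 1 v := by simpa using (hasDerivAt_id v).ofReal_comp
  have dp := (d0.const_mul (Complex.I * (Ω : ℂ))).sub_const (ε : ℂ)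
  have dX := ((dp.mul (dp.sub_const (Complex.I * Ω))).const_mul (-(Complex.I / (Ω : ℂ)))).mul hF'
  have dk := (((d0.const_mul ((Ω : ℂ) / 2)).mul (d0.sub_const 1)).add
    (d0.const_mul (μ : ℂ))).const_mul Complex.I
  have dW := (dX.add (dk.mul hF)).mul hF.star
  have dI := Complex.imCLM.hasFDerivAt.comp_hasDerivAt v dW
  refine dI.congr_deriv ?_
  simp only [Pi.mul_apply, Pi.add_apply, Complex.imCLM_apply]
  have hII : Complex.I * Complex.I = -1 := Complex.I_mul_I
  have e1 : Complex.I / (Ω : ℂ) * (Complex.I * Ω) = -1 := by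
    field_simp
    linear_combination hII
  have hstar : star (Complex.I * Ω * F' v) = -Complex.I * Ω * conj (F' v) := by
    rw [← starRingEnd_apply, map_mul, map_mul, Complex.conj_I, Complex.conj_ofReal]
  -- The equation solved for the derivative of the second order part, with the `ε = 0` terms
  -- separated from those carrying an explicit `ε`.
  have key : (-(Complex.I / Ω) *
      (Complex.I * Ω * 1 * (Complex.I * Ω * v - ε - Complex.I * Ω) +
        (Complex.I * Ω * v - ε) * (Complex.I * Ω * 1)) * F' v +
      -(Complex.I / Ω) * ((Complex.I * Ω * v - ε) * (Complex.I * Ω * v - ε - Complex.I * Ω)) *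
        (Complex.I * Ω * F'' v)) =
      (Ω * Ω * v * (v - 1) + 2 * μ * Ω * v) * F' v -
        (Complex.I * (Ω * v + μ - Ω / 2) - 2 * α * Ω * v - Λ) * F v +
      ε * ((Complex.I * Ω * (2 * v - 1) - ε + 2 * Complex.I * μ) * F' v +
        (1 + 2 * Complex.I * α) * F v) := by
    subst hp
    linear_combination hode - ((Complex.I * Ω * v - ε - Complex.I * Ω) * F' v +
      (Complex.I * Ω * v - ε) * F' v + (Complex.I * Ω * v - ε) *
        (Complex.I * Ω * v - ε - Complex.I * Ω) * F'' v) * e1 +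
      (-(Ω : ℂ) ^ 2 * v * (v - 1) * F' v - 2 * μ * Ω * v * F' v - 2 * α * Ω * v * F v) * hII
  rw [key]
  have e2 : -(Complex.I / (Ω : ℂ)) *
      ((Complex.I * Ω * v - ε) * (Complex.I * Ω * v - ε - Complex.I * Ω)) * F' v *
      star (Complex.I * Ω * F' v) =
      -((Complex.I * Ω * v - ε) * (Complex.I * Ω * v - ε - Complex.I * Ω)) *
        (F' v * conj (F' v)) := by
    rw [hstar]
    linear_combination (((Complex.I * Ω * v - ε) * (Complex.I * Ω * v - ε - Complex.I * Ω)) *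
        (F' v * conj (F' v))) * e1
  rw [add_mul _ _ (star (Complex.I * Ω * F' v)), e2, hstar]
  simp [Complex.normSq_apply]
  ring

/-- The flux is conserved up to an error of order `ε`. -/
theorem abs_flux_sub_le (hΩ : Ω ≠ 0) (hε : 0 < ε) (hε1 : ε ≤ 1) {V A : ℝ} (hV : 1 ≤ V)
    (hF : ∀ v ∈ Icc 1 V, HasDerivAt F (Complex.I * Ω * F' v) v)
    (hF' : ∀ v ∈ Icc 1 V, HasDerivAt F' (Complex.I * Ω * F'' v) v)
    (hode : ∀ v ∈ Icc 1 V, ∀ p : ℂ, p = Complex.I * Ω * v - ε → p * (p - Complex.I * Ω) * F'' v +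
      (p * (p - Complex.I * Ω) + (2 * p - Complex.I * Ω) + 2 * Complex.I * μ * p) * F' v +
      ((1 + 2 * Complex.I * α) * p + Complex.I * μ - Complex.I * Ω / 2 - Λ) * F v = 0)
    (hA : ∀ v ∈ Icc 1 V, ‖F v‖ ≤ A) (hA' : ∀ v ∈ Icc 1 V, ‖F' v‖ ≤ A) :
    |flux Ω μ ε F F' V - flux Ω μ ε F F' 1| ≤
      ε * ((4 * |Ω| * V + 2 + 2 * |μ| + 2 * |α|) * A ^ 2) * (V - 1) := by
  have key := (convex_Icc 1 V).norm_image_sub_le_of_norm_hasDerivWithin_le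
    (f := flux Ω μ ε F F') (C := ε * ((4 * |Ω| * V + 2 + 2 * |μ| + 2 * |α|) * A ^ 2))
    (fun v hv => (hasDerivAt_flux hΩ (hF v hv) (hF' v hv) rfl
      (hode v hv _ rfl)).hasDerivWithinAt) (fun v hv => ?_)
    (left_mem_Icc.2 hV) (right_mem_Icc.2 hV)
  · rwa [Real.norm_eq_abs, Real.norm_of_nonneg (by linarith)] at key
  · have hv0 : 0 ≤ 2 * v - 1 := by linarith [hv.1]
    have hv1 : 2 * v - 1 ≤ 2 * V := by linarith [hv.2]
    have hA0 : 0 ≤ A := (norm_nonneg _).trans (hA v hv)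
    rw [norm_mul, Real.norm_of_nonneg hε.le]
    refine mul_le_mul_of_nonneg_left ?_ hε.le
    have n1 : ‖Complex.I * Ω * (2 * v - 1) - ε + 2 * Complex.I * μ‖ ≤
        |Ω| * (2 * V) + 1 + 2 * |μ| := by
      refine (norm_add_le _ _).trans (add_le_add ((norm_sub_le _ _).trans (add_le_add ?_ ?_)) ?_)
      · have : (2 * (v : ℂ) - 1) = ((2 * v - 1 : ℝ) : ℂ) := by push_cast; ring
        rw [this, norm_mul, norm_mul, Complex.norm_I, one_mul, Complex.norm_real,
          Complex.norm_real, Real.norm_eq_abs, Real.norm_of_nonneg hv0]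
        exact mul_le_mul_of_nonneg_left hv1 (abs_nonneg _)
      · rw [Complex.norm_real, Real.norm_of_nonneg hε.le]; exact hε1
      · simp
    have n2 : ‖1 + 2 * Complex.I * (α : ℂ)‖ ≤ 1 + 2 * |α| := by
      refine (norm_add_le _ _).trans ?_
      simp
    have n3 : ‖((Complex.I * Ω * (2 * v - 1) - ε + 2 * Complex.I * μ) * F' v +
        (1 + 2 * Complex.I * α) * F v) * conj (F v)‖ ≤
        ((|Ω| * (2 * V) + 1 + 2 * |μ|) * A + (1 + 2 * |α|) * A) * A := by
      rw [norm_mul, RCLike.norm_conj]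
      refine mul_le_mul ((norm_add_le _ _).trans (add_le_add ?_ ?_)) (hA v hv) (norm_nonneg _)
        (by positivity)
      · rw [norm_mul]; exact mul_le_mul n1 (hA' v hv) (norm_nonneg _) (by positivity)
      · rw [norm_mul]; exact mul_le_mul n2 (hA v hv) (norm_nonneg _) (by positivity)
    have n4 : ‖Ω * (2 * v - 1) * Complex.normSq (F' v)‖ ≤ |Ω| * (2 * V) * A ^ 2 := by
      rw [norm_mul, norm_mul, Real.norm_eq_abs, Real.norm_of_nonneg hv0,
        Real.norm_of_nonneg (Complex.normSq_nonneg _), Complex.normSq_eq_norm_sq]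
      have := pow_le_pow_left₀ (norm_nonneg _) (hA' v hv) 2
      gcongr
    refine (norm_add_le _ _).trans ((add_le_add ((Complex.abs_im_le_norm _).trans n3) n4).trans ?_)
    exact le_of_eq (by ring)

theorem flux_eq (v : ℝ) : flux Ω μ ε F F' v =
    (-(Complex.I / Ω) * ((Complex.I * Ω * v - ε) * (Complex.I * Ω * v - ε - Complex.I * Ω)) *
      F' v * conj (F v)).im + (Ω / 2 * v * (v - 1) + μ * v) * ‖F v‖ ^ 2 := by
  rw [flux, add_mul, Complex.add_im]
  congr 1
  rw [mul_assoc _ (F v), Complex.mul_conj, Complex.normSq_eq_norm_sq]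
  simp [-Complex.ofReal_pow]

/-- Isolates the term with definite sign. The error is small at both ends: at `v = 1` the factor `p
- iΩ` is `-ε`, and for large `v` the decay of `F'` compensates `|p|²`. -/
theorem norm_mul_sub_flux (hΩ : Ω ≠ 0) (v : ℝ) :
    |Ω * flux Ω μ ε F F' v - Ω * (Ω / 2 * v * (v - 1) + μ * v) * ‖F v‖ ^ 2| ≤
      ‖Complex.I * Ω * v - ε‖ * ‖Complex.I * Ω * v - ε - Complex.I * Ω‖ * ‖F' v‖ * ‖F v‖ := by
  rw [flux_eq]
  have e : ∀ x y z : ℝ, Ω * (x + y * z) - Ω * y * z = Ω * x := fun x y z => by ring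
  rw [e, abs_mul]
  refine (mul_le_mul_of_nonneg_left (Complex.abs_im_le_norm _) (abs_nonneg _)).trans (le_of_eq ?_)
  simp only [norm_mul, norm_neg, norm_div, Complex.norm_I, Complex.norm_real, Real.norm_eq_abs,
    RCLike.norm_conj]
  have := abs_ne_zero.2 hΩ
  field_simp

end Flux

theorem exists_norm_laplace_gammaKernel_le' {a : ℂ} (ha : a.re = 1) :
    ∃ C ≥ 0, ∀ p : ℂ, p.re < 0 → ‖laplace (gammaKernel a) p‖ ≤ C / ‖p‖ := by
  refine ⟨‖Complex.Gamma a‖ * Real.exp (Real.pi * |a.im|), by positivity, fun p hp => ?_⟩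
  have hp0 : p ≠ 0 := by rintro rfl; simp at hp
  rw [norm_laplace_gammaKernel ha.ge hp, ha, Real.rpow_one]
  have := (le_abs_self _).trans (abs_arg_mul_le (1 - p) a.im)
  have := norm_le_norm_one_sub hp
  gcongr

/-- The algebraic end of the flux argument. -/
theorem eq_zero_of_sq_mul_le {c B : ℝ} (h : ∀ V ≥ 1, c ^ 2 * V ≤ B) : c = 0 := by
  by_contra hc
  have hc2 : 0 < c ^ 2 := by positivity
  have h1 := h (max 1 ((B + 1) / c ^ 2)) (le_max_left _ _)
  have h2 : c ^ 2 * ((B + 1) / c ^ 2) ≤ c ^ 2 * max 1 ((B + 1) / c ^ 2) :=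
    mul_le_mul_of_nonneg_left (le_max_right _ _) hc2.le
  rw [mul_div_cancel₀ _ hc2.ne'] at h2
  linarith

/-! ### Vanishing of the leading coefficient at the horizon -/

section Leading

variable {Ω α γ Λ : ℝ} {f f₁ f₂ h h₁ h₂ : ℝ → ℂ} {δ C : ℝ} {c : ℂ}

theorem line_re (Ω v ε : ℝ) : (Complex.I * Ω * v - ε).re = -ε := by simp

theorem line_norm_sq (Ω v ε : ℝ) : ‖Complex.I * Ω * v - ε‖ ^ 2 = (Ω * v) ^ 2 + ε ^ 2 := by
  rw [← Complex.normSq_eq_norm_sq, Complex.normSq_apply]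
  simp
  ring

theorem le_line_norm (Ω v ε : ℝ) : |Ω| * |v| ≤ ‖Complex.I * Ω * v - ε‖ := by
  rw [← abs_mul]
  refine abs_le_of_sq_le_sq ?_ (norm_nonneg _)
  rw [line_norm_sq]
  nlinarith

theorem line_sub_norm_le (Ω ε : ℝ) {v : ℝ} (hv : 1 ≤ v) :
    ‖Complex.I * Ω * v - ε - Complex.I * Ω‖ ≤ ‖Complex.I * Ω * v - ε‖ := by
  have e : Complex.I * Ω * v - ε - Complex.I * Ω = Complex.I * Ω * ((v - 1 : ℝ) : ℂ) - ε := by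
    push_cast; ring
  rw [e, ← sq_le_sq₀ (norm_nonneg _) (norm_nonneg _), line_norm_sq, line_norm_sq]
  have : (v - 1) ^ 2 ≤ v ^ 2 := by nlinarith
  nlinarith [mul_le_mul_of_nonneg_left this (sq_nonneg Ω)]

theorem line_norm_le (Ω : ℝ) {v ε : ℝ} (hv : 0 ≤ v) (hε : 0 ≤ ε) :
    ‖Complex.I * Ω * v - ε‖ ≤ |Ω| * v + ε := by
  refine (norm_sub_le _ _).trans (le_of_eq ?_)
  simp [abs_of_nonneg hv, abs_of_nonneg hε]

/-- The flux inequality for the Laplace transform along `p = iΩv - ε`. -/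
theorem IsHeunSolution.exists_sq_norm_laplace_le (hf : IsHeunSolution Ω α γ Λ f f₁ f₂)
    (hΩ : Ω ≠ 0) (hμ : Ω * (α + γ) ≤ 0) (hd : HasDecay 1 f) (hd₁ : HasDecay 2 f₁)
    (hh : HasTaylorData h h₁ h₂ δ C) (hfh : ∀ z ∈ Ioo 0 δ, f z = osc α z * h z) {A B : ℝ}
    (hA : ∀ p : ℂ, p.re < 0 → |Ω| ≤ ‖p‖ → ‖laplace f p‖ ≤ A / ‖p‖)
    (hB : ∀ p : ℂ, p.re < 0 → ‖laplace (fun z => z * f z) p‖ ≤ B / ‖p‖ ^ 2) :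
    ∃ D : ℝ, ∀ V : ℝ, 1 ≤ V → ∃ ε ∈ Ioc (0 : ℝ) 1,
      (V * ‖laplace f (Complex.I * Ω * V - ε)‖) ^ 2 * V ≤ D := by
  have hΩ0 : 0 < |Ω| := abs_pos.2 hΩ
  have hpre : ∀ {ε : ℝ}, 0 < ε → ∀ v : ℝ, (Complex.I * Ω * v - ε).re < 0 := fun hε v => by
    rw [line_re]; linarith
  have hple : ∀ (ε : ℝ) {v : ℝ}, 1 ≤ v → |Ω| * v ≤ ‖Complex.I * Ω * v - ε‖ := fun ε v hv => by
    have := le_line_norm Ω v ε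
    rwa [abs_of_nonneg (show 0 ≤ v by linarith)] at this
  have hA0 : 0 ≤ A := by
    have hle := hple 1 le_rfl
    rw [mul_one] at hle
    have h := (norm_nonneg _).trans (hA _ (hpre one_pos 1) hle)
    by_contra hneg
    exact absurd h (not_le.2 (div_neg_of_neg_of_pos (not_le.1 hneg) (hΩ0.trans_le hle)))
  have hB0 : 0 ≤ B := by
    have hle := hple 1 le_rfl
    rw [mul_one] at hle
    have h := (norm_nonneg _).trans (hB _ (hpre one_pos 1))
    by_contra hneg
    have : 0 < ‖Complex.I * Ω * (1 : ℝ) - (1 : ℝ)‖ := hΩ0.trans_le hle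
    exact absurd h (not_le.2 (div_neg_of_neg_of_pos (not_le.1 hneg) (by positivity)))
  set μ := α + γ with hμdef
  set A₀ := max (A / |Ω|) (B / |Ω| ^ 2) with hA₀
  have hA₀0 : 0 ≤ A₀ := (by positivity : 0 ≤ A / |Ω|).trans (le_max_left _ _)
  have m0 := hf.isModerate hd hh hfh
  have mz := m0.mul_ofReal
  set x₀ := A / |Ω| with hx₀
  refine ⟨(2 / Ω ^ 2) * (Ω ^ 2 / 2 * x₀ ^ 2 + |Ω * μ| * x₀ ^ 2 + B * x₀ + 1), fun V hV => ?_⟩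
  have hV0 : 0 < V := by linarith
  -- `ε K` bounds `|Ω|` times the drift of the flux over `[1, V]` plus the error term at `v = 1`. As
  -- `K` does not involve `ε`, the choice `ε = 1 / (1 + K V)` gives `ε K V ≤ 1`.
  set K := |Ω| * ((4 * |Ω| * V + 2 + 2 * |μ| + 2 * |α|) * A₀ ^ 2 * (V - 1)) +
    (|Ω| + 1) * A₀ ^ 2 with hK
  have hK0 : 0 ≤ K := by
    have : 0 ≤ V - 1 := by linarith
    positivity
  set ε := 1 / (1 + K * V) with hεdef
  have hKV : 0 ≤ K * V := by positivity
  have hε : 0 < ε := by positivity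
  have hε1 : ε ≤ 1 := by rw [hεdef, div_le_one (by positivity)]; linarith
  refine ⟨ε, ⟨hε, hε1⟩, ?_⟩
  set F : ℝ → ℂ := fun v => laplace f (Complex.I * Ω * v - ε) with hF
  set F' : ℝ → ℂ := fun v => laplace (fun z => z * f z) (Complex.I * Ω * v - ε) with hF'
  set F'' : ℝ → ℂ := fun v => laplace (fun z => z * (z * f z)) (Complex.I * Ω * v - ε) with hF''
  have dl : ∀ v : ℝ, HasDerivAt (fun v : ℝ => Complex.I * (Ω : ℂ) * v - ε)
      (Complex.I * Ω) v := fun v => by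
    simpa using (((hasDerivAt_id v).ofReal_comp).const_mul (Complex.I * (Ω : ℂ))).sub_const
      (ε : ℂ)
  have dF : ∀ v : ℝ, HasDerivAt F (Complex.I * Ω * F' v) v := fun v => by
    have := HasDerivAt.comp (h₂ := laplace f) v (hasDerivAt_laplace m0 (hpre hε v)) (dl v)
    exact this.congr_deriv (mul_comm _ _)
  have dF' : ∀ v : ℝ, HasDerivAt F' (Complex.I * Ω * F'' v) v := fun v => by
    have := HasDerivAt.comp (h₂ := laplace (fun z => z * f z)) v (hasDerivAt_laplace mz (hpre hε v)) (dl v)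
    exact this.congr_deriv (mul_comm _ _)
  have bF : ∀ v ≥ 1, ‖F v‖ ≤ A / (|Ω| * v) := fun v hv => by
    have h1 := hple ε hv
    refine (hA _ (hpre hε v) (le_trans ?_ h1)).trans ?_
    · exact le_mul_of_one_le_right hΩ0.le hv
    · exact div_le_div_of_nonneg_left hA0 (by positivity) h1
  have bF' : ∀ v ≥ 1, ‖F' v‖ ≤ B / |Ω| ^ 2 := fun v hv => by
    have h1 := (le_mul_of_one_le_right hΩ0.le hv).trans (hple ε hv)
    exact (hB _ (hpre hε v)).trans (div_le_div_of_nonneg_left hB0 (by positivity)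
      (pow_le_pow_left₀ hΩ0.le h1 2))
  have bF0 : ∀ v ≥ 1, ‖F v‖ ≤ A₀ := fun v hv => (bF v hv).trans
    ((div_le_div_of_nonneg_left hA0 hΩ0 (le_mul_of_one_le_right hΩ0.le hv)).trans (le_max_left _ _))
  have bF0' : ∀ v ≥ 1, ‖F' v‖ ≤ A₀ := fun v hv => (bF' v hv).trans (le_max_right _ _)
  have hflux := abs_flux_sub_le (Ω := Ω) (μ := μ) (α := α) (Λ := Λ) (ε := ε) (F := F) (F' := F')
    (F'' := F'') hΩ hε hε1 hV (fun v _ => dF v) (fun v _ => dF' v)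
    (fun v hv p hp => by
      subst hp
      have := hf.laplace_ode hd hd₁ hh hfh (hpre hε v)
      simp only [hF, hF', hF'', hμdef]
      push_cast
      exact this) (fun v hv => bF0 v hv.1) (fun v hv => bF0' v hv.1)
  have h1 := norm_mul_sub_flux (μ := μ) (ε := ε) (F := F) (F' := F') hΩ 1
  have h2 := norm_mul_sub_flux (μ := μ) (ε := ε) (F := F) (F' := F') hΩ V
  have h1' : ‖Complex.I * Ω * (1 : ℝ) - ε‖ *
      ‖Complex.I * Ω * (1 : ℝ) - ε - Complex.I * Ω‖ * ‖F' 1‖ * ‖F 1‖ ≤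
      ε * ((|Ω| + 1) * A₀ ^ 2) := by
    have e1 : ‖Complex.I * Ω * (1 : ℝ) - ε‖ ≤ |Ω| + 1 := by
      refine (line_norm_le Ω zero_le_one hε.le).trans ?_
      linarith
    have e2 : ‖Complex.I * Ω * (1 : ℝ) - ε - Complex.I * Ω‖ = ε := by
      have : Complex.I * Ω * (1 : ℝ) - ε - Complex.I * Ω = -(ε : ℂ) := by push_cast; ring
      rw [this, norm_neg, Complex.norm_real, Real.norm_of_nonneg hε.le]
    rw [e2]
    calc _ ≤ (|Ω| + 1) * ε * A₀ * A₀ := by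
          have := bF0 1 le_rfl
          have := bF0' 1 le_rfl
          gcongr
      _ = _ := by ring
  have h2' : ‖Complex.I * Ω * V - ε‖ * ‖Complex.I * Ω * V - ε - Complex.I * Ω‖ *
      ‖F' V‖ * ‖F V‖ ≤ B * ‖F V‖ := by
    refine mul_le_mul_of_nonneg_right ?_ (norm_nonneg _)
    have hpos : 0 < ‖Complex.I * Ω * V - ε‖ := lt_of_lt_of_le (by positivity) (hple ε hV)
    have := hB _ (hpre hε V)
    rw [le_div_iff₀ (by positivity)] at this
    calc _ ≤ ‖Complex.I * Ω * V - ε‖ * ‖Complex.I * Ω * V - ε‖ * ‖F' V‖ := by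
          gcongr; exact line_sub_norm_le Ω ε hV
      _ ≤ B := by rw [mul_comm, ← sq]; exact this
  set W₁ := flux Ω μ ε F F' 1
  set W := flux Ω μ ε F F' V
  have h3 : |Ω * W - Ω * W₁| ≤
      ε * (|Ω| * ((4 * |Ω| * V + 2 + 2 * |μ| + 2 * |α|) * A₀ ^ 2 * (V - 1))) := by
    rw [← mul_sub, abs_mul]
    refine (mul_le_mul_of_nonneg_left hflux (abs_nonneg _)).trans (le_of_eq (by ring))
  have g1 := (abs_le.1 h1).2
  have g2 := (abs_le.1 h2).1
  have g3 := (abs_le.1 h3).2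
  have hεK : ε * K * V ≤ 1 := by
    rw [hεdef, mul_assoc, one_div, inv_mul_le_iff₀ (by positivity)]
    linarith
  set y := V * ‖F V‖ with hy
  have hy0 : 0 ≤ y := by positivity
  have hyx : y ≤ x₀ := by
    have := mul_le_mul_of_nonneg_left (bF V hV) hV0.le
    refine this.trans (le_of_eq ?_)
    rw [hx₀]; field_simp
  -- Approximate conservation of the flux between `1` and `V`; the term `Ωμ‖F 1‖²` is discarded by
  -- the sign hypothesis `hμ`.
  have hWsum : Ω * (Ω / 2 * V * (V - 1) + μ * V) * ‖F V‖ ^ 2 ≤ B * ‖F V‖ + ε * K := by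
    have hμ1 : Ω * (Ω / 2 * 1 * (1 - 1) + μ * 1) * ‖F 1‖ ^ 2 ≤ 0 := by
      have : Ω * (Ω / 2 * 1 * (1 - 1) + μ * 1) = Ω * μ := by ring
      rw [this]
      exact mul_nonpos_of_nonpos_of_nonneg hμ (sq_nonneg _)
    have hKe : ε * K = ε * (|Ω| * ((4 * |Ω| * V + 2 + 2 * |μ| + 2 * |α|) * A₀ ^ 2 * (V - 1))) +
      ε * ((|Ω| + 1) * A₀ ^ 2) := by rw [hK]; ring
    linarith
  -- Multiplying by `V` and writing `y = V‖F V‖`, every term except `y² V` is bounded because `y ≤ A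
  -- / |Ω|`.
  have hVW : Ω ^ 2 / 2 * (y ^ 2 * V) ≤ Ω ^ 2 / 2 * y ^ 2 + |Ω * μ| * y ^ 2 + B * y + ε * K * V := by
    have h5 := mul_le_mul_of_nonneg_right hWsum hV0.le
    have h6 : Ω * (Ω / 2 * V * (V - 1) + μ * V) * ‖F V‖ ^ 2 * V =
        Ω ^ 2 / 2 * (y ^ 2 * V) - Ω ^ 2 / 2 * y ^ 2 + Ω * μ * y ^ 2 := by
      rw [hy]; ring
    have h7 : -(|Ω * μ|) * y ^ 2 ≤ Ω * μ * y ^ 2 :=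
      mul_le_mul_of_nonneg_right (neg_abs_le _) (sq_nonneg _)
    have h8 : (B * ‖F V‖ + ε * K) * V = B * y + ε * K * V := by rw [hy]; ring
    rw [h6, h8] at h5
    linarith
  have hΩ2 : 0 < Ω ^ 2 := by positivity
  have hfin : Ω ^ 2 / 2 * (y ^ 2 * V) ≤
      Ω ^ 2 / 2 * x₀ ^ 2 + |Ω * μ| * x₀ ^ 2 + B * x₀ + 1 := by
    have hyx2 : y ^ 2 ≤ x₀ ^ 2 := pow_le_pow_left₀ hy0 hyx 2
    have i1 := mul_le_mul_of_nonneg_left hyx2 (by positivity : 0 ≤ Ω ^ 2 / 2)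
    have i2 := mul_le_mul_of_nonneg_left hyx2 (abs_nonneg (Ω * μ))
    have i3 := mul_le_mul_of_nonneg_left hyx hB0
    linarith
  calc y ^ 2 * V = (2 / Ω ^ 2) * (Ω ^ 2 / 2 * (y ^ 2 * V)) := by field_simp
    _ ≤ _ := mul_le_mul_of_nonneg_left hfin (by positivity)

/-- A Heun solution that is outgoing at infinity and regular at `0` vanishes at `0` to leading
order. -/
theorem IsHeunSolution.leading_eq_zero (hf : IsHeunSolution Ω α γ Λ f f₁ f₂)
    (hΩ : Ω ≠ 0) (hμ : Ω * (α + γ) ≤ 0)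
    (hinf : Tendsto (fun z : ℝ => (1 + (z : ℂ)) * f z) atTop (𝓝 c))
    (hh : HasTaylorData h h₁ h₂ δ C) (hfh : ∀ z ∈ Ioo 0 δ, f z = osc α z * h z) : h 0 = 0 := by
  obtain ⟨hd, hd₁, hd₂, hg₂⟩ := hf.hasDecay hΩ hinf
  obtain ⟨B, hB⟩ := hf.exists_laplace_asymptotics hd hd₁ hd₂ hg₂ hh hfh
  have hare : (1 + 2 * Complex.I * (α : ℂ)).re = 1 := by simp
  obtain ⟨c₁, hc₁, hc₁'⟩ := exists_le_norm_laplace_gammaKernel hare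
  obtain ⟨c₂, hc₂, hc₂'⟩ := exists_norm_laplace_gammaKernel_le' hare
  have hΩ0 : 0 < |Ω| := abs_pos.2 hΩ
  have hB0 : 0 ≤ B := by
    have h := (norm_nonneg _).trans (hB (-1) (by simp)).1
    simpa using h
  have hA : ∀ p : ℂ, p.re < 0 → |Ω| ≤ ‖p‖ →
      ‖laplace f p‖ ≤ (‖h 0‖ * c₂ + B / |Ω|) / ‖p‖ := fun p hp hpΩ => by
    have hp0 : 0 < ‖p‖ := hΩ0.trans_le hpΩ
    have h1 := (hB p hp).1
    have h2 := norm_sub_norm_le (laplace f p)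
      (h 0 * laplace (gammaKernel (1 + 2 * Complex.I * α)) p)
    rw [norm_mul] at h2
    have h3 := mul_le_mul_of_nonneg_left (hc₂' p hp) (norm_nonneg (h 0))
    have h4 : B / ‖p‖ ^ 2 ≤ B / |Ω| / ‖p‖ := by
      rw [div_div, sq]
      exact div_le_div_of_nonneg_left hB0 (by positivity) (by gcongr)
    rw [add_div, mul_div_assoc]
    linarith
  obtain ⟨D, hD⟩ := hf.exists_sq_norm_laplace_le hΩ hμ hd hd₁ hh hfh hA (fun p hp => (hB p hp).2)
  -- By the lower bound for the model transform and `‖1 - p‖ ≤ (2 + |Ω|) V`, this constant is at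
  -- most `V‖F‖ + O(1/V)`, while the flux inequality makes `(V‖F‖)² V` bounded.
  have hz : ‖h 0‖ * (c₁ / (2 + |Ω|)) = 0 := by
    refine eq_zero_of_sq_mul_le (B := 2 * D + 2 * (B / Ω ^ 2) ^ 2) fun V hV => ?_
    have hV0 : 0 < V := by linarith
    obtain ⟨ε, hε, hεD⟩ := hD V hV
    set p : ℂ := Complex.I * Ω * V - ε with hpdef
    have hp : p.re < 0 := by rw [hpdef, line_re]; linarith [hε.1]
    have hpl : |Ω| * V ≤ ‖p‖ := by
      have := le_line_norm Ω V ε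
      rwa [abs_of_nonneg hV0.le] at this
    have hpu : ‖1 - p‖ ≤ (2 + |Ω|) * V := by
      have h1 := line_norm_le Ω hV0.le hε.1.le
      have h2 := norm_sub_le 1 p
      rw [norm_one] at h2
      have h3 := hε.2
      nlinarith
    have k1 : ‖h 0‖ * (c₁ / (2 + |Ω|)) ≤ V * (‖h 0‖ *
        ‖laplace (gammaKernel (1 + 2 * Complex.I * α)) p‖) := by
      have h1 := hc₁' p hp
      have h2 : c₁ / ((2 + |Ω|) * V) ≤ c₁ / ‖1 - p‖ := div_le_div_of_nonneg_left hc₁.le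
        (one_pos.trans_le (one_le_norm_one_sub hp)) hpu
      have h3 := mul_le_mul_of_nonneg_left (h2.trans h1) (by positivity : 0 ≤ V * ‖h 0‖)
      refine le_trans (le_of_eq ?_) (h3.trans (le_of_eq (by ring)))
      field_simp
    have k2 : V * (‖h 0‖ * ‖laplace (gammaKernel (1 + 2 * Complex.I * α)) p‖) ≤
        V * ‖laplace f p‖ + B / Ω ^ 2 / V := by
      have h1 := (hB p hp).1
      rw [← norm_mul]
      have h2 := norm_sub_norm_le (h 0 * laplace (gammaKernel (1 + 2 * Complex.I * α)) p)
        (laplace f p)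
      rw [norm_sub_rev] at h2
      have h3 : B / ‖p‖ ^ 2 ≤ B / (Ω ^ 2 * V ^ 2) := by
        refine div_le_div_of_nonneg_left hB0 (by positivity) ?_
        have := pow_le_pow_left₀ (by positivity) hpl 2
        rwa [mul_pow, sq_abs] at this
      have h4 : ‖h 0 * laplace (gammaKernel (1 + 2 * Complex.I * α)) p‖ ≤
          ‖laplace f p‖ + B / (Ω ^ 2 * V ^ 2) := by linarith
      refine (mul_le_mul_of_nonneg_left h4 hV0.le).trans (le_of_eq ?_)
      field_simp
    set y := V * ‖laplace f p‖
    have k3 := k1.trans k2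
    have hx0 : 0 ≤ ‖h 0‖ * (c₁ / (2 + |Ω|)) := by positivity
    have k4 := pow_le_pow_left₀ hx0 k3 2
    have k5 : (B / Ω ^ 2 / V) ^ 2 * V ≤ (B / Ω ^ 2) ^ 2 := by
      rw [div_pow, div_mul_eq_mul_div, div_le_iff₀ (by positivity)]
      have : V ≤ V ^ 2 := by nlinarith
      exact mul_le_mul_of_nonneg_left this (sq_nonneg _)
    calc _ ≤ (y + B / Ω ^ 2 / V) ^ 2 * V := mul_le_mul_of_nonneg_right k4 hV0.le
      _ ≤ (2 * y ^ 2 + 2 * (B / Ω ^ 2 / V) ^ 2) * V := by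
          refine mul_le_mul_of_nonneg_right ?_ hV0.le
          nlinarith [sq_nonneg (y - B / Ω ^ 2 / V)]
      _ = 2 * (y ^ 2 * V) + 2 * ((B / Ω ^ 2 / V) ^ 2 * V) := by ring
      _ ≤ _ := by linarith
  have hpos : 0 < c₁ / (2 + |Ω|) := by positivity
  exact norm_eq_zero.1 ((mul_eq_zero.1 hz).resolve_right hpos.ne')

end Leading

end FluxIdentity

/-! ### Uniqueness at the regular singular point -/

section Vanishing

open Filter Set Topology MeasureTheory

theorem norm_le_mul_of_tendsto_zero {g g' : ℝ → ℂ} {z B : ℝ} (hz : 0 < z)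
    (hg : ∀ t ∈ Ioc 0 z, HasDerivAt g (g' t) t) (hB : ∀ t ∈ Ioc 0 z, ‖g' t‖ ≤ B)
    (h0 : Tendsto g (𝓝[>] 0) (𝓝 0)) : ‖g z‖ ≤ B * z := by
  have hB0 : 0 ≤ B := (norm_nonneg _).trans (hB z ⟨hz, le_rfl⟩)
  have h1 : Tendsto (fun t => ‖g z - g t‖) (𝓝[>] 0) (𝓝 ‖g z - 0‖) := (h0.const_sub (g z)).norm
  rw [sub_zero] at h1
  refine le_of_tendsto h1 (eventually_of_mem (Ioo_mem_nhdsGT hz) fun t ht => ?_)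
  have := (convex_Icc t z).norm_image_sub_le_of_norm_hasDerivWithin_le
    (fun s hs => (hg s ⟨ht.1.trans_le hs.1, hs.2⟩).hasDerivWithinAt)
    (fun s hs => hB s ⟨ht.1.trans_le hs.1, hs.2⟩) (left_mem_Icc.2 ht.2.le)
    (right_mem_Icc.2 ht.2.le)
  refine this.trans (mul_le_mul_of_nonneg_left ?_ hB0)
  rw [Real.norm_of_nonneg (by linarith [ht.2])]
  linarith [ht.1]

section Uniqueness

variable {Ω α γ Λ : ℝ} {f f₁ f₂ h h₁ h₂ : ℝ → ℂ} {δ C : ℝ} {c : ℂ}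

/-- A Heun solution vanishing on an interval vanishes to the right of it. -/
theorem IsHeunSolution.eq_zero_of_initial (hf : IsHeunSolution Ω α γ Λ f f₁ f₂) {a : ℝ}
    (ha : 0 < a) (h0 : f a = 0) (h1 : f₁ a = 0) : ∀ z ≥ a, f z = 0 := by
  intro b hb
  have hpos : ∀ z ∈ Icc a b, 0 < z := fun z hz => ha.trans_le hz.1
  have hne : ∀ z ∈ Icc a b, (z : ℂ) * (1 + z) ≠ 0 := fun z hz =>
    mul_ne_zero (by exact_mod_cast (hpos z hz).ne') (one_add_ofReal_ne_zero (hpos z hz))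
  obtain ⟨K₁, hK₁⟩ := (isCompact_Icc (a := a) (b := b)).exists_bound_of_continuousOn
    (f := fun z : ℝ => (1 + 2 * (z : ℂ) +
      2 * Complex.I * (Ω / 2 * z * (1 + z) - α * (1 + z) - γ * z)) / ((z : ℂ) * (1 + z)))
    (ContinuousOn.div (by fun_prop) (by fun_prop) hne)
  obtain ⟨K₀, hK₀⟩ := (isCompact_Icc (a := a) (b := b)).exists_bound_of_continuousOn
    (f := fun z : ℝ => (Complex.I * (Ω * ((z : ℂ) + 1 / 2) - (α + γ)) - Λ) / ((z : ℂ) * (1 + z)))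
    (ContinuousOn.div (by fun_prop) (by fun_prop) hne)
  have key := norm_le_gronwallBound_of_norm_deriv_right_le (f := fun z => (f z, f₁ z))
    (f' := fun z => (f₁ z, f₂ z)) (δ := 0) (K := max 1 (K₁ + K₀)) (ε := 0) (a := a) (b := b)
    (fun z hz => ((hf.hasDerivAt z (hpos z hz)).prodMk
      (hf.hasDerivAt₁ z (hpos z hz))).continuousAt.continuousWithinAt)
    (fun z hz => ((hf.hasDerivAt z (hpos z (Ico_subset_Icc_self hz))).prodMk
      (hf.hasDerivAt₁ z (hpos z (Ico_subset_Icc_self hz)))).hasDerivWithinAt)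
    (by simp [h0, h1]) (fun z hz => ?_) b (right_mem_Icc.2 hb)
  · rw [gronwallBound_ε0_δ0] at key
    have : (f b, f₁ b) = 0 := norm_le_zero_iff.1 key
    exact congrArg Prod.fst this
  · have hz' := Ico_subset_Icc_self hz
    have n0 : ‖f z‖ ≤ ‖(f z, f₁ z)‖ := norm_fst_le (f z, f₁ z)
    have n1 : ‖f₁ z‖ ≤ ‖(f z, f₁ z)‖ := norm_snd_le (f z, f₁ z)
    have hN := norm_nonneg (f z, f₁ z)
    rw [add_zero]
    refine max_le ?_ ?_
    · exact n1.trans (le_mul_of_one_le_left hN (le_max_left _ _))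
    · have e : f₂ z = -(((1 + 2 * (z : ℂ) +
          2 * Complex.I * (Ω / 2 * z * (1 + z) - α * (1 + z) - γ * z)) / ((z : ℂ) * (1 + z))) * f₁ z
          + ((Complex.I * (Ω * ((z : ℂ) + 1 / 2) - (α + γ)) - Λ) / ((z : ℂ) * (1 + z))) * f z) := by
        have h1 := hne z hz'
        have h2 := hf.ode z (hpos z hz')
        have gen : ∀ D u v w x y : ℂ, D ≠ 0 → D * w + u * x + v * y = 0 →
            w = -(u / D * x + v / D * y) := fun D u v w x y hD h => by
          field_simp
          linear_combination h
        exact gen _ _ _ _ _ _ h1 h2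
      have k1 := hK₁ z hz'
      have k0 := hK₀ z hz'
      have hK₁0 := (norm_nonneg _).trans k1
      have hK₀0 := (norm_nonneg _).trans k0
      calc ‖f₂ z‖ ≤ K₁ * ‖(f z, f₁ z)‖ + K₀ * ‖(f z, f₁ z)‖ := by
            rw [e, norm_neg]
            refine (norm_add_le _ _).trans (add_le_add ?_ ?_)
            · rw [norm_mul]; exact mul_le_mul k1 n1 (norm_nonneg _) hK₁0
            · rw [norm_mul]; exact mul_le_mul k0 n0 (norm_nonneg _) hK₀0
        _ = (K₁ + K₀) * ‖(f z, f₁ z)‖ := by ring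
        _ ≤ _ := mul_le_mul_of_nonneg_right (le_max_right _ _) hN

/-- A Heun solution `f = z^{2iα} h` with `h` smooth and `h 0 = 0` vanishes. -/
theorem IsHeunSolution.eq_zero_of_leading (hf : IsHeunSolution Ω α γ Λ f f₁ f₂)
    (hh : HasTaylorData h h₁ h₂ δ C) (hfh : ∀ z ∈ Ioo 0 δ, f z = osc α z * h z)
    (h00 : h 0 = 0) : ∀ z > 0, f z = 0 := by
  have hδ := hh.pos
  have hC := hh.nonneg
  have hhz : ∀ z ∈ Ioo 0 δ, ‖h z‖ ≤ C * z := fun z hz => hh.norm_le h00 hz fun t ht =>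
    hh.bound₁ t ⟨by linarith [ht.1], ht.2.trans_lt hz.2⟩
  have hf0 : Tendsto f (𝓝[>] 0) (𝓝 0) := tendsto_zero_of_norm_le_mul hδ (C := C) fun z hz => by
    rw [hfh z hz, norm_mul, norm_osc, one_mul]; exact hhz z hz
  set N := C + ‖2 * Complex.I * (α : ℂ)‖ * C with hN
  have hN0 : 0 ≤ N := by positivity
  have hf₁b : ∀ z ∈ Ioo 0 δ, ‖f₁ z‖ ≤ N := fun z hz => by
    rw [deriv_of_eq_osc_mul hf.hasDerivAt hh hfh z hz, norm_mul, norm_osc, one_mul]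
    refine (norm_add_le _ _).trans (add_le_add (hh.bound₁ z ⟨by linarith [hz.1], hz.2⟩) ?_)
    rw [norm_div, norm_mul, Complex.norm_real, Real.norm_of_nonneg hz.1.le, div_le_iff₀ hz.1]
    exact (mul_le_mul_of_nonneg_left (hhz z hz) (norm_nonneg _)).trans (le_of_eq (by ring))
  obtain ⟨K, hK⟩ := (isCompact_Icc (a := (0 : ℝ)) (b := δ)).exists_bound_of_continuousOn
    (f := fun z : ℝ => Complex.I * (Ω * ((z : ℂ) + 1 / 2) - (α + γ)) - (Λ : ℂ)) (by fun_prop)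
  have hK0 : 0 ≤ K := le_trans (norm_nonneg _) (hK 0 ⟨le_rfl, hδ.le⟩)
  -- Small enough that `K η ≤ 1/2`, which makes the integrated equation a contraction for the
  -- supremum of `|f'|` on `(0, η]`.
  set η := min (δ / 2) (1 / (2 * (K + 1))) with hη
  have hη0 : 0 < η := by positivity
  have hηδ : η < δ := (min_le_left _ _).trans_lt (by linarith)
  have hKη : K * η ≤ 1 / 2 := by
    have h1 : K * η ≤ K * (1 / (2 * (K + 1))) := mul_le_mul_of_nonneg_left (min_le_right _ _) hK0
    refine h1.trans ?_
    rw [mul_one_div, div_le_div_iff₀ (by positivity) (by positivity)]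
    linarith
  -- the integrating factor of the equation, of modulus `z (1 + z)`
  set w : ℝ → ℂ := fun z => heunWeight Ω α γ z * (1 + (z : ℂ)) ^ 2 with hw
  have hwn : ∀ z > 0, ‖w z‖ = z * (1 + z) := fun z hz => by
    have : (1 + (z : ℂ)) = ((1 + z : ℝ) : ℂ) := by push_cast; ring
    rw [hw, norm_mul, norm_heunWeight hz, norm_pow, this, Complex.norm_real,
      Real.norm_of_nonneg (by linarith)]
    have : 1 + z ≠ 0 := by linarith
    field_simp
  have dw : ∀ z > 0, HasDerivAt (fun z => w z * f₁ z)
      (-(w z / (z * (1 + z))) * ((Complex.I * (Ω * ((z : ℂ) + 1 / 2) - (α + γ)) - Λ) * f z)) z :=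
    fun z hz => by
      have d0 : HasDerivAt (fun z : ℝ => (z : ℂ)) 1 z := by
        simpa using (hasDerivAt_id z).ofReal_comp
      have z0 : (z : ℂ) ≠ 0 := by exact_mod_cast hz.ne'
      have z1 := one_add_ofReal_ne_zero hz
      have h2 := hf.ode z hz
      refine (((hasDerivAt_heunWeight (Ω := Ω) (α := α) (γ := γ) hz).mul
        ((d0.const_add 1).pow 2)).mul (hf.hasDerivAt₁ z hz)).congr_deriv ?_
      simp only [hw, heunCoeff, Pi.mul_apply, Pi.pow_apply]
      field_simp
      field_simp at h2
      linear_combination heunWeight Ω α γ z * (1 + (z : ℂ)) * h2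
  -- If `|f'| ≤ B` then `|f| ≤ B z`, because `f → 0`. Integrating `(w f')'` from `0` gives
  -- `z(1+z)|f'| ≤ K B z²`, so the bound on `f'` is halved. Since `h 0 = 0` removes the `1/z` term
  -- of `f'`, an initial bound `N` exists and iteration forces `f' = 0`.
  have step : ∀ B ≥ 0, (∀ z ∈ Ioc 0 η, ‖f₁ z‖ ≤ B) → ∀ z ∈ Ioc 0 η, ‖f₁ z‖ ≤ B / 2 := by
    intro B hB hfB z hz
    have hfz : ∀ t ∈ Ioc 0 z, ‖f t‖ ≤ B * z := fun t ht =>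
      (norm_le_mul_of_tendsto_zero ht.1 (fun s hs => hf.hasDerivAt s hs.1)
        (fun s hs => hfB s ⟨hs.1, hs.2.trans (ht.2.trans hz.2)⟩) hf0).trans
        (mul_le_mul_of_nonneg_left ht.2 hB)
    have hw0 : Tendsto (fun z => w z * f₁ z) (𝓝[>] 0) (𝓝 0) :=
      tendsto_zero_of_norm_le_mul hδ (C := (1 + δ) * N) fun t ht => by
        rw [norm_mul, hwn t ht.1]
        have := hf₁b t ht
        calc t * (1 + t) * ‖f₁ t‖ ≤ t * (1 + δ) * N := by
              have h1 := ht.1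
              have h2 := ht.2.le
              gcongr
          _ = _ := by ring
    have h1 := norm_le_mul_of_tendsto_zero hz.1 (B := K * (B * z)) (fun t ht => dw t ht.1)
      (fun t ht => by
        have hn : ‖-(w t / ((t : ℂ) * (1 + t)))‖ = 1 := by
          have e : (t : ℂ) * (1 + t) = ((t * (1 + t) : ℝ) : ℂ) := by push_cast; ring
          have : 0 < t * (1 + t) := by have := ht.1; positivity
          rw [norm_neg, norm_div, hwn t ht.1, e, Complex.norm_real, Real.norm_of_nonneg this.le,
            div_self this.ne']
        rw [norm_mul, hn, one_mul, norm_mul]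
        exact mul_le_mul (hK t ⟨ht.1.le, ht.2.trans (hz.2.trans hηδ.le)⟩) (hfz t ht)
          (norm_nonneg _) hK0) hw0
    rw [norm_mul, hwn z hz.1] at h1
    have hz0 := hz.1
    have h2 : z * ‖f₁ z‖ ≤ z * (1 + z) * ‖f₁ z‖ := by
      refine mul_le_mul_of_nonneg_right ?_ (norm_nonneg _)
      nlinarith
    have h3 : z * ‖f₁ z‖ ≤ z * (K * z * B) := by nlinarith
    have h4 := le_of_mul_le_mul_left h3 hz0
    have h5 : K * z ≤ 1 / 2 := (mul_le_mul_of_nonneg_left hz.2 hK0).trans hKη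
    nlinarith
  have iter : ∀ n : ℕ, ∀ z ∈ Ioc 0 η, ‖f₁ z‖ ≤ N / 2 ^ n := by
    intro n
    induction n with
    | zero => exact fun z hz => by simpa using hf₁b z ⟨hz.1, hz.2.trans_lt hηδ⟩
    | succ n ih =>
      intro z hz
      have := step _ (by positivity) ih z hz
      rwa [div_div, ← pow_succ] at this
  have hz₁ : ∀ z ∈ Ioc 0 η, f₁ z = 0 := fun z hz => by
    have ht : Tendsto (fun n : ℕ => N / 2 ^ n) atTop (𝓝 0) :=
      (tendsto_const_nhds (x := N)).div_atTop
        (tendsto_pow_atTop_atTop_of_one_lt (one_lt_two : (1 : ℝ) < 2))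
    exact norm_le_zero_iff.1 (ge_of_tendsto' ht fun n => iter n z hz)
  have hz₀ : ∀ z ∈ Ioc 0 η, f z = 0 := fun z hz => by
    have := norm_le_mul_of_tendsto_zero hz.1 (B := 0) (fun s hs => hf.hasDerivAt s hs.1)
      (fun s hs => by rw [hz₁ s ⟨hs.1, hs.2.trans hz.2⟩, norm_zero]) hf0
    rw [zero_mul] at this
    exact norm_le_zero_iff.1 this
  intro z hz
  rcases le_total z η with h | h
  · exact hz₀ z ⟨hz, h⟩
  · exact hf.eq_zero_of_initial hη0 (hz₀ η ⟨hη0, le_rfl⟩) (hz₁ η ⟨hη0, le_rfl⟩) z h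

/-- A Heun solution that is regular at `0` and outgoing at infinity vanishes. -/
theorem IsHeunSolution.eq_zero (hf : IsHeunSolution Ω α γ Λ f f₁ f₂) (hΩ : Ω ≠ 0)
    (hμ : Ω * (α + γ) ≤ 0)
    (hinf : Tendsto (fun z : ℝ => (1 + (z : ℂ)) * f z) atTop (𝓝 c))
    (hh : ContDiffAt ℝ 2 h 0) (hfh : ∀ᶠ z in 𝓝[>] 0, f z = osc α z * h z) :
    ∀ z > 0, f z = 0 := by
  obtain ⟨δ, C, hT, hfh⟩ := exists_hasTaylorData hh hfh
  exact hf.eq_zero_of_leading hT hfh (hf.leading_eq_zero hΩ hμ hinf hT hfh)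

end Uniqueness

end Vanishing

namespace KerrNewman

open scoped Manifold Topology
open Filter Set

/-! ### Reality of the angular eigenvalue -/

section Angular

/-- For `θ` ranging over all of `ℝ` this is a full great circle through both poles, so a smooth
function on the sphere restricts to a function smooth across `θ = 0` and `θ = π`. -/
theorem contMDiff_spherePoint (φ : ℝ) :
    ContMDiff 𝓘(ℝ, ℝ) (𝓡 2) ((⊤ : ℕ∞) : WithTop ℕ∞) fun θ : ℝ => spherePoint θ φ := by
  have h : ContMDiff 𝓘(ℝ, ℝ) 𝓘(ℝ, EuclideanSpace ℝ (Fin 3)) ((⊤ : ℕ∞) : WithTop ℕ∞)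
      fun θ : ℝ => (spherePoint θ φ : EuclideanSpace ℝ (Fin 3)) := by
    rw [contMDiff_iff_contDiff, contDiff_euclidean]
    intro i
    fin_cases i
    · exact Real.contDiff_sin.mul contDiff_const
    · exact Real.contDiff_sin.mul contDiff_const
    · exact Real.contDiff_cos
  have : Fact (Module.finrank ℝ (EuclideanSpace ℝ (Fin 3)) = 2 + 1) := ⟨by simp⟩
  exact h.codRestrict_sphere (n := 2) fun θ => (spherePoint θ φ).2

/-- The eigenvalues of the angular problem at real frequency are real. -/
theorem IsAngularEigenfunction.im_eq_zero {a ω : ℝ} {m : ℤ} {lam : ℂ} {S : ℝ → ℂ}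
    (hS : IsAngularEigenfunction a ω m lam S) : lam.im = 0 := by
  by_contra hlam
  obtain ⟨Y, hY, hYS⟩ := hS.smooth_extension
  set T : ℝ → ℂ := fun θ => Y (spherePoint θ 0) with hT
  have hTc : ContDiff ℝ ((⊤ : ℕ∞) : WithTop ℕ∞) T :=
    contMDiff_iff_contDiff.1 (hY.comp (contMDiff_spherePoint 0))
  have hTS : ∀ θ ∈ Ioo 0 Real.pi, T θ = S θ := fun θ hθ => by
    simp only [hT, hYS θ hθ 0]; simp
  have hd : ∀ θ ∈ Ioo 0 Real.pi, deriv T θ = deriv S θ := fun θ hθ =>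
    Filter.EventuallyEq.deriv_eq (eventually_of_mem (Ioo_mem_nhds hθ.1 hθ.2) hTS)
  have hT' : Continuous (deriv T) := hTc.continuous_deriv (by simp)
  have hS1 : ContDiffOn ℝ 1 (deriv S) (Ioo 0 Real.pi) :=
    ((contDiffOn_succ_iff_deriv_of_isOpen (n := 1) isOpen_Ioo).1 hS.contDiffOn).2.2
  -- The angular flux, normalized so that its derivative is `sin θ |S|²`. It is written with the
  -- smooth extension `T`, whose derivative is finite at the poles, so that `sin θ` annihilates it
  -- there; a monotone function vanishing at both ends is zero.
  set u : ℝ → ℝ := fun θ =>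
    -(lam.im)⁻¹ * (((Real.sin θ : ℂ) * deriv T θ) * (starRingEnd ℂ) (T θ)).im with hu
  have hsin : ∀ θ ∈ Ioo 0 Real.pi, (Real.sin θ : ℂ) ≠ 0 := fun θ hθ => by
    exact_mod_cast (Real.sin_pos_of_mem_Ioo hθ).ne'
  have hder : ∀ θ ∈ Ioo 0 Real.pi, HasDerivAt u (Real.sin θ * Complex.normSq (S θ)) θ := by
    intro θ hθ
    have hmem := Ioo_mem_nhds hθ.1 hθ.2
    have dS : HasDerivAt S (deriv S θ) θ :=
      ((hS.contDiffOn.differentiableOn (by norm_num)).differentiableAt hmem).hasDerivAt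
    have dS' : DifferentiableAt ℝ (deriv S) θ :=
      (hS1.differentiableOn (by norm_num)).differentiableAt hmem
    have dsin : HasDerivAt (fun s : ℝ => (Real.sin s : ℂ)) (Real.cos θ) θ :=
      (Real.hasDerivAt_sin θ).ofReal_comp
    have dP : HasDerivAt (fun s : ℝ => (Real.sin s : ℂ) * deriv S s)
        (deriv (fun s : ℝ => (Real.sin s : ℂ) * deriv S s) θ) θ :=
      (dsin.differentiableAt.mul dS').hasDerivAt
    have hode := hS.ode θ hθ
    set P := deriv (fun s : ℝ => (Real.sin s : ℂ) * deriv S s) θ with hP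
    have hs := hsin θ hθ
    have hPe : P = (((Real.sin θ * (m ^ 2 / Real.sin θ ^ 2 - a ^ 2 * ω ^ 2 * Real.cos θ ^ 2) : ℝ)
        : ℂ) - Real.sin θ * lam) * S θ := by
      have h2 : P = Real.sin θ * (1 / Real.sin θ * P) := by field_simp
      rw [h2]
      push_cast at hode ⊢
      linear_combination (Complex.sin θ) * hode
    have dW := Complex.imCLM.hasFDerivAt.comp_hasDerivAt θ (dP.mul dS.star)
    have dW' := dW.const_mul (-(lam.im)⁻¹)
    refine (dW'.congr_of_eventuallyEq (eventually_of_mem hmem fun s hs => ?_)).congr_deriv ?_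
    · simp only [hu, Function.comp, Complex.imCLM_apply, Pi.mul_apply]
      rw [hTS s hs, hd s hs]
      rfl
    · rw [hPe]
      set x : ℝ := Real.sin θ * (m ^ 2 / Real.sin θ ^ 2 - a ^ 2 * ω ^ 2 * Real.cos θ ^ 2)
      simp only [Complex.imCLM_apply]
      have e : (((x : ℂ) - Real.sin θ * lam) * S θ * star (S θ) +
          Real.sin θ * deriv S θ * star (deriv S θ)).im =
          -(Real.sin θ * lam.im * Complex.normSq (S θ)) := by
        have e1 : ((x : ℂ) - Real.sin θ * lam) * S θ * star (S θ) =
            (x - Real.sin θ * lam) * (Complex.normSq (S θ) : ℂ) := by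
          rw [mul_assoc]; congr 1; exact Complex.mul_conj _
        have e2 : (Real.sin θ : ℂ) * deriv S θ * star (deriv S θ) =
            ((Real.sin θ * Complex.normSq (deriv S θ) : ℝ) : ℂ) := by
          rw [mul_assoc, Complex.ofReal_mul]; congr 1; exact Complex.mul_conj _
        rw [e1, e2, Complex.add_im, Complex.ofReal_im, add_zero, Complex.im_mul_ofReal,
          Complex.sub_im, Complex.ofReal_im, Complex.im_ofReal_mul]
        ring
      rw [e]
      field_simp
  have hcont : Continuous u := by
    have : Continuous T := hTc.continuous
    simp only [hu]
    fun_prop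
  have hmono : MonotoneOn u (Icc 0 Real.pi) := by
    refine monotoneOn_of_deriv_nonneg (convex_Icc _ _) hcont.continuousOn ?_ ?_
    · rw [interior_Icc]
      exact fun θ hθ => (hder θ hθ).differentiableAt.differentiableWithinAt
    · rw [interior_Icc]
      intro θ hθ
      rw [(hder θ hθ).deriv]
      exact mul_nonneg (Real.sin_pos_of_mem_Ioo hθ).le (Complex.normSq_nonneg _)
  have hu0 : u 0 = 0 := by simp [hu]
  have hupi : u Real.pi = 0 := by simp [hu]
  have hzero : ∀ θ ∈ Icc 0 Real.pi, u θ = 0 := fun θ hθ => by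
    have hpi := Real.pi_pos.le
    have h1 := hmono (left_mem_Icc.2 hpi) hθ hθ.1
    have h2 := hmono hθ (right_mem_Icc.2 hpi) hθ.2
    linarith
  obtain ⟨θ, hθ, hne⟩ := hS.nonzero
  have h1 : HasDerivAt u 0 θ := (hasDerivAt_const θ (0 : ℝ)).congr_of_eventuallyEq
    (eventually_of_mem (Ioo_mem_nhds hθ.1 hθ.2) fun s hs => hzero s (Ioo_subset_Icc_self hs))
  have h2 := (hder θ hθ).unique h1
  rcases mul_eq_zero.1 h2 with h | h
  · exact (Real.sin_pos_of_mem_Ioo hθ).ne' h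
  · exact hne (Complex.normSq_eq_zero.1 h)

end Angular

/-! ### Polar coordinates on the sphere and the axis -/

section Sphere

theorem exists_spherePoint_eq (y : S2) : ∃ θ ∈ Icc 0 Real.pi, ∃ φ : ℝ, spherePoint θ φ = y := by
  obtain ⟨y, hy⟩ := y
  have hn : y 0 ^ 2 + y 1 ^ 2 + y 2 ^ 2 = 1 := by
    rw [mem_sphere_zero_iff_norm, EuclideanSpace.norm_eq, Real.sqrt_eq_one] at hy
    simpa [Fin.sum_univ_three] using hy
  have h2 : -1 ≤ y 2 ∧ y 2 ≤ 1 := by constructor <;> nlinarith [sq_nonneg (y 0), sq_nonneg (y 1)]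
  set w : ℂ := ⟨y 0, y 1⟩ with hw
  have hnorm : ‖w‖ = Real.sin (Real.arccos (y 2)) := by
    rw [Real.sin_arccos, Complex.norm_def, Complex.normSq_apply]
    congr 1
    simp only [hw]
    nlinarith
  refine ⟨Real.arccos (y 2), ⟨Real.arccos_nonneg _, Real.arccos_le_pi _⟩, w.arg, ?_⟩
  apply Subtype.ext
  ext i
  fin_cases i
  · change Real.sin (Real.arccos (y 2)) * Real.cos w.arg = y 0
    rw [← hnorm, Complex.norm_mul_cos_arg]
  · change Real.sin (Real.arccos (y 2)) * Real.sin w.arg = y 1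
    rw [← hnorm, Complex.norm_mul_sin_arg]
  · exact Real.cos_arccos h2.1 h2.2

/-- A smooth function on the exterior that vanishes off the axis vanishes. -/
theorem eq_zero_of_eq_zero_off_axis {M a Q : ℝ} {ψ : ℝ × ℝ × S2 → ℂ}
    (hψ : ContinuousOn ψ (exterior M a Q))
    (h : ∀ t : ℝ, ∀ r > rPlus M a Q, ∀ θ ∈ Ioo 0 Real.pi, ∀ φ : ℝ,
      ψ (t, r, spherePoint θ φ) = 0) : ∀ p ∈ exterior M a Q, ψ p = 0 := by
  rintro ⟨t, r, y⟩ hp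
  obtain ⟨θ, hθ, φ, rfl⟩ := exists_spherePoint_eq y
  have hc : Continuous fun s : ℝ => ψ (t, r, spherePoint s φ) :=
    hψ.comp_continuous (by have := (contMDiff_spherePoint φ).continuous; fun_prop)
      fun s => hp
  have hclosed : IsClosed {s : ℝ | ψ (t, r, spherePoint s φ) = 0} :=
    isClosed_eq hc continuous_const
  have hsub : closure (Ioo 0 Real.pi) ⊆ {s : ℝ | ψ (t, r, spherePoint s φ) = 0} :=
    hclosed.closure_subset_iff.2 fun s hs => h t r hp s hs φ
  rw [closure_Ioo Real.pi_pos.ne] at hsub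
  exact hsub hθ

end Sphere

/-! ### From the radial equation to the confluent Heun equation -/

section Radial

variable {M a Q : ℝ}

theorem rPlus_sub_rMinus_pos (hsub : a ^ 2 + Q ^ 2 < M ^ 2) : 0 < rPlus M a Q - rMinus M a Q := by
  have : 0 < Real.sqrt (M ^ 2 - a ^ 2 - Q ^ 2) := Real.sqrt_pos.2 (by linarith)
  unfold rPlus rMinus
  linarith

theorem rPlus_add_rMinus : rPlus M a Q + rMinus M a Q = 2 * M := by
  unfold rPlus rMinus; ring

theorem rPlus_mul_rMinus (hsub : a ^ 2 + Q ^ 2 < M ^ 2) :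
    rPlus M a Q * rMinus M a Q = a ^ 2 + Q ^ 2 := by
  have hs2 : Real.sqrt (M ^ 2 - a ^ 2 - Q ^ 2) ^ 2 = M ^ 2 - a ^ 2 - Q ^ 2 :=
    Real.sq_sqrt (by linarith)
  unfold rPlus rMinus
  linear_combination -hs2

/-- The phase relating the radial function to a solution of the confluent Heun equation. -/
noncomputable def heunPhase (Ω α γ z : ℝ) : ℝ :=
  α * Real.log z + γ * Real.log (1 + z) - Ω / 2 * z

/-- The derivative of `heunPhase`. -/
noncomputable def heunPhaseDeriv (Ω α γ z : ℝ) : ℝ := α / z + γ / (1 + z) - Ω / 2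

theorem hasDerivAt_heunPhase {Ω α γ z : ℝ} (hz : 0 < z) :
    HasDerivAt (heunPhase Ω α γ) (heunPhaseDeriv Ω α γ z) z := by
  have h1 := (Real.hasDerivAt_log hz.ne').const_mul α
  have h2 := (((hasDerivAt_id z).const_add 1).log (by simp; linarith)).const_mul γ
  refine ((h1.add h2).sub ((hasDerivAt_id z).const_mul (Ω / 2))).congr_deriv ?_
  simp only [heunPhaseDeriv, id]
  ring

theorem hasDerivAt_heunPhaseDeriv {Ω α γ z : ℝ} (hz : 0 < z) :
    HasDerivAt (heunPhaseDeriv Ω α γ) (-α / z ^ 2 - γ / (1 + z) ^ 2) z := by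
  have hz1 : 1 + z ≠ 0 := by linarith
  have h1 := (hasDerivAt_const z α).div (hasDerivAt_id z) hz.ne'
  have h2 := (hasDerivAt_const z γ).div ((hasDerivAt_id z).const_add 1) hz1
  refine ((h1.add h2).sub_const (Ω / 2)).congr_deriv ?_
  simp only [id]
  ring

/-- The parameter `α = (am - (r₊² + a²)ω)/(r₊ - r₋)` of the Heun equation. -/
noncomputable def heunAlpha (M a Q ω : ℝ) (m : ℤ) : ℝ :=
  (a * m - (rPlus M a Q ^ 2 + a ^ 2) * ω) / (rPlus M a Q - rMinus M a Q)

/-- The parameter `γ = ((r₋² + a²)ω - am)/(r₊ - r₋)` of the Heun equation. -/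
noncomputable def heunGamma (M a Q ω : ℝ) (m : ℤ) : ℝ :=
  ((rMinus M a Q ^ 2 + a ^ 2) * ω - a * m) / (rPlus M a Q - rMinus M a Q)

/-- The parameter `Ω = 2ω(r₊ - r₋)` of the Heun equation. -/
noncomputable def heunOmega (M a Q ω : ℝ) : ℝ := 2 * ω * (rPlus M a Q - rMinus M a Q)

/-- The solution of the Heun equation obtained from a radial function. -/
noncomputable def heunOfRadial (M a Q ω : ℝ) (m : ℤ) (R : ℝ → ℂ) (z : ℝ) : ℂ :=
  Complex.exp (Complex.I *
    heunPhase (heunOmega M a Q ω) (heunAlpha M a Q ω m) (heunGamma M a Q ω m) z) *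
    R (rPlus M a Q + (rPlus M a Q - rMinus M a Q) * z)

/-- The radial function of a mode gives a solution of the confluent Heun equation. -/
theorem IsRadialSolution.exists_isHeunSolution (hsub : a ^ 2 + Q ^ 2 < M ^ 2) {ω L : ℝ} {m : ℤ}
    {R : ℝ → ℂ} (hR : IsRadialSolution M a Q ω m L R) :
    ∃ f₁ f₂, IsHeunSolution (heunOmega M a Q ω) (heunAlpha M a Q ω m) (heunGamma M a Q ω m)
      (L + a ^ 2 * ω ^ 2 - 2 * a * m * ω) (heunOfRadial M a Q ω m R) f₁ f₂ := by
  have hs := rPlus_sub_rMinus_pos hsub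
  have hadd := rPlus_add_rMinus (M := M) (a := a) (Q := Q)
  have hmul := rPlus_mul_rMinus hsub
  set s := rPlus M a Q - rMinus M a Q with hsdef
  set Ω := heunOmega M a Q ω with hΩ
  set α := heunAlpha M a Q ω m with hα
  set γ := heunGamma M a Q ω m with hγ
  set θ₁ := heunPhaseDeriv Ω α γ with hθ₁
  set θ₂ : ℝ → ℝ := fun z => -α / z ^ 2 - γ / (1 + z) ^ 2 with hθ₂
  set e : ℝ → ℂ := fun z => Complex.exp (Complex.I * heunPhase Ω α γ z) with he
  set ρ : ℝ → ℝ := fun z => rPlus M a Q + s * z with hρ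
  have hρpos : ∀ z > 0, rPlus M a Q < ρ z := fun z hz => by
    have : 0 < s * z := mul_pos hs hz
    simp only [hρ]; linarith
  have hR1 : ContDiffOn ℝ 1 (deriv R) (Ioi (rPlus M a Q)) :=
    ((contDiffOn_succ_iff_deriv_of_isOpen (n := 1) isOpen_Ioi).1 hR.contDiffOn).2.2
  have dR : ∀ r > rPlus M a Q, HasDerivAt R (deriv R r) r := fun r hr =>
    ((hR.contDiffOn.differentiableOn (by norm_num)).differentiableAt
      (Ioi_mem_nhds hr)).hasDerivAt
  have dR1 : ∀ r > rPlus M a Q, HasDerivAt (deriv R) (deriv (deriv R) r) r := fun r hr =>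
    ((hR1.differentiableOn (by norm_num)).differentiableAt (Ioi_mem_nhds hr)).hasDerivAt
  have dρ : ∀ z, HasDerivAt ρ s z := fun z =>
    (((hasDerivAt_id z).const_mul s).const_add (rPlus M a Q)).congr_deriv (mul_one s)
  have de : ∀ z > 0, HasDerivAt e (Complex.I * θ₁ z * e z) z := fun z hz =>
    (((hasDerivAt_heunPhase hz).ofReal_comp.const_mul Complex.I).cexp).congr_deriv (by
      simp only [he, hθ₁]; ring)
  have dRρ : ∀ z > 0, HasDerivAt (fun z => R (ρ z)) (s * deriv R (ρ z)) z := fun z hz =>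
    ((dR _ (hρpos z hz)).scomp z (dρ z)).congr_deriv (Complex.real_smul)
  have dR1ρ : ∀ z > 0, HasDerivAt (fun z => deriv R (ρ z)) (s * deriv (deriv R) (ρ z)) z :=
    fun z hz => ((dR1 _ (hρpos z hz)).scomp z (dρ z)).congr_deriv (Complex.real_smul)
  refine ⟨fun z => e z * (Complex.I * θ₁ z * R (ρ z) + s * deriv R (ρ z)),
    fun z => e z * ((Complex.I * θ₂ z + (Complex.I * θ₁ z) ^ 2) * R (ρ z) +
      2 * Complex.I * θ₁ z * s * deriv R (ρ z) + s ^ 2 * deriv (deriv R) (ρ z)),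
    fun z hz => ?_, fun z hz => ?_, fun z hz => ?_⟩
  · exact ((de z hz).mul (dRρ z hz)).congr_deriv (by ring)
  · have dθ := (hasDerivAt_heunPhaseDeriv (Ω := Ω) (α := α) (γ := γ) hz).ofReal_comp.const_mul
      Complex.I
    refine ((de z hz).mul ((dθ.mul (dRρ z hz)).add
      ((dR1ρ z hz).const_mul (s : ℂ)))).congr_deriv ?_
    simp only [Pi.mul_apply, Pi.add_apply, hθ₂, hθ₁]
    ring
  · have hz1 : 1 + z ≠ 0 := by linarith
    have hDel : ∀ r, Delta M a Q r = (r - rPlus M a Q) * (r - rMinus M a Q) := fun r => by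
      unfold Delta; linear_combination r * hadd - hmul
    have hD : Delta M a Q (ρ z) = s ^ 2 * (z * (1 + z)) := by
      rw [hDel]; simp only [hρ, hsdef]; ring
    have hD0 : Delta M a Q (ρ z) ≠ 0 := by
      rw [hD]; positivity
    have dD : HasDerivAt (fun r => (Delta M a Q r : ℂ)) ((s * (1 + 2 * z) : ℝ) : ℂ) (ρ z) := by
      have h1 : HasDerivAt (Delta M a Q) (2 * ρ z - 2 * M) (ρ z) := by
        unfold Delta
        have := ((((hasDerivAt_id (ρ z)).pow 2).sub
          ((hasDerivAt_id (ρ z)).const_mul (2 * M))).add_const (a ^ 2)).add_const (Q ^ 2)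
        refine this.congr_deriv ?_
        simp
      refine (h1.congr_deriv ?_).ofReal_comp
      simp only [hρ, hsdef]
      linear_combination hadd
    have hode := hR.ode (ρ z) (hρpos z hz)
    have hdd : deriv (fun r : ℝ => (Delta M a Q r : ℂ) * deriv R r) (ρ z) = _ :=
      (dD.mul (dR1 _ (hρpos z hz))).deriv
    rw [hdd] at hode
    -- the real identities behind the change of variables
    set k : ℝ := Ω / 2 * z * (1 + z) - α * (1 + z) - γ * z with hk
    -- The phase is chosen so that its derivative is `-k / (z(1+z))`: conjugating by it cancels the
    -- potential `k² / (z(1+z))` and leaves the terms `2ik f'` and `ik' f`.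
    have hθk : z * (1 + z) * θ₁ z = -k := by
      simp only [hθ₁, heunPhaseDeriv, hk]; field_simp; ring
    have hθ₂k : z * (1 + z) * θ₂ z + (1 + 2 * z) * θ₁ z = -(Ω * (z + 1 / 2) - (α + γ)) := by
      simp only [hθ₁, hθ₂, heunPhaseDeriv]; field_simp; ring
    have hsα : s * α = a * m - (rPlus M a Q ^ 2 + a ^ 2) * ω := by
      simp only [hα, heunAlpha, ← hsdef]; field_simp
    have hsγ : s * γ = (rMinus M a Q ^ 2 + a ^ 2) * ω - a * m := by
      simp only [hγ, heunGamma, ← hsdef]; field_simp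
    have hsk : s * k = (ρ z ^ 2 + a ^ 2) * ω - a * m := by
      have : s * k = ω * s ^ 2 * (z * (1 + z)) - s * α * (1 + z) - s * γ * z := by
        simp only [hk, hΩ, heunOmega, ← hsdef]; ring
      rw [this, hsα, hsγ]
      simp only [hρ, hsdef]
      ring
    have hV : -(ω ^ 2 * (a ^ 2 - (a ^ 2 + ρ z ^ 2) ^ 2 / Delta M a Q (ρ z)))
        + a ^ 2 * m ^ 2 / Delta M a Q (ρ z)
        - 2 * a * m * ω * (2 * M * ρ z - Q ^ 2) / Delta M a Q (ρ z) - L =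
        k ^ 2 / (z * (1 + z)) - (L + a ^ 2 * ω ^ 2 - 2 * a * m * ω) := by
      have h1 : k ^ 2 / (z * (1 + z)) = (s * k) ^ 2 / Delta M a Q (ρ z) := by
        rw [hD]; field_simp
      -- This substitution completes the square: the singular part becomes `((r² + a²)ω - am)² / Δ`,
      -- and the leftover constant `2amω` is absorbed into `Λ`.
      have h2 : 2 * M * ρ z - Q ^ 2 = ρ z ^ 2 + a ^ 2 - Delta M a Q (ρ z) := by
        unfold Delta; ring
      rw [h1, hsk, h2]
      field_simp
      ring
    have hVc := congrArg (fun x : ℝ => (x : ℂ)) hV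
    push_cast at hVc
    have hode' : (s : ℂ) * (1 + 2 * z) * deriv R (ρ z) +
        s ^ 2 * (z * (1 + z)) * deriv (deriv R) (ρ z) +
        ((k : ℂ) ^ 2 / (z * (1 + z)) - (L + a ^ 2 * ω ^ 2 - 2 * a * m * ω)) * R (ρ z) = 0 := by
      rw [← hVc]
      rw [hD] at hode ⊢
      push_cast at hode ⊢
      linear_combination hode
    have zc : (z : ℂ) ≠ 0 := by exact_mod_cast hz.ne'
    have zc1 := one_add_ofReal_ne_zero hz
    have hθkc : (z : ℂ) * (1 + z) * θ₁ z = -k := by exact_mod_cast hθk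
    have hθ₂kc : (z : ℂ) * (1 + z) * θ₂ z + (1 + 2 * z) * θ₁ z =
        -(Ω * (z + 1 / 2) - (α + γ)) := by
      have := congrArg Complex.ofReal hθ₂k
      push_cast at this
      exact this
    have hkc : (Ω : ℂ) / 2 * z * (1 + z) - α * (1 + z) - γ * z = k := by
      simp only [hk]; push_cast; ring
    have hk2 : (k : ℂ) ^ 2 / (z * (1 + z)) = -k * θ₁ z := by
      rw [div_eq_iff (mul_ne_zero zc zc1)]
      linear_combination (k : ℂ) * hθkc
    rw [hk2] at hode'
    rw [hkc]
    have hf : heunOfRadial M a Q ω m R z = e z * R (ρ z) := rfl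
    rw [hf]
    push_cast
    have hII : Complex.I ^ 2 = -1 := Complex.I_sq
    linear_combination (e z) * hode' + (e z * Complex.I * R (ρ z)) * hθ₂kc +
      (e z * (Complex.I ^ 2 * θ₁ z * R (ρ z) + 2 * Complex.I * s * deriv R (ρ z))) * hθkc +
      (e z * k * θ₁ z * R (ρ z)) * hII

end Radial

/-! ### Boundary conditions in the Heun variable, and conclusion -/

section BoundaryConditions

variable {M a Q : ℝ}

theorem heunOmega_ne_zero (hsub : a ^ 2 + Q ^ 2 < M ^ 2) {ω : ℝ} (hω : ω ≠ 0) :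
    heunOmega M a Q ω ≠ 0 :=
  mul_ne_zero (mul_ne_zero two_ne_zero hω) (rPlus_sub_rMinus_pos hsub).ne'

/-- In the sum `α + γ` the contributions of `am` cancel, leaving `-(r₊ + r₋) ω = -2Mω`. The sign
therefore holds for every frequency and azimuthal number, superradiant ones included. -/
theorem heunOmega_mul_le (hM : 0 < M) (hsub : a ^ 2 + Q ^ 2 < M ^ 2) (ω : ℝ) (m : ℤ) :
    heunOmega M a Q ω * (heunAlpha M a Q ω m + heunGamma M a Q ω m) ≤ 0 := by
  have hs := rPlus_sub_rMinus_pos hsub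
  have hadd := rPlus_add_rMinus (M := M) (a := a) (Q := Q)
  have h : heunOmega M a Q ω * (heunAlpha M a Q ω m + heunGamma M a Q ω m) =
      -(4 * M * ω ^ 2 * (rPlus M a Q - rMinus M a Q)) := by
    unfold heunOmega heunAlpha heunGamma
    field_simp
    linear_combination (-2 * ω ^ 2 * (rPlus M a Q - rMinus M a Q)) * hadd
  rw [h]
  have := sq_nonneg ω
  exact neg_nonpos.2 (by positivity)

/-- Because `r₊` is a root of `Δ`, `2Mr₊ - Q² = r₊² + a²`. -/
theorem horizonExponent_eq (hsub : a ^ 2 + Q ^ 2 < M ^ 2) (ω : ℝ) (m : ℤ) :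
    horizonExponent M a Q ω m = Complex.I * heunAlpha M a Q ω m := by
  have hadd := rPlus_add_rMinus (M := M) (a := a) (Q := Q)
  have hmul := rPlus_mul_rMinus hsub
  have h : rPlus M a Q ^ 2 + a ^ 2 = 2 * M * rPlus M a Q - Q ^ 2 := by
    linear_combination rPlus M a Q * hadd - hmul
  unfold horizonExponent heunAlpha
  rw [h]
  push_cast
  ring

theorem log_horizon_scale (hsub : a ^ 2 + Q ^ 2 < M ^ 2) {z : ℝ} (hz : 0 < z) :
    Real.log (rPlus M a Q + (rPlus M a Q - rMinus M a Q) * z - rPlus M a Q) =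
      Real.log (rPlus M a Q - rMinus M a Q) + Real.log z := by
  rw [add_sub_cancel_left, Real.log_mul (rPlus_sub_rMinus_pos hsub).ne' hz.ne']

theorem log_inner_scale (hsub : a ^ 2 + Q ^ 2 < M ^ 2) {z : ℝ} (hz : 0 < z) :
    Real.log (rPlus M a Q + (rPlus M a Q - rMinus M a Q) * z - rMinus M a Q) =
      Real.log (rPlus M a Q - rMinus M a Q) + Real.log (1 + z) := by
  rw [← Real.log_mul (rPlus_sub_rMinus_pos hsub).ne' (by linarith : (1 + z) ≠ 0)]
  congr 1
  ring

/-- Regularity at the horizon in terms of the Heun solution. -/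
theorem RegularAtHorizon.exists_contDiffAt (hsub : a ^ 2 + Q ^ 2 < M ^ 2) {ω : ℝ} {m : ℤ}
    {R : ℝ → ℂ} (hR : RegularAtHorizon M a Q ω m R) :
    ∃ h : ℝ → ℂ, ContDiffAt ℝ 2 h 0 ∧
      ∀ᶠ z in 𝓝[>] 0, heunOfRadial M a Q ω m R z = osc (heunAlpha M a Q ω m) z * h z := by
  obtain ⟨F, hF, hRF⟩ := hR
  have hs := rPlus_sub_rMinus_pos hsub
  rw [horizonExponent_eq hsub] at hRF
  set s := rPlus M a Q - rMinus M a Q with hsdef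
  set Ω := heunOmega M a Q ω with hΩ
  set α := heunAlpha M a Q ω m with hα
  set γ := heunGamma M a Q ω m with hγ
  have hlim : Tendsto (fun z : ℝ => rPlus M a Q + s * z) (𝓝[>] 0) (𝓝[>] (rPlus M a Q)) := by
    refine tendsto_nhdsWithin_of_tendsto_nhds_of_eventually_within _ ?_ ?_
    · have : Continuous fun z : ℝ => rPlus M a Q + s * z := by fun_prop
      simpa using (this.tendsto 0).mono_left nhdsWithin_le_nhds
    · filter_upwards [self_mem_nhdsWithin] with z hz
      have : 0 < s * z := mul_pos hs hz
      exact mem_Ioi.2 (by linarith)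
  -- `R` contributes `(sz)^{iα}` and the phase another `z^{iα}`; together they form the oscillating
  -- factor `z^{2iα}`. The constant `s^{iα}` and the smooth remainder of the phase go into `h`.
  refine ⟨fun z => Complex.exp (Complex.I * ((α * Real.log s + γ * Real.log (1 + z) -
    Ω / 2 * z : ℝ) : ℂ)) * F (rPlus M a Q + s * z), ?_, ?_⟩
  · refine ContDiffAt.mul ?_ ?_
    · refine ContDiffAt.cexp (contDiffAt_const.mul ?_)
      refine Complex.ofRealCLM.contDiff.contDiffAt.comp (0 : ℝ) ?_
      have hlog : ContDiffAt ℝ 2 (fun z : ℝ => Real.log (1 + z)) 0 :=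
        (contDiffAt_const.add contDiffAt_id).log (by simp)
      exact (contDiffAt_const.add (contDiffAt_const.mul hlog)).sub
        (contDiffAt_const.mul contDiffAt_id)
    · refine ContDiffAt.comp (0 : ℝ) ?_ (contDiffAt_const.add (contDiffAt_const.mul contDiffAt_id))
      simpa using hF.of_le (WithTop.coe_le_coe.2 (le_top : (2 : ℕ∞) ≤ ⊤))
  · filter_upwards [hlim.eventually hRF, self_mem_nhdsWithin] with z hz hz0
    have hz0 : 0 < z := hz0
    have hne : ((rPlus M a Q + s * z - rPlus M a Q : ℝ) : ℂ) ≠ 0 := by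
      rw [add_sub_cancel_left]; exact_mod_cast (mul_pos hs hz0).ne'
    have hnn : 0 ≤ rPlus M a Q + s * z - rPlus M a Q := by
      rw [add_sub_cancel_left]; exact (mul_pos hs hz0).le
    rw [Complex.cpow_def_of_ne_zero hne, ← Complex.ofReal_log hnn, hsdef,
      log_horizon_scale hsub hz0, ← hsdef] at hz
    simp only [heunOfRadial, osc, heunPhase, ← hsdef, ← hΩ, ← hα, ← hγ]
    rw [← hz, mul_left_comm (Complex.exp _) (R _), mul_left_comm (Complex.exp _) (R _),
      mul_comm (Complex.exp _) (R _), ← Complex.exp_add, ← Complex.exp_add]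
    congr 2
    push_cast
    ring

/-- The linear terms cancel, and so do the logarithmic divergences at infinity. Only `log (1 + 1/z)`
survives, which tends to `0`, so multiplying by the phase removes the whole outgoing oscillation of
`R`. -/
theorem heunPhase_add_rStar (hsub : a ^ 2 + Q ^ 2 < M ^ 2) (ω : ℝ) (m : ℤ) {z : ℝ} (hz : 0 < z) :
    heunPhase (heunOmega M a Q ω) (heunAlpha M a Q ω m) (heunGamma M a Q ω m) z +
      ω * rStar M a Q (rPlus M a Q + (rPlus M a Q - rMinus M a Q) * z) =
    ω * rPlus M a Q + 2 * M * ω * Real.log (rPlus M a Q - rMinus M a Q) -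
      a * m / (rPlus M a Q - rMinus M a Q) * Real.log (1 + z⁻¹) := by
  have hs := (rPlus_sub_rMinus_pos hsub).ne'
  have hlog : Real.log (1 + z⁻¹) = Real.log (1 + z) - Real.log z := by
    rw [← Real.log_div (by linarith : (1 + z) ≠ 0) hz.ne']
    congr 1
    field_simp
    ring
  rw [hlog, ← rPlus_add_rMinus (M := M) (a := a) (Q := Q)]
  simp only [heunPhase, heunOmega, heunAlpha, heunGamma, rStar]
  rw [log_horizon_scale hsub hz, log_inner_scale hsub hz]
  field_simp
  ring

/-- The outgoing condition in terms of the Heun solution. -/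
theorem OutgoingAtInfinity.exists_tendsto (hsub : a ^ 2 + Q ^ 2 < M ^ 2) {ω : ℝ} (m : ℤ)
    {R : ℝ → ℂ} (hR : OutgoingAtInfinity M a Q ω R) :
    ∃ c : ℂ, Tendsto (fun z : ℝ => (1 + (z : ℂ)) * heunOfRadial M a Q ω m R z) atTop (𝓝 c) := by
  obtain ⟨C, hC⟩ := hR
  have hs := rPlus_sub_rMinus_pos hsub
  -- The expansion to order `N = 1` suffices: its remainder `O(r⁻³)` tends to zero even after
  -- multiplication by `1 + z`.
  have hO := hC 1 le_rfl
  have hphase := fun (z : ℝ) (hz : 0 < z) => heunPhase_add_rStar hsub ω m hz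
  set s := rPlus M a Q - rMinus M a Q with hsdef
  set ρ : ℝ → ℝ := fun z => rPlus M a Q + s * z with hρ
  set θ := heunPhase (heunOmega M a Q ω) (heunAlpha M a Q ω m) (heunGamma M a Q ω m) with hθ
  set E : ℝ → ℂ := fun r => Complex.exp (Complex.I * ω * rStar M a Q r) / r *
    ∑ k ∈ Finset.range (1 + 1), C k * ((r : ℂ) ^ k)⁻¹ with hE
  have hρlim : Tendsto ρ atTop atTop :=
    tendsto_atTop_add_const_left _ _ (tendsto_id.const_mul_atTop hs)
  have hinv : Tendsto (fun z => (ρ z)⁻¹) atTop (𝓝 0) := tendsto_inv_atTop_zero.comp hρlim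
  have hratio : Tendsto (fun z => (1 + z) * (ρ z)⁻¹) atTop (𝓝 s⁻¹) := by
    have h : Tendsto (fun z => s⁻¹ + (1 - rPlus M a Q * s⁻¹) * (ρ z)⁻¹) atTop (𝓝 (s⁻¹ +
        (1 - rPlus M a Q * s⁻¹) * 0)) := (hinv.const_mul _).const_add _
    rw [mul_zero, add_zero] at h
    refine h.congr' ?_
    filter_upwards [hρlim.eventually_ne_atTop 0] with z hz
    field_simp
    simp only [hρ]
    ring
  have hinvc : Tendsto (fun z => ((ρ z : ℝ) : ℂ)⁻¹) atTop (𝓝 0) := by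
    have := (Complex.continuous_ofReal.tendsto 0).comp hinv
    simpa [Function.comp_def] using this
  have hratioc : Tendsto (fun z : ℝ => (1 + (z : ℂ)) * ((ρ z : ℝ) : ℂ)⁻¹) atTop
      (𝓝 ((s⁻¹ : ℝ) : ℂ)) := by
    have := (Complex.continuous_ofReal.tendsto _).comp hratio
    simpa [Function.comp_def] using this
  have hsmall : Tendsto (fun z : ℝ => (1 + (z : ℂ)) * (R (ρ z) - E (ρ z))) atTop (𝓝 0) := by
    have hone : (fun z : ℝ => 1 + (z : ℂ)) =O[atTop] fun z : ℝ => 1 + z :=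
      Asymptotics.IsBigO.of_bound 1 (Eventually.of_forall fun z => by
        rw [one_mul, ← Complex.norm_real]; push_cast; rfl)
    refine (hone.mul (hO.comp_tendsto hρlim)).trans_tendsto ?_
    have h3 := hratio.mul (hinv.mul hinv)
    rw [mul_zero, mul_zero] at h3
    refine h3.congr fun z => ?_
    simp only [Function.comp_apply]
    ring_nf
  have hphaselim : Tendsto (fun z : ℝ => Complex.exp (Complex.I * ((θ z + ω * rStar M a Q (ρ z) :
      ℝ) : ℂ))) atTop (𝓝 (Complex.exp (Complex.I * ((ω * rPlus M a Q + 2 * M * ω * Real.log s -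
        a * m / s * Real.log (1 + 0) : ℝ) : ℂ)))) := by
    have hlog : Tendsto (fun z : ℝ => Real.log (1 + z⁻¹)) atTop (𝓝 (Real.log (1 + 0))) :=
      (tendsto_inv_atTop_zero.const_add 1).log (by simp)
    have h := ((Complex.continuous_ofReal.tendsto _).comp ((hlog.const_mul (a * m / s)).const_sub
      (ω * rPlus M a Q + 2 * M * ω * Real.log s))).const_mul Complex.I
    refine (h.cexp).congr' ?_
    filter_upwards [eventually_gt_atTop 0] with z hz
    rw [hphase z hz]
    rfl
  have hbdd : Tendsto (fun z : ℝ => Complex.exp (Complex.I * θ z) *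
      ((1 + (z : ℂ)) * (R (ρ z) - E (ρ z)))) atTop (𝓝 0) := by
    rw [tendsto_zero_iff_norm_tendsto_zero] at hsmall ⊢
    refine hsmall.congr fun z => ?_
    rw [norm_mul (Complex.exp _), mul_comm Complex.I, Complex.norm_exp_ofReal_mul_I, one_mul]
  have hmain := hphaselim.mul (hratioc.mul ((hinvc.const_mul (C 1)).const_add (C 0)))
  refine ⟨_, (hbdd.add hmain).congr fun z => ?_⟩
  simp only [heunOfRadial, ← hsdef, ← hθ, hE]
  rw [show rPlus M a Q + s * z = ρ z from rfl]
  simp only [Finset.sum_range_succ, Finset.sum_range_zero, pow_zero, pow_one, inv_one]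
  push_cast
  rw [mul_add Complex.I, Complex.exp_add, ← mul_assoc Complex.I]
  ring

/-- A radial function satisfying both boundary conditions at a real frequency is trivial. -/
theorem IsRadialSolution.eq_zero (hM : 0 < M) (hsub : a ^ 2 + Q ^ 2 < M ^ 2) {ω L : ℝ}
    (hω : ω ≠ 0) {m : ℤ} {R : ℝ → ℂ} (hR : IsRadialSolution M a Q ω m L R)
    (hhor : RegularAtHorizon M a Q ω m R) (hinf : OutgoingAtInfinity M a Q ω R)
    {r : ℝ} (hr : rPlus M a Q < r) : R r = 0 := by
  obtain ⟨f₁, f₂, hf⟩ := hR.exists_isHeunSolution hsub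
  obtain ⟨h, hh, hfh⟩ := hhor.exists_contDiffAt hsub
  obtain ⟨c, hc⟩ := hinf.exists_tendsto hsub m
  have hs := rPlus_sub_rMinus_pos hsub
  have h0 := hf.eq_zero (heunOmega_ne_zero hsub hω) (heunOmega_mul_le hM hsub ω m) hc hh hfh
    ((r - rPlus M a Q) / (rPlus M a Q - rMinus M a Q)) (div_pos (sub_pos.2 hr) hs)
  rw [heunOfRadial, mul_div_cancel₀ _ hs.ne', add_sub_cancel] at h0
  exact (mul_eq_zero.1 h0).resolve_left (Complex.exp_ne_zero _)

end BoundaryConditions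

end KerrNewman

/-- Mode stability on the real axis: a mode solution of the wave equation on a subextremal
Kerr–Newman exterior with real frequency `ω ≠ 0` vanishes identically. -/
theorem theorem3p2 (M a Q : ℝ) (hM : 0 < M) (hsub : a ^ 2 + Q ^ 2 < M ^ 2)
    (ω : ℝ) (hω : ω ≠ 0) (ψ : ℝ × ℝ × KerrNewman.S2 → ℂ)
    (hψ : KerrNewman.IsModeSolution M a Q ψ (ω : ℂ)) :
    ∀ p ∈ KerrNewman.exterior M a Q, ψ p = 0 := by
  obtain ⟨⟨hsmooth, -⟩, -, m, lam, R, S, hform, hS, hR, hhor, hinf⟩ := hψ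
  -- Conservation of the flux requires a real Heun parameter `Λ`, hence a real separation constant.
  have hlam : lam = ((lam.re : ℝ) : ℂ) := Complex.ext rfl (by simpa using hS.im_eq_zero)
  rw [hlam] at hR
  refine KerrNewman.eq_zero_of_eq_zero_off_axis hsmooth.continuousOn fun t r hr θ hθ φ => ?_
  rw [hform t r hr θ hθ φ, hR.eq_zero hM hsub hω hhor hinf hr]
  simp
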